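/- Fix a finite terminal alphabet $T$. **Multiple context-free grammars.** An MCFG over $T$ consists of a finite set of predicate symbols, each of nonzero arity, a unary initial symbol $S$ among them, and a finite set of productions $$B_1(x^1_1,\ldots,x^1_{k_1}),\ldots,B_n(x^n_1,\ldots,x^n_{k_n})\vdash A(s_1,\ldots,s_k)\qquad(n\ge 0),$$ where $A,B_1,\ldots,B_n$ are predicate symbols of arities $k,k_1,\ldots,k_n$, the $x^j_i$ are pairwise distinct variables, and $s_1,\ldots,s_k$ are words built of terminal symbols and these variables such that each $x^j_i$ occurs exactly once in exactly one of $s_1,\ldots,s_k$. The derivable formulas are defined inductively: if $B_j(s^j_1,\ldots,s^j_{k_j})$ is derivable for every $j$, then so is $A(t_1,\ldots,t_k)$, where $t_m$ is obtained from $s_m$ by substituting $s^j_i$ for $x^j_i$. The generated language is $\{w\in T^*: S(w)\text{ is derivable}\}$. **Cowordisms.** A *boundary* $X$ is a finite linearly ordered set of vertices, each declared a left or a right endpoint. $X\otimes Y$ is concatenation, $X^\bot$ is obtained by reversing the order and all polarities, and $\mathbf 1$ is the empty boundary. A *multiword* with boundary $X$ is a perfect matching of the vertices of $X$ by directed edges,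 each labelled with a word over $T$ and going from a left to a right endpoint, together with a finite multiset of cyclic words; it is *regular* if this multiset is empty. Two adjacent vertices $n,n+1$ of opposite polarity are *contracted* by gluing them: if $x$ is the right and $y$ the left endpoint among them, the edges $[\alpha,u,x]$ and $[y,v,\beta]$ are replaced by $[\alpha,uv,\beta]$, and if there is an edge $[y,w,x]$, it is removed and the cyclic word $[w]$ is added. A *cowordism* $X\to Y$ is a multiword with boundary $X^\bot\otimes Y$. **Linear logic grammars.** An LLG over $T$ consists of a set $N$ of atoms; an assignment $\xi$ of a boundary to each atom; a finite set of axioms (the *lexicon*), each a pair of a sequent $\vdash\Gamma$ of multiplicative linear logic over $N$ and a cowordism $\mathbf 1\to\xi(\Gamma)$; and an initial atom $S$ such that $\xi(S)$ has two vertices, exactly one of them left. Formulas are built from the literals $p,p^\bot$ ($p\in N$) by $\otimes$ and $\parr$; negation is defined by $p^{\bot\bot}=p$, $(A\otimes B)^\bot=B^\bot\parr A^\bot$, $(A\parr B)^\bot=B^\bot\otimes A^\bot$. The interpretation extends by $\xi(A^\bot)=\xi(A)^\bot$, $\xi(A\otimes B)=\xi(A\parr B)=\xi(A)\otimes\xi(B)$,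 $\xi(A_1,\ldots,A_n)=\xi(A_1)\otimes\cdots\otimes\xi(A_n)$. Derivations use the lexicon and the rules $$\vdash X^\bot,X\ (\mathrm{Id}),\quad \frac{\vdash\Gamma,X\quad\vdash X^\bot,\Delta}{\vdash\Gamma,\Delta}\ (\mathrm{Cut}),\quad \frac{\vdash\Gamma,X,Y,\Delta}{\vdash\Gamma,Y,X,\Delta}\ (\mathrm{Ex}),\quad \frac{\vdash\Gamma,X,Y}{\vdash\Gamma,X\parr Y}\ (\parr),\quad \frac{\vdash\Gamma,X\quad\vdash Y,\Delta}{\vdash\Gamma,X\otimes Y,\Delta}\ (\otimes),$$ and are interpreted by cowordisms: (Id) by the identity cowordism, which matches corresponding vertices of $\xi(X)^\bot$ and $\xi(X)$ by edges labelled with the empty word; (Cut) by the disjoint union of the two multiwords, contracted along $\xi(X)\otimes\xi(X)^\bot$ from the middle outwards; (Ex) by exchanging the two blocks of vertices; ($\parr$) by the same multiword; ($\otimes$) by the disjoint union of the two multiwords. The generated language consists of the words labelling the single edge of the regular cowordisms that interpret derivations of $\vdash S$. The lexicon is *$\otimes$-free* if no formula in its sequents contains $\otimes$. **Theorem.** A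 language $L\subseteq T^*$ is generated by some MCFG over $T$ if and only if it is generated by some LLG over $T$ with $\otimes$-free lexicon. -/

import Mathlib

universe u v

namespace LinLog

/-! ### Boundaries -/

inductive Polarity where
  | left
  | right

def Polarity.flip : Polarity → Polarity
  | .left => .right
  | .right => .left

/-- A boundary: the cardinality is the length of the list, the vertices are the positions
`0, …, length - 1`, and the left endpoints are the positions that hold `Polarity.left`.
The tensor product of boundaries is concatenation `++`, the unit boundary is `[]`. -/
abbrev Boundary := List Polarity

/-- The dual boundary: order and polarity reversal. -/
def Boundary.dual (X : Boundary) : Boundary := (X.map Polarity.flip).reverse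

/-! ### Multiwords -/

/-- A directed edge `[src, label, tgt]` labelled with a word. -/
structure Edge (T : Type u) where
  src : ℕ
  label : List T
  tgt : ℕ

/-- The data of a multiword: the set of labelled edges of the regular part, and a finite multiset
of cyclic words, the singular part. -/
structure Multiword (T : Type u) where
  edges : Set (Edge T)
  cyc : Multiset (Cycle T)

namespace Multiword

variable {T : Type u}

/-- `M` is a multiword with boundary `X`: its edges go from left endpoints to right endpoints of
`X`, and form a perfect matching of the vertices of `X`. -/
structure HasBoundary (M : Multiword T) (X : Boundary) : Prop where
  polarity : ∀ e ∈ M.edges, X[e.src]? = some .left ∧ X[e.tgt]? = some .right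
  matching : ∀ i < X.length, ∃! e, e ∈ M.edges ∧ (e.src = i ∨ e.tgt = i)

/-- `σ` is a cowordism from `X` to `Y`. -/
def IsCowordism (X Y : Boundary) (σ : Multiword T) : Prop :=
  σ.HasBoundary (X.dual ++ Y)

/-- A multiword is regular if its singular part is empty. -/
def IsRegular (M : Multiword T) : Prop := M.cyc = 0

/-- Renaming of the vertices. -/
def rename (f : ℕ → ℕ) (M : Multiword T) : Multiword T where
  edges := (fun e => ⟨f e.src, e.label, f e.tgt⟩) '' M.edges
  cyc := M.cyc

/-- The tensor product of multiwords `M` and `N`, where `k` is the cardinality of the boundary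
of `M`. -/
def tensor (k : ℕ) (M N : Multiword T) : Multiword T where
  edges := M.edges ∪ (N.rename (fun i => k + i)).edges
  cyc := M.cyc + N.cyc

/-- The identity cowordism of `X`, a multiword with boundary `X.dual ++ X`. -/
def identity (X : Boundary) : Multiword T where
  edges := {e | ∃ i, X[i]? = some .left ∧ e = ⟨X.length + i, [], X.length - 1 - i⟩} ∪
    {e | ∃ i, X[i]? = some .right ∧ e = ⟨X.length - 1 - i, [], X.length + i⟩}
  cyc := 0

/-- The shifted embedding that skips the vertices `n` and `n + 1`. -/
def shift (n i : ℕ) : ℕ := if i < n then i else i + 2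

/-- The edges of `M` that avoid `n` and `n + 1`, after removal of these two vertices. -/
def restrict (n : ℕ) (M : Multiword T) : Set (Edge T) :=
  {e | ⟨shift n e.src, e.label, shift n e.tgt⟩ ∈ M.edges}

open Classical in
/-- The elementary contraction along `n` and `n + 1`, where `x` is the right endpoint and `y` the
left endpoint among these two vertices. -/
noncomputable def contractPair (n x y : ℕ) (M : Multiword T) : Multiword T :=
  if h : ∃ w, (⟨y, w, x⟩ : Edge T) ∈ M.edges then
    { edges := M.restrict n
      cyc := M.cyc + {(h.choose : Cycle T)} }
  else
    { edges := M.restrict n ∪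
        {e | ∃ a u v b, (⟨shift n a, u, x⟩ : Edge T) ∈ M.edges ∧
          (⟨y, v, shift n b⟩ : Edge T) ∈ M.edges ∧ e = ⟨a, u ++ v, b⟩}
      cyc := M.cyc }

/-- The elementary contraction along `n` and `n + 1`, where `n + 1` has the given polarity and `n`
the opposite one. -/
noncomputable def contract (n : ℕ) : Polarity → Multiword T → Multiword T
  | .left, M => M.contractPair n n (n + 1)
  | .right, M => M.contractPair n (n + 1) n

/-- The iterated contraction along the subboundary `Y.dual ++ Y` that starts at the vertex `i`:
the last vertex of `Y.dual` is glued to the first vertex of `Y`, and so on outwards. -/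
noncomputable def contractAlong (i : ℕ) : Boundary → Multiword T → Multiword T
  | [], M => M
  | p :: Y, M => contractAlong i Y (M.contract (i + Y.length) p)

end Multiword

/-! ### Formulas of multiplicative linear logic -/

inductive Formula (N : Type v) where
  | pos : N → Formula N
  | neg : N → Formula N
  | tensor : Formula N → Formula N → Formula N
  | par : Formula N → Formula N → Formula N

namespace Formula

variable {N : Type v}

/-- Linear negation; it flips the factors. -/
def dual : Formula N → Formula N
  | pos a => neg a
  | neg a => pos a
  | tensor A B => par B.dual A.dual
  | par A B => tensor B.dual A.dual

/-- No tensor occurs in the formula. -/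
def TensorFree : Formula N → Prop
  | pos _ => True
  | neg _ => True
  | tensor _ _ => False
  | par A B => A.TensorFree ∧ B.TensorFree

/-- The interpretation of formulas that extends an interpretation of atoms by boundaries. -/
def interp (ξ : N → Boundary) : Formula N → Boundary
  | pos a => ξ a
  | neg a => (ξ a).dual
  | tensor A B => A.interp ξ ++ B.interp ξ
  | par A B => A.interp ξ ++ B.interp ξ

end Formula

/-- The interpretation of a sequent, as the cotensor of its formulas. -/
def seqInterp {N : Type v} (ξ : N → Boundary) (Γ : List (Formula N)) : Boundary :=
  Γ.flatMap (Formula.interp ξ)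

/-- The renaming of vertices that exchanges the block of `a` vertices starting at `g` with the
block of `b` vertices following it. -/
def exchange (g a b i : ℕ) : ℕ :=
  if i < g then i
  else if i < g + a then i + b
  else if i < g + a + b then i - a
  else i

/-! ### Linear logic grammars -/

/-- A linear logic grammar over the terminal alphabet `T`. The lexicon is a finite set of
cowordism typing judgements, that is, of pairs of a sequent `Γ` and a cowordism from the unit
boundary to the interpretation of `Γ`. -/
structure LLG (T : Type u) where
  Atom : Type v
  ξ : Atom → Boundary
  Lex : Set (List (Formula Atom) × Multiword T)
  lex_finite : Lex.Finite
  lex_typed : ∀ α ∈ Lex, Multiword.IsCowordism [] (seqInterp ξ α.1) α.2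
  S : Atom
  card_S : (ξ S).length = 2
  left_S : ∃! i : ℕ, (ξ S)[i]? = some Polarity.left

namespace LLG

variable {T : Type u}

/-- `G.Derivable Γ σ`: there is a derivation of `⊢ Γ` in the sequent calculus of multiplicative
linear logic from the axioms of `G` whose interpretation is `σ`. -/
inductive Derivable (G : LLG.{u, v} T) : List (Formula G.Atom) → Multiword T → Prop
  | lex {Γ : List (Formula G.Atom)} {σ : Multiword T} (h : (Γ, σ) ∈ G.Lex) : Derivable G Γ σ
  | id (X : Formula G.Atom) :
      Derivable G [X.dual, X] (Multiword.identity (X.interp G.ξ))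
  | cut {Γ Δ : List (Formula G.Atom)} {X : Formula G.Atom} {σ τ : Multiword T}
      (hσ : Derivable G (Γ ++ [X]) σ) (hτ : Derivable G ([X.dual] ++ Δ) τ) :
      Derivable G (Γ ++ Δ)
        ((Multiword.tensor (seqInterp G.ξ (Γ ++ [X])).length σ τ).contractAlong
          (seqInterp G.ξ Γ).length (X.dual.interp G.ξ))
  | ex {Γ Δ : List (Formula G.Atom)} {X Y : Formula G.Atom} {σ : Multiword T}
      (hσ : Derivable G (Γ ++ [X, Y] ++ Δ) σ) :
      Derivable G (Γ ++ [Y, X] ++ Δ)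
        (σ.rename (exchange (seqInterp G.ξ Γ).length
          (X.interp G.ξ).length (Y.interp G.ξ).length))
  | par {Γ : List (Formula G.Atom)} {X Y : Formula G.Atom} {σ : Multiword T}
      (hσ : Derivable G (Γ ++ [X, Y]) σ) :
      Derivable G (Γ ++ [X.par Y]) σ
  | tensor {Γ Δ : List (Formula G.Atom)} {X Y : Formula G.Atom} {σ τ : Multiword T}
      (hσ : Derivable G (Γ ++ [X]) σ) (hτ : Derivable G ([Y] ++ Δ) τ) :
      Derivable G (Γ ++ [X.tensor Y] ++ Δ)
        (Multiword.tensor (seqInterp G.ξ (Γ ++ [X])).length σ τ)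

/-- The language generated by `G`: the words that label the edge of a regular cowordism of type
`S` generated by `G`. -/
def language (G : LLG.{u, v} T) : Language T :=
  {w | ∃ σ : Multiword T, G.Derivable [Formula.pos G.S] σ ∧ σ.IsRegular ∧
    ∃ e ∈ σ.edges, e.label = w}

/-- The lexicon of `G` is `⊗`-free. -/
def TensorFreeLexicon (G : LLG.{u, v} T) : Prop :=
  ∀ α ∈ G.Lex, ∀ A ∈ α.1, A.TensorFree

end LLG

/-! ### Multiple context-free grammars -/

open Classical in
/-- A production `B_1(x^1_1, …), …, B_n(x^n_1, …) ⊢ A(s_1, …, s_k)` over the terminal alphabet `T`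
and the predicate symbols `N` with the given arities. The variable `x^j_i` is the pair `⟨j, i⟩`. -/
structure Production (T : Type u) (N : Type) (arity : N → ℕ) where
  head : N
  n : ℕ
  body : Fin n → N
  args : Fin (arity head) → List (T ⊕ (j : Fin n) × Fin (arity (body j)))
  linear : ∀ x : (j : Fin n) × Fin (arity (body j)),
    ∑ m, (args m).count (Sum.inr x) = 1

/-- A multiple context-free grammar over the terminal alphabet `T`. -/
structure MCFG (T : Type u) where
  N : Type
  finite_N : Finite N
  arity : N → ℕ
  arity_pos : ∀ A, 0 < arity A
  S : N
  arity_S : arity S = 1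
  P : Set (Production T N arity)
  finite_P : P.Finite

/-- Substitution of the words `t x` for the variables `x` in a word built of terminal symbols and
variables. -/
def substitute {T : Type u} {V : Type} (t : V → List T) (s : List (T ⊕ V)) : List T :=
  s.flatMap (Sum.elim (fun a => [a]) t)

namespace MCFG

variable {T : Type u}

/-- `G.Derivable A t`: the predicate formula `A(t_1, …, t_k)` is derivable in `G`. -/
inductive Derivable (G : MCFG T) : (A : G.N) → (Fin (G.arity A) → List T) → Prop
  | production (p : Production T G.N G.arity) (hp : p ∈ G.P)
      (t : (j : Fin p.n) → Fin (G.arity (p.body j)) → List T)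
      (ht : ∀ j, Derivable G (p.body j) (t j)) :
      Derivable G p.head (fun m => substitute (fun x => t x.1 x.2) (p.args m))

/-- The language generated by `G`: the words `w` for which `S(w)` is derivable. -/
def language (G : MCFG T) : Language T :=
  {w | G.Derivable G.S (fun _ => w)}

end MCFG

end LinLog

/-! A contraction glues edges end to end, so contracting a multiword amounts to tracing alternating
paths between its edges and the edges plugged into it. Cyclic words arise exactly when such a path
closes up. Everything is computed in this calculus of paths: composition is associative
(`path_union_push_iff`, `cyc_union_push_iff`), and `Multiword.contractAlong_spec` translates the
contraction of a cut into it.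

On top of this stands a realizability model of multiplicative linear logic. A formula is interpreted
by two families of edge sets over its boundary: realizers, and tests that may be plugged into
realizers. A realizer of a tensor is a disjoint union. A realizer of a par turns a test on either
side into a realizer on the other, unless a cycle closes. The interpretation of atoms is arbitrary,
and if the axioms realize their sequents, so do all regular derivable multiwords
(`LLG.Derivable.realizes`). Thus nothing is derivable beyond what the chosen interpretation of atoms
allows, and no cut elimination is needed.

For the converse bounds, formulas are interpreted by their closed derivable multiwords. Cutting a
derivable multiword against closed ones gives closed ones (`LLG.Derivable.realizes_closedPair`). Par
is invertible by means of cuts against identities, so for ⊗-free formulas closed multiwords are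
realizers over the closed multiwords of literals (`LLG.closed_tensorFree`). Hence a ⊗-free axiom
acts as a set of rules: edges plugged into all but one of its literals determine the edges at the
remaining literal.

From an MCFG to an LLG: a predicate of arity k becomes an atom whose boundary carries k edges, and a
production becomes an axiom with the body atoms negated and the head atom positive. Its edges spell
the words of the head between the variables; linearity makes them a perfect matching
(`Production.wires_spec`).

From an LLG to an MCFG: a predicate consists of a sign, an atom and a matching of the boundary of
the atom, and its arguments are the labels of the matched edges. Once the matchings plugged into an
axiom are fixed, the paths no longer depend on the words, so each choice gives at most one
production. If no cycle closes, every edge is used exactly once (`exists_wiring`), which is the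
linearity of productions. -/

namespace LinLog

variable {T : Type u} {N : Type v}

/-! ### Alternating paths -/

/-- `Path A B a w b`: a path from `a` to `b` labelled `w` in which edges of `A` and `B` alternate
and whose first and last edges belong to `A`. -/
inductive Path (A B : Set (Edge T)) : ℕ → List T → ℕ → Prop
  | single {a b : ℕ} {w : List T} (h : ⟨a, w, b⟩ ∈ A) : Path A B a w b
  | step {a x y b : ℕ} {u v w : List T} (hA : ⟨a, u, x⟩ ∈ A) (hB : ⟨x, v, y⟩ ∈ B)
      (hp : Path A B y w b) : Path A B a (u ++ (v ++ w)) b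

/-- There is a closed alternating path. -/
def Cyc (A B : Set (Edge T)) : Prop :=
  ∃ a u x v, Path A B a u x ∧ ⟨x, v, a⟩ ∈ B

def paths (A B : Set (Edge T)) : Set (Edge T) :=
  {e | Path A B e.src e.label e.tgt}

/-- The preimage of an edge set under a renaming of the vertices of `N`. -/
def pull (f : ℕ → ℕ) (N : Set ℕ) (E : Set (Edge T)) : Set (Edge T) :=
  {e | e.src ∈ N ∧ e.tgt ∈ N ∧ ⟨f e.src, e.label, f e.tgt⟩ ∈ E}

/-- The image of an edge set under a renaming of the vertices. -/
def push (f : ℕ → ℕ) (E : Set (Edge T)) : Set (Edge T) :=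
  (fun e => ⟨f e.src, e.label, f e.tgt⟩) '' E

/-- All endpoints of edges of `E` belong to `N`. -/
def SuppIn (N : Set ℕ) (E : Set (Edge T)) : Prop :=
  ∀ e ∈ E, e.src ∈ N ∧ e.tgt ∈ N

theorem SuppIn.mem {N : Set ℕ} {E : Set (Edge T)} (hE : SuppIn N E) {a b : ℕ} {w : List T}
    (h : (⟨a, w, b⟩ : Edge T) ∈ E) : a ∈ N ∧ b ∈ N := hE _ h

@[simp] theorem mem_paths {A B : Set (Edge T)} {a b : ℕ} {w : List T} :
    (⟨a, w, b⟩ : Edge T) ∈ paths A B ↔ Path A B a w b := Iff.rfl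

@[simp] theorem mem_pull {f : ℕ → ℕ} {N : Set ℕ} {E : Set (Edge T)} {a b : ℕ} {w : List T} :
    (⟨a, w, b⟩ : Edge T) ∈ pull f N E ↔ a ∈ N ∧ b ∈ N ∧ (⟨f a, w, f b⟩ : Edge T) ∈ E := Iff.rfl

theorem mem_push {f : ℕ → ℕ} {E : Set (Edge T)} {x y : ℕ} {w : List T} :
    (⟨x, w, y⟩ : Edge T) ∈ push f E ↔ ∃ a b, (⟨a, w, b⟩ : Edge T) ∈ E ∧ f a = x ∧ f b = y := by
  constructor
  · rintro ⟨⟨a, v, b⟩, h, he⟩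
    simp only [Edge.mk.injEq] at he
    obtain ⟨rfl, rfl, rfl⟩ := he
    exact ⟨a, b, h, rfl, rfl⟩
  · rintro ⟨a, b, h, rfl, rfl⟩
    exact ⟨_, h, rfl⟩

theorem mem_push_of_mem {f : ℕ → ℕ} {E : Set (Edge T)} {a b : ℕ} {w : List T}
    (h : (⟨a, w, b⟩ : Edge T) ∈ E) : (⟨f a, w, f b⟩ : Edge T) ∈ push f E := ⟨_, h, rfl⟩

theorem push_union (f : ℕ → ℕ) (E F : Set (Edge T)) : push f (E ∪ F) = push f E ∪ push f F :=
  Set.image_union _ _ _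

@[simp] theorem push_empty (f : ℕ → ℕ) : push f (∅ : Set (Edge T)) = ∅ := Set.image_empty _

theorem push_push (f g : ℕ → ℕ) (E : Set (Edge T)) : push f (push g E) = push (f ∘ g) E := by
  simp [push, Set.image_image]

theorem push_congr {f g : ℕ → ℕ} {N : Set ℕ} {E : Set (Edge T)} (hE : SuppIn N E)
    (h : ∀ i ∈ N, f i = g i) : push f E = push g E := by
  refine Set.image_congr fun e he => ?_
  rw [h _ (hE e he).1, h _ (hE e he).2]

theorem push_eq_self {f : ℕ → ℕ} {N : Set ℕ} {E : Set (Edge T)} (hE : SuppIn N E)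
    (h : ∀ i ∈ N, f i = i) : push f E = E := by
  rw [push_congr (g := fun i => i) hE h]
  exact Set.image_id E

theorem pull_congr {f g : ℕ → ℕ} {N : Set ℕ} {E : Set (Edge T)}
    (h : ∀ i ∈ N, f i = g i) : pull f N E = pull g N E := by
  ext ⟨a, w, b⟩
  simp only [mem_pull]
  constructor
  · rintro ⟨ha, hb, hE⟩
    exact ⟨ha, hb, by rwa [← h a ha, ← h b hb]⟩
  · rintro ⟨ha, hb, hE⟩
    exact ⟨ha, hb, by rwa [h a ha, h b hb]⟩

theorem suppIn_pull (f : ℕ → ℕ) (N : Set ℕ) (E : Set (Edge T)) : SuppIn N (pull f N E) :=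
  fun _ he => ⟨he.1, he.2.1⟩

theorem SuppIn.push {f : ℕ → ℕ} {N N' : Set ℕ} {E : Set (Edge T)} (hE : SuppIn N E)
    (hf : ∀ i ∈ N, f i ∈ N') : SuppIn N' (push f E) := by
  rintro _ ⟨e, he, rfl⟩
  exact ⟨hf _ (hE e he).1, hf _ (hE e he).2⟩

theorem SuppIn.mono {N N' : Set ℕ} {E : Set (Edge T)} (hE : SuppIn N E) (h : N ⊆ N') :
    SuppIn N' E := fun e he => ⟨h (hE e he).1, h (hE e he).2⟩

theorem SuppIn.union {N : Set ℕ} {E F : Set (Edge T)} (hE : SuppIn N E) (hF : SuppIn N F) :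
    SuppIn N (E ∪ F) := by
  rintro e (he | he)
  exacts [hE e he, hF e he]

theorem pull_push {f : ℕ → ℕ} {N : Set ℕ} {E : Set (Edge T)} (hE : SuppIn N E)
    (hf : Set.InjOn f N) : pull f N (push f E) = E := by
  ext ⟨a, w, b⟩
  simp only [mem_pull, mem_push]
  constructor
  · rintro ⟨ha, hb, c, d, h, h1, h2⟩
    have hcd := hE _ h
    rw [← hf hcd.1 ha h1, ← hf hcd.2 hb h2]
    exact h
  · intro h
    exact ⟨(hE _ h).1, (hE _ h).2, a, b, h, rfl, rfl⟩

theorem pull_pull {f g : ℕ → ℕ} {N N' : Set ℕ} {E : Set (Edge T)} (h : ∀ i ∈ N, g i ∈ N') :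
    pull g N (pull f N' E) = pull (f ∘ g) N E := by
  ext ⟨a, w, b⟩
  simp only [mem_pull, Function.comp]
  exact ⟨fun h => ⟨h.1, h.2.1, h.2.2.2.2⟩, fun h' => ⟨h'.1, h'.2.1, h _ h'.1, h _ h'.2.1, h'.2.2⟩⟩

namespace Path

variable {A B : Set (Edge T)}

theorem mono {A' B' : Set (Edge T)} (hA : A ⊆ A') (hB : B ⊆ B') {a b : ℕ} {w : List T}
    (h : Path A B a w b) : Path A' B' a w b := by
  induction h with
  | single h => exact .single (hA h)
  | step h1 h2 _ ih => exact .step (hA h1) (hB h2) ih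

theorem trans {a x y b : ℕ} {u v w : List T} (h : Path A B a u x) (hB : ⟨x, v, y⟩ ∈ B)
    (h' : Path A B y w b) : Path A B a (u ++ (v ++ w)) b := by
  induction h with
  | single h => exact .step h hB h'
  | step h1 h2 _ ih =>
    have := Path.step h1 h2 (ih hB)
    simpa [List.append_assoc] using this

theorem head {a b : ℕ} {w : List T} (h : Path A B a w b) : ∃ u x, (⟨a, u, x⟩ : Edge T) ∈ A := by
  cases h with
  | single h => exact ⟨_, _, h⟩
  | step h _ _ => exact ⟨_, _, h⟩

theorem last {a b : ℕ} {w : List T} (h : Path A B a w b) : ∃ u x, (⟨x, u, b⟩ : Edge T) ∈ A := by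
  induction h with
  | single h => exact ⟨_, _, h⟩
  | step _ _ _ ih => exact ih

theorem mem_of_suppIn {N : Set ℕ} (hA : SuppIn N A) {a b : ℕ} {w : List T} (h : Path A B a w b) :
    a ∈ N ∧ b ∈ N := by
  obtain ⟨_, _, h1⟩ := h.head
  obtain ⟨_, _, h2⟩ := h.last
  exact ⟨(hA _ h1).1, (hA _ h2).2⟩

theorem empty_right {a b : ℕ} {w : List T} : Path A ∅ a w b ↔ (⟨a, w, b⟩ : Edge T) ∈ A := by
  refine ⟨fun h => ?_, .single⟩
  cases h with
  | single h => exact h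
  | step _ h _ => exact h.elim

end Path

theorem paths_empty_right (A : Set (Edge T)) : paths A ∅ = A := by
  ext ⟨a, w, b⟩
  exact Path.empty_right

theorem not_cyc_empty (A : Set (Edge T)) : ¬ Cyc A ∅ := by
  rintro ⟨_, _, _, _, _, h⟩
  exact h

theorem Cyc.mono {A B A' B' : Set (Edge T)} (hA : A ⊆ A') (hB : B ⊆ B') (h : Cyc A B) :
    Cyc A' B' := by
  obtain ⟨a, u, x, v, h1, h2⟩ := h
  exact ⟨a, u, x, v, h1.mono hA hB, hB h2⟩

theorem suppIn_paths {A B : Set (Edge T)} {N : Set ℕ} (hA : SuppIn N A) :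
    SuppIn N (paths A B) := fun _ he => Path.mem_of_suppIn hA he

/-! #### Iterated alternation -/

section Assoc

variable {A B C : Set (Edge T)} {f : ℕ → ℕ} {N : Set ℕ}

theorem path_of_path_pull {a b : ℕ} {w : List T}
    (h : Path (pull f N (paths A B)) C a w b) : Path A (B ∪ push f C) (f a) w (f b) := by
  induction h with
  | single h => exact Path.mono subset_rfl Set.subset_union_left h.2.2
  | step h1 h2 _ ih =>
    exact Path.trans (Path.mono subset_rfl Set.subset_union_left h1.2.2)
      (Or.inr (mem_push_of_mem h2)) ih

/-- The path is split at its first edge from `C`. Every later stretch between `C`-edges has its ends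
at images of points of `N`, hence is an edge of the pulled-back composite. Injectivity of `f` is not
needed, because each pushed edge comes with its own preimages. -/
theorem path_union_push_cases (hC : SuppIn N C) {p q : ℕ} {w : List T}
    (h : Path A (B ∪ push f C) p w q) : ∀ b ∈ N, q = f b →
      Path A B p w q ∨ ∃ u x v y w', Path A B p u (f x) ∧ (⟨x, v, y⟩ : Edge T) ∈ C ∧
        Path (pull f N (paths A B)) C y w' b ∧ w = u ++ (v ++ w') := by
  induction h with
  | single h => exact fun _ _ _ => Or.inl (.single h)
  | step h1 h2 hp ih =>
    intro b hb hq
    rcases h2 with h2 | h2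
    · rcases ih b hb hq with h | ⟨u, x, v, y, w', h3, h4, h5, rfl⟩
      · exact Or.inl (.step h1 h2 h)
      · exact Or.inr ⟨_, x, v, y, w', .step h1 h2 h3, h4, h5, by simp [List.append_assoc]⟩
    · obtain ⟨x', y', h2', rfl, rfl⟩ := mem_push.1 h2
      refine Or.inr ⟨_, x', _, y', _, .single h1, h2', ?_, rfl⟩
      have hy := (hC _ h2').2
      rcases ih b hb hq with h | ⟨u, x, v, y, w', h3, h4, h5, rfl⟩
      · exact .single ⟨hy, hb, hq ▸ h⟩
      · exact .step ⟨hy, (hC _ h4).1, h3⟩ h4 h5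

/-- Associativity of plugging: inserting `B` and `C` at once has the same paths as inserting `B`,
restricting to the vertices that remain, and inserting `C`. -/
theorem path_union_push_iff (hC : SuppIn N C) {a b : ℕ} (ha : a ∈ N) (hb : b ∈ N) {w : List T} :
    Path A (B ∪ push f C) (f a) w (f b) ↔ Path (pull f N (paths A B)) C a w b := by
  refine ⟨fun h => ?_, path_of_path_pull⟩
  rcases path_union_push_cases hC h b hb rfl with h | ⟨u, x, v, y, w', h3, h4, h5, rfl⟩
  · exact .single ⟨ha, hb, h⟩
  · exact .step ⟨ha, (hC _ h4).1, h3⟩ h4 h5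

/-- The ends of a closed path need not come from `N`, so only the part from the first to the last
`C`-edge is rewritten; `y = z` is the case of a single `C`-edge. -/
theorem path_union_push_cases' (hC : SuppIn N C) {p q : ℕ} {w : List T}
    (h : Path A (B ∪ push f C) p w q) :
      Path A B p w q ∨ ∃ u x v y z w', Path A B p u (f x) ∧ (⟨x, v, y⟩ : Edge T) ∈ C ∧
        (y = z ∨ ∃ u' s v', Path (pull f N (paths A B)) C y u' s ∧ (⟨s, v', z⟩ : Edge T) ∈ C) ∧
        Path A B (f z) w' q := by
  induction h with
  | single h => exact Or.inl (.single h)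
  | step h1 h2 hp ih =>
    rcases h2 with h2 | h2
    · rcases ih with h | ⟨u, x, v, y, z, w', h3, h4⟩
      · exact Or.inl (.step h1 h2 h)
      · exact Or.inr ⟨_, x, v, y, z, w', .step h1 h2 h3, h4⟩
    · obtain ⟨x', y', h2', rfl, rfl⟩ := mem_push.1 h2
      have hy := (hC _ h2').2
      rcases ih with h | ⟨u, x, v, y, z, w', h3, h4, h5, h6⟩
      · exact Or.inr ⟨_, x', _, y', y', _, .single h1, h2', Or.inl rfl, h⟩
      · refine Or.inr ⟨_, x', _, y', z, _, .single h1, h2', Or.inr ?_, h6⟩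
        have h7 : (⟨y', u, x⟩ : Edge T) ∈ pull f N (paths A B) := ⟨hy, (hC _ h4).1, h3⟩
        rcases h5 with rfl | ⟨u', s, v', h8, h9⟩
        · exact ⟨_, x, _, .single h7, h4⟩
        · exact ⟨_, s, _, .step h7 h4 h8, h9⟩

/-- A closed path without `C`-edges closes before `C` is inserted. Any other closed path can be
rotated to begin and end at `C`-edges, and is then a closed path of the composite. -/
theorem cyc_union_push_iff (hC : SuppIn N C) :
    Cyc A (B ∪ push f C) ↔ Cyc A B ∨ Cyc (pull f N (paths A B)) C := by
  constructor
  · rintro ⟨a, u, x, v, h1, h2⟩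
    rcases h2 with h2 | h2
    · rcases path_union_push_cases' hC h1 with h | ⟨u, x', v, y, z, w', h3, h4, h5, h6⟩
      · exact Or.inl ⟨_, _, _, _, h, h2⟩
      · right
        have hz : z ∈ N := by
          rcases h5 with rfl | ⟨_, _, _, _, h9⟩
          exacts [(hC _ h4).2, (hC _ h9).2]
        -- Rotation of the cycle: the tail after the last `C`-edge, the closing `B`-edge and the
        -- head before the first `C`-edge join into one edge of the composite.
        have h7 : (⟨z, _, x'⟩ : Edge T) ∈ pull f N (paths A B) :=
          ⟨hz, (hC _ h4).1, h6.trans h2 h3⟩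
        rcases h5 with rfl | ⟨u', s, v', h8, h9⟩
        · exact ⟨_, _, _, _, .single h7, h4⟩
        · exact ⟨_, _, _, _, .step h7 h4 h8, h9⟩
    · obtain ⟨x, a, h2', rfl, rfl⟩ := mem_push.1 h2
      have h3 := (path_union_push_iff hC (hC _ h2').2 (hC _ h2').1).1 h1
      exact Or.inr ⟨_, _, _, _, h3, h2'⟩
  · rintro (h | ⟨a, u, x, v, h1, h2⟩)
    · exact h.mono subset_rfl Set.subset_union_left
    · exact ⟨_, _, _, _, path_of_path_pull h1, Or.inr (mem_push_of_mem h2)⟩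

end Assoc

/-! #### Renaming -/

theorem Path.push {A B : Set (Edge T)} (f : ℕ → ℕ) {a b : ℕ} {w : List T} (h : Path A B a w b) :
    Path (push f A) (push f B) (f a) w (f b) := by
  induction h with
  | single h => exact .single (mem_push_of_mem h)
  | step h1 h2 _ ih => exact .step (mem_push_of_mem h1) (mem_push_of_mem h2) ih

/-- Injectivity on `N` ensures that edges which meet after the renaming already met before it. -/
theorem Path.of_push {A B : Set (Edge T)} {f : ℕ → ℕ} {N : Set ℕ} (hf : Set.InjOn f N)
    (hA : SuppIn N A) (hB : SuppIn N B) {p q : ℕ} {w : List T}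
    (h : Path (LinLog.push f A) (LinLog.push f B) p w q) :
    ∃ a b, f a = p ∧ f b = q ∧ Path A B a w b := by
  induction h with
  | single h =>
    obtain ⟨a, b, h', rfl, rfl⟩ := mem_push.1 h
    exact ⟨a, b, rfl, rfl, .single h'⟩
  | step h1 h2 _ ih =>
    obtain ⟨a, b, h1', rfl, rfl⟩ := mem_push.1 h1
    obtain ⟨c, d, h2', h3, rfl⟩ := mem_push.1 h2
    obtain ⟨a', b', h4, rfl, h5⟩ := ih
    obtain rfl := hf (hB.mem h2').1 (hA.mem h1').2 h3
    obtain rfl := hf (h5.mem_of_suppIn hA).1 (hB.mem h2').2 h4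
    exact ⟨_, _, rfl, rfl, .step h1' h2' h5⟩

theorem paths_push {A B : Set (Edge T)} {f : ℕ → ℕ} {N : Set ℕ} (hf : Set.InjOn f N)
    (hA : SuppIn N A) (hB : SuppIn N B) :
    paths (push f A) (push f B) = push f (paths A B) := by
  ext ⟨p, w, q⟩
  rw [mem_paths, mem_push]
  constructor
  · intro h
    obtain ⟨a, b, rfl, rfl, h'⟩ := h.of_push hf hA hB
    exact ⟨a, b, h', rfl, rfl⟩
  · rintro ⟨a, b, h, rfl, rfl⟩
    exact Path.push f h

theorem cyc_push_iff {A B : Set (Edge T)} {f : ℕ → ℕ} {N : Set ℕ} (hf : Set.InjOn f N)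
    (hA : SuppIn N A) (hB : SuppIn N B) : Cyc (push f A) (push f B) ↔ Cyc A B := by
  constructor
  · rintro ⟨a, u, x, v, h1, h2⟩
    obtain ⟨a, b, rfl, rfl, h⟩ := h1.of_push hf hA hB
    obtain ⟨c, d, h2', h3, h4⟩ := mem_push.1 h2
    have h5 := h.mem_of_suppIn hA
    obtain rfl := hf (hB.mem h2').1 h5.2 h3
    obtain rfl := hf (hB.mem h2').2 h5.1 h4
    exact ⟨_, _, _, _, h, h2'⟩
  · rintro ⟨a, u, x, v, h1, h2⟩
    exact ⟨_, _, _, _, Path.push f h1, mem_push_of_mem h2⟩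

/-! #### Two zones -/

section Zones

variable {A₁ A₂ B₁ B₂ s : Set (Edge T)} {Z₁ Z₂ : Set ℕ}

/-- The connections between vertices of `Z₁` that pass through `s` and the zone of `A₂`. -/
def detour (A₂ B₂ s : Set (Edge T)) (Z₁ : Set ℕ) : Set (Edge T) :=
  {e | e.src ∈ Z₁ ∧ e.tgt ∈ Z₁ ∧ Path s (paths A₂ B₂) e.src e.label e.tgt}

/-- The edges of `s` are the only passage between the zones, so a path that ends in `Z₁` consists of
stretches in `Z₁` and excursions, and each excursion is a detour. The induction also meets paths
that begin in the middle of an excursion; the second conjunct describes these. -/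
theorem path_zones_cases (hZ : Disjoint Z₁ Z₂) (hA₁ : SuppIn Z₁ A₁) (hA₂ : SuppIn Z₂ A₂)
    (hB₁ : SuppIn Z₁ B₁) (hB₂ : SuppIn Z₂ B₂) (hs : SuppIn (Z₁ ∪ Z₂) s) {a b : ℕ} {w : List T}
    (h : Path (A₁ ∪ A₂) (B₁ ∪ B₂ ∪ s) a w b) (hb : b ∈ Z₁) :
    (a ∈ Z₁ → Path A₁ (B₁ ∪ detour A₂ B₂ s Z₁) a w b) ∧
    (a ∈ Z₂ → ∃ u z v y w', Path A₂ B₂ a u z ∧ Path s (paths A₂ B₂) z v y ∧ y ∈ Z₁ ∧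
      Path A₁ (B₁ ∪ detour A₂ B₂ s Z₁) y w' b ∧ w = u ++ (v ++ w')) := by
  have hd : ∀ {i}, i ∈ Z₁ → i ∈ Z₂ → False := fun h1 h2 => Set.disjoint_left.1 hZ h1 h2
  induction h with
  | single h =>
    refine ⟨fun ha => .single (h.resolve_right fun h => hd ha (hA₂ _ h).1), fun ha => ?_⟩
    rcases h with h | h
    · exact (hd (hA₁ _ h).1 ha).elim
    · exact (hd hb (hA₂ _ h).2).elim
  | step h1 h2 _ ih =>
    obtain ⟨ih1, ih2⟩ := ih hb
    constructor
    · intro ha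
      have h1 := h1.resolve_right fun h => hd ha (hA₂ _ h).1
      have hx := (hA₁ _ h1).2
      rcases h2 with (h2 | h2) | h2
      · exact .step h1 (Or.inl h2) (ih1 (hB₁ _ h2).2)
      · exact (hd hx (hB₂ _ h2).1).elim
      · rcases (hs _ h2).2 with hy | hy
        · exact .step h1 (Or.inr ⟨hx, hy, .single h2⟩) (ih1 hy)
        · obtain ⟨u, z, v, y', w', h3, h4, h5, h6, rfl⟩ := ih2 hy
          have h7 := Path.step h1 (Or.inr ⟨hx, h5, .step h2 h3 h4⟩) h6
          simpa [List.append_assoc] using h7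
    · intro ha
      have h1 := h1.resolve_left fun h => hd (hA₁ _ h).1 ha
      have hx := (hA₂ _ h1).2
      rcases h2 with (h2 | h2) | h2
      · exact (hd (hB₁ _ h2).1 hx).elim
      · obtain ⟨u, z, v, y', w', h3, h4, h5, h6, rfl⟩ := ih2 (hB₂ _ h2).2
        exact ⟨_, z, v, y', w', .step h1 h2 h3, h4, h5, h6, by simp [List.append_assoc]⟩
      · rcases (hs _ h2).2 with hy | hy
        · exact ⟨_, _, _, _, _, .single h1, .single h2, hy, ih1 hy, rfl⟩
        · obtain ⟨u, z, v, y', w', h3, h4, h5, h6, rfl⟩ := ih2 hy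
          exact ⟨_, _, _, _, _, .single h1, .step h2 h3 h4, h5, h6, by simp [List.append_assoc]⟩

theorem path_detour_trans {a x y b : ℕ} {u v w : List T}
    (h : Path s (paths A₂ B₂) x v y) (h1 : Path (A₁ ∪ A₂) (B₁ ∪ B₂ ∪ s) a u x)
    (h2 : Path (A₁ ∪ A₂) (B₁ ∪ B₂ ∪ s) y w b) :
    Path (A₁ ∪ A₂) (B₁ ∪ B₂ ∪ s) a (u ++ (v ++ w)) b := by
  induction h generalizing u with
  | single h => exact h1.trans (Or.inr h) h2
  | step h3 h4 _ ih =>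
    have h5 := h1.trans (Or.inr h3) (Path.mono (B' := B₁ ∪ B₂ ∪ s) (A' := A₁ ∪ A₂)
      Set.subset_union_right (fun _ h => Or.inl (Or.inr h)) h4)
    simpa [List.append_assoc] using ih h5 h2

/-- The edges of the detour are absorbed one by one into the returning path until a single `s`-edge
is left to close it. -/
theorem cyc_of_path_detour {x y : ℕ} {u v : List T}
    (h : Path s (paths A₂ B₂) x v y) (h1 : Path (A₁ ∪ A₂) (B₁ ∪ B₂ ∪ s) y u x) :
    Cyc (A₁ ∪ A₂) (B₁ ∪ B₂ ∪ s) := by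
  induction h generalizing u with
  | single h => exact ⟨_, _, _, _, h1, Or.inr h⟩
  | step h3 h4 _ ih =>
    exact ih (h1.trans (Or.inr h3) (Path.mono (B' := B₁ ∪ B₂ ∪ s) (A' := A₁ ∪ A₂)
      Set.subset_union_right (fun _ h => Or.inl (Or.inr h)) h4))

theorem path_of_path_detour {a b : ℕ} {w : List T}
    (h : Path A₁ (B₁ ∪ detour A₂ B₂ s Z₁) a w b) :
    Path (A₁ ∪ A₂) (B₁ ∪ B₂ ∪ s) a w b := by
  induction h with
  | single h => exact .single (Or.inl h)
  | step h1 h2 _ ih =>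
    rcases h2 with h2 | h2
    · exact .step (Or.inl h1) (Or.inl (Or.inl h2)) ih
    · exact path_detour_trans h2.2.2 (.single (Or.inl h1)) ih

theorem path_zones_iff (hZ : Disjoint Z₁ Z₂) (hA₁ : SuppIn Z₁ A₁) (hA₂ : SuppIn Z₂ A₂)
    (hB₁ : SuppIn Z₁ B₁) (hB₂ : SuppIn Z₂ B₂) (hs : SuppIn (Z₁ ∪ Z₂) s) {a b : ℕ} {w : List T}
    (ha : a ∈ Z₁) (hb : b ∈ Z₁) :
    Path (A₁ ∪ A₂) (B₁ ∪ B₂ ∪ s) a w b ↔ Path A₁ (B₁ ∪ detour A₂ B₂ s Z₁) a w b :=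
  ⟨fun h => (path_zones_cases hZ hA₁ hA₂ hB₁ hB₂ hs h hb).1 ha, path_of_path_detour⟩

theorem cyc_of_cyc_detour (h : Cyc A₁ (B₁ ∪ detour A₂ B₂ s Z₁)) :
    Cyc (A₁ ∪ A₂) (B₁ ∪ B₂ ∪ s) := by
  obtain ⟨a, u, x, v, h1, h2⟩ := h
  have h1 := path_of_path_detour (A₂ := A₂) (B₂ := B₂) (s := s) h1
  rcases h2 with h2 | h2
  · exact ⟨_, _, _, _, h1, Or.inl (Or.inl h2)⟩
  · exact cyc_of_path_detour h2.2.2 h1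

theorem cyc_of_cyc_connector (h : Cyc s (paths A₂ B₂)) : Cyc (A₁ ∪ A₂) (B₁ ∪ B₂ ∪ s) := by
  obtain ⟨a, u, x, v, h1, h2⟩ := h
  exact cyc_of_path_detour h1 (Path.mono Set.subset_union_right (fun _ h => Or.inl (Or.inr h)) h2)

end Zones

/-! ### Boundaries and formulas -/

theorem Polarity.flip_flip (p : Polarity) : p.flip.flip = p := by cases p <;> rfl

/-- The polarity of the sources of edges: `true` for multiwords, `false` for the edges that are
plugged into multiwords. -/
def pol : Bool → Polarity
  | true => .left
  | false => .right

theorem pol_not (b : Bool) : pol (!b) = (pol b).flip := by cases b <;> rfl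

theorem pol_flip (b : Bool) : (pol b).flip = pol (!b) := (pol_not b).symm

theorem pol_injective : Function.Injective pol := by
  intro a b
  cases a <;> cases b <;> simp [pol]

theorem exists_pol (p : Polarity) (b : Bool) : p = pol b ∨ p = pol (!b) := by
  cases p <;> cases b <;> simp [pol]

theorem Boundary.length_dual (X : Boundary) : X.dual.length = X.length := by
  simp [Boundary.dual]

theorem Boundary.dual_dual (X : Boundary) : X.dual.dual = X := by
  simp only [Boundary.dual, List.map_reverse, List.reverse_reverse, List.map_map]
  conv_rhs => rw [← List.map_id X]
  congr 1
  funext p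
  exact p.flip_flip

theorem Boundary.dual_append (X Y : Boundary) : Boundary.dual (X ++ Y) = Y.dual ++ X.dual := by
  simp [Boundary.dual]

/-- Reversal of the order of `0, …, m - 1`. -/
def rev (m i : ℕ) : ℕ := m - 1 - i

theorem rev_lt {m i : ℕ} (h : i < m) : rev m i < m := by unfold rev; omega

theorem rev_rev {m i : ℕ} (h : i < m) : rev m (rev m i) = i := by unfold rev; omega

theorem rev_injOn (m : ℕ) : Set.InjOn (rev m) (Set.Iio m) := by
  intro i hi j hj h
  rw [← rev_rev hi, h, rev_rev hj]

theorem Boundary.getElem?_dual (X : Boundary) {i : ℕ} (h : i < X.length) :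
    X.dual[i]? = X[rev X.length i]?.map Polarity.flip := by
  have : i < (X.map Polarity.flip).length := by simpa using h
  rw [Boundary.dual, List.getElem?_reverse this]
  simp [rev]

theorem Boundary.lt_of_getElem? {X : Boundary} {i : ℕ} {p : Polarity} (h : X[i]? = some p) :
    i < X.length := by
  obtain ⟨h, _⟩ := List.getElem?_eq_some_iff.1 h
  exact h

theorem Formula.dual_dual (X : Formula N) : X.dual.dual = X := by
  induction X <;> simp_all [Formula.dual]

theorem Formula.interp_dual (ξ : N → Boundary) (X : Formula N) :
    X.dual.interp ξ = (X.interp ξ).dual := by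
  induction X <;> simp_all [Formula.dual, Formula.interp, Boundary.dual_dual, Boundary.dual_append]

theorem Formula.length_interp_dual (ξ : N → Boundary) (X : Formula N) :
    (X.dual.interp ξ).length = (X.interp ξ).length := by
  rw [Formula.interp_dual, Boundary.length_dual]

/-! ### Polarized edge sets -/

def Typed (b : Bool) (X : Boundary) (E : Set (Edge T)) : Prop :=
  ∀ e ∈ E, X[e.src]? = some (pol b) ∧ X[e.tgt]? = some (pol !b)

theorem Typed.suppIn {b : Bool} {X : Boundary} {E : Set (Edge T)} (h : Typed b X E) :
    SuppIn (Set.Iio X.length) E := fun e he =>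
  ⟨Boundary.lt_of_getElem? (h e he).1, Boundary.lt_of_getElem? (h e he).2⟩

theorem Typed.push_rev {b : Bool} {X : Boundary} {E : Set (Edge T)} (h : Typed b X.dual E) :
    Typed (!b) X (push (rev X.length) E) := by
  rintro _ ⟨e, he, rfl⟩
  have h1 := h e he
  have h2 := h.suppIn e he
  rw [Boundary.length_dual] at h2
  rw [Boundary.getElem?_dual _ h2.1, Boundary.getElem?_dual _ h2.2] at h1
  simp only [Option.map_eq_some_iff] at h1
  obtain ⟨⟨p, hp, hp'⟩, q, hq, hq'⟩ := h1
  refine ⟨hp.trans ?_, hq.trans ?_⟩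
  · rw [← p.flip_flip, hp', pol_flip]
  · rw [← q.flip_flip, hq', pol_flip]

theorem push_rev_push_rev {m : ℕ} {E : Set (Edge T)} (h : SuppIn (Set.Iio m) E) :
    push (rev m) (push (rev m) E) = E := by
  rw [push_push]
  exact push_eq_self h fun i hi => rev_rev hi

theorem Typed.union_push {b : Bool} {X Y : Boundary} {E F : Set (Edge T)} (hE : Typed b X E)
    (hF : Typed b Y F) : Typed b (X ++ Y) (E ∪ push (X.length + ·) F) := by
  rintro e (he | ⟨e, he, rfl⟩)
  · have h1 := hE e he
    have h2 := hE.suppIn e he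
    rwa [List.getElem?_append_left h2.1, List.getElem?_append_left h2.2]
  · simpa [List.getElem?_append_right] using hF e he

theorem Typed.paths {b : Bool} {X : Boundary} {E F : Set (Edge T)} (hE : Typed b X E) :
    Typed b X (paths E F) := by
  rintro ⟨i, w, j⟩ he
  obtain ⟨_, _, h1⟩ := Path.head he
  obtain ⟨_, _, h2⟩ := Path.last he
  exact ⟨(hE _ h1).1, (hE _ h2).2⟩

/-! ### The realizability interpretation of formulas -/

def tensSet (m : ℕ) (U V : Set (Set (Edge T))) : Set (Set (Edge T)) :=
  {d | ∃ a ∈ U, ∃ c ∈ V, d = a ∪ push (m + ·) c}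

/-- Pluggings that close a cycle are exempt from both implications: they correspond to singular
multiwords, which contribute no words. -/
def parSet (b : Bool) (X Y : Boundary) (U V U' V' : Set (Set (Edge T))) : Set (Set (Edge T)) :=
  {d | Typed b (X ++ Y) d ∧
    (∀ a ∈ U', ¬ Cyc d a → pull (X.length + ·) (Set.Iio Y.length) (paths d a) ∈ V) ∧
    (∀ c ∈ V', ¬ Cyc d (push (X.length + ·) c) →
      pull id (Set.Iio X.length) (paths d (push (X.length + ·) c)) ∈ U)}

/-- The edge sets that realize a formula (for `true`), and those that may be plugged into it (for
`false`), given such sets for the atoms. -/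
def realizers (ξ : N → Boundary) (L : Bool → N → Set (Set (Edge T))) :
    Formula N → Bool → Set (Set (Edge T))
  | .pos p, b => L b p
  | .neg p, b => push (rev (ξ p).length) '' L (!b) p
  | .tensor A B, true =>
    tensSet (A.interp ξ).length (realizers ξ L A true) (realizers ξ L B true)
  | .tensor A B, false =>
    parSet false (A.interp ξ) (B.interp ξ) (realizers ξ L A false) (realizers ξ L B false)
      (realizers ξ L A true) (realizers ξ L B true)
  | .par A B, true =>
    parSet true (A.interp ξ) (B.interp ξ) (realizers ξ L A true) (realizers ξ L B true)
      (realizers ξ L A false) (realizers ξ L B false)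
  | .par A B, false =>
    tensSet (A.interp ξ).length (realizers ξ L A false) (realizers ξ L B false)

theorem tensSet_typed {b : Bool} {X Y : Boundary} {U V : Set (Set (Edge T))}
    (hU : ∀ a ∈ U, Typed b X a) (hV : ∀ c ∈ V, Typed b Y c) :
    ∀ d ∈ tensSet X.length U V, Typed b (X ++ Y) d := by
  rintro _ ⟨a, ha, c, hc, rfl⟩
  exact (hU a ha).union_push (hV c hc)

theorem realizers_typed {ξ : N → Boundary} {L : Bool → N → Set (Set (Edge T))}
    (hL : ∀ b p, ∀ d ∈ L b p, Typed b (ξ p) d) (X : Formula N) (b : Bool) :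
    ∀ d ∈ realizers ξ L X b, Typed b (X.interp ξ) d := by
  induction X generalizing b with
  | pos p => exact hL b p
  | neg p =>
    rintro _ ⟨d, hd, rfl⟩
    have h := hL _ _ d hd
    rw [← Boundary.dual_dual (ξ p)] at h
    have := h.push_rev
    rwa [Bool.not_not, Boundary.length_dual] at this
  | tensor A B ihA ihB =>
    cases b
    · exact fun d hd => hd.1
    · exact tensSet_typed (ihA true) (ihB true)
  | par A B ihA ihB =>
    cases b
    · exact tensSet_typed (ihA false) (ihB false)
    · exact fun d hd => hd.1

theorem push_rev_mem_tensSet {m n : ℕ} {U V U₂ V₂ : Set (Set (Edge T))}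
    (hU₂ : ∀ a ∈ U₂, SuppIn (Set.Iio m) a) (hV₂ : ∀ a ∈ V₂, SuppIn (Set.Iio n) a)
    (hU : ∀ a ∈ U₂, push (rev m) a ∈ U) (hV : ∀ c ∈ V₂, push (rev n) c ∈ V)
    {d : Set (Edge T)} (hd : d ∈ tensSet n V₂ U₂) : push (rev (m + n)) d ∈ tensSet m U V := by
  obtain ⟨c, hc, a, ha, rfl⟩ := hd
  refine ⟨_, hU a ha, _, hV c hc, ?_⟩
  rw [push_union, Set.union_comm, push_push, push_push]
  congr 1
  · exact push_congr (hU₂ a ha) fun i hi => by simp only [Function.comp, rev]; omega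
  · refine push_congr (hV₂ c hc) fun i hi => ?_
    simp only [Set.mem_Iio] at hi
    simp only [Function.comp, rev]; omega

/-- Reversal is injective on the vertices, so it commutes with paths and cycles. It exchanges the
two factors, so each clause of `parSet` turns into the other one. -/
theorem push_rev_mem_parSet {b : Bool} {X Y : Boundary} {U V U' V' U₂ V₂ U₂' V₂' : Set (Set (Edge T))}
    (hU' : ∀ a ∈ U', SuppIn (Set.Iio X.length) a) (hV' : ∀ a ∈ V', SuppIn (Set.Iio Y.length) a)
    (hU : ∀ a ∈ U₂, push (rev X.length) a ∈ U) (hV : ∀ c ∈ V₂, push (rev Y.length) c ∈ V)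
    (hU₂' : ∀ a ∈ U', push (rev X.length) a ∈ U₂') (hV₂' : ∀ c ∈ V', push (rev Y.length) c ∈ V₂')
    {d : Set (Edge T)} (hd : d ∈ parSet b Y.dual X.dual V₂ U₂ V₂' U₂') :
    push (rev (X.length + Y.length)) d ∈ parSet (!b) X Y U V U' V' := by
  obtain ⟨h1, h2, h3⟩ := hd
  simp only [Boundary.length_dual] at h2 h3
  rw [← Boundary.dual_append] at h1
  have hlen : (X ++ Y).length = X.length + Y.length := List.length_append
  have hd := h1.suppIn
  rw [Boundary.length_dual, hlen] at hd
  have hinj := rev_injOn (X.length + Y.length)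
  refine ⟨by simpa using h1.push_rev, fun a ha hcyc => ?_, fun c hc hcyc => ?_⟩
  · have ha' : SuppIn (Set.Iio (X.length + Y.length))
        (push (Y.length + ·) (push (rev X.length) a)) := by
      rw [push_push]
      refine (hU' a ha).push fun i hi => ?_
      have := rev_lt hi
      simp only [Function.comp, Set.mem_Iio]; omega
    -- Reversed as a whole, a block plugged in at the front becomes the reversed block at the back,
    -- at distance `Y.length`.
    have hpush : a = push (rev (X.length + Y.length)) (push (Y.length + ·) (push (rev X.length) a)) := by
      rw [push_push, push_push]
      refine (push_eq_self (hU' a ha) fun i hi => ?_).symm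
      simp only [Set.mem_Iio] at hi
      simp only [Function.comp, rev]; omega
    rw [hpush, cyc_push_iff hinj hd ha'] at hcyc
    have h4 := hV _ (h3 _ (hU₂' a ha) hcyc)
    rw [hpush, paths_push hinj hd ha']
    convert h4 using 1
    ext ⟨i, w, j⟩
    simp only [mem_pull, mem_push, Set.mem_Iio, id]
    constructor
    · rintro ⟨hi, hj, p, q, h5, hp, hq⟩
      have h6 := suppIn_paths (B := push (Y.length + ·) (push (rev X.length) a)) hd _ h5
      simp only [Set.mem_Iio] at h6
      simp only [rev] at hp hq
      exact ⟨p, q, ⟨by omega, by omega, h5⟩, by simp only [rev]; omega, by simp only [rev]; omega⟩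
    · rintro ⟨p, q, ⟨hp, hq, h5⟩, rfl, rfl⟩
      exact ⟨rev_lt hp, rev_lt hq, p, q, h5, by simp only [rev]; omega, by simp only [rev]; omega⟩
  · have hc' : SuppIn (Set.Iio (X.length + Y.length)) (push (rev Y.length) c) :=
      (hV' c hc).push fun i hi => by
        have := rev_lt hi
        simp only [Set.mem_Iio]; omega
    have hpush : push (X.length + ·) c = push (rev (X.length + Y.length)) (push (rev Y.length) c) := by
      rw [push_push]
      refine push_congr (hV' c hc) fun i hi => ?_
      simp only [Set.mem_Iio] at hi
      simp only [Function.comp, rev]; omega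
    rw [hpush, cyc_push_iff hinj hd hc'] at hcyc
    have h4 := hU _ (h2 _ (hV₂' c hc) hcyc)
    rw [hpush, paths_push hinj hd hc']
    convert h4 using 1
    ext ⟨i, w, j⟩
    simp only [mem_pull, mem_push, Set.mem_Iio, id]
    constructor
    · rintro ⟨hi, hj, p, q, h5, hp, hq⟩
      have h6 := suppIn_paths (B := push (rev Y.length) c) hd _ h5
      simp only [Set.mem_Iio] at h6
      simp only [rev] at hp hq
      refine ⟨p - Y.length, q - Y.length, ⟨by omega, by omega, ?_⟩, by simp only [rev]; omega,
        by simp only [rev]; omega⟩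
      rwa [show Y.length + (p - Y.length) = p by omega, show Y.length + (q - Y.length) = q by omega]
    · rintro ⟨p, q, ⟨hp, hq, h5⟩, rfl, rfl⟩
      exact ⟨rev_lt hp, rev_lt hq, _, _, h5, by simp only [rev]; omega, by simp only [rev]; omega⟩

theorem realizers_suppIn {ξ : N → Boundary} {L : Bool → N → Set (Set (Edge T))}
    (hL : ∀ b p, ∀ d ∈ L b p, Typed b (ξ p) d) (X : Formula N) (b : Bool) :
    ∀ d ∈ realizers ξ L X b, SuppIn (Set.Iio (X.interp ξ).length) d :=
  fun d hd => (realizers_typed hL X b d hd).suppIn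

/-- Reversal exchanges realizers of a formula with tests of its dual. Both directions are proved
together because the clauses of `parSet` have test sets as premises, where the opposite direction of
the induction hypothesis is used. -/
theorem push_rev_realizers_aux {ξ : N → Boundary} {L : Bool → N → Set (Set (Edge T))}
    (hL : ∀ b p, ∀ d ∈ L b p, Typed b (ξ p) d) (X : Formula N) : ∀ b,
    (∀ d ∈ realizers ξ L X.dual b, push (rev (X.interp ξ).length) d ∈ realizers ξ L X (!b)) ∧
    (∀ d ∈ realizers ξ L X b, push (rev (X.interp ξ).length) d ∈ realizers ξ L X.dual (!b)) := by
  have hS := realizers_suppIn hL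
  have hS' : ∀ (X : Formula N) (b : Bool), ∀ d ∈ realizers ξ L X.dual b,
      SuppIn (Set.Iio (X.interp ξ).length) d := fun X b d hd => by
    have := hS _ _ d hd
    rwa [Formula.length_interp_dual] at this
  induction X with
  | pos p =>
    intro b
    constructor
    · rintro _ ⟨d, hd, rfl⟩
      simp only [Formula.interp, realizers]
      rwa [push_rev_push_rev (hL _ _ d hd).suppIn]
    · intro d hd
      exact ⟨d, by rwa [Bool.not_not], rfl⟩
  | neg p =>
    intro b
    constructor
    · intro d hd
      simp only [Formula.interp, Boundary.length_dual]
      exact ⟨d, by rwa [Bool.not_not], rfl⟩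
    · rintro _ ⟨d, hd, rfl⟩
      simp only [Formula.interp, realizers, Boundary.length_dual, Formula.dual]
      rwa [push_rev_push_rev (hL _ _ d hd).suppIn]
  | tensor A B ihA ihB =>
    intro b
    simp only [Formula.interp, Formula.dual, List.length_append]
    cases b
    · constructor
      · intro d hd
        simp only [realizers, Formula.length_interp_dual] at hd
        exact push_rev_mem_tensSet (hS' A false) (hS' B false) (ihA false).1 (ihB false).1 hd
      · intro d hd
        simp only [realizers, Bool.not_false, Formula.interp_dual] at hd ⊢
        have h := push_rev_mem_parSet (b := false) (X := (B.interp ξ).dual) (Y := (A.interp ξ).dual)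
          (U₂ := realizers ξ L B false) (V₂ := realizers ξ L A false)
          (U₂' := realizers ξ L B true) (V₂' := realizers ξ L A true) (d := d)
          (by simpa [Boundary.length_dual] using hS' B false)
          (by simpa [Boundary.length_dual] using hS' A false)
          (by simpa [Boundary.length_dual] using (ihB false).2)
          (by simpa [Boundary.length_dual] using (ihA false).2)
          (by simpa [Boundary.length_dual] using (ihB false).1)
          (by simpa [Boundary.length_dual] using (ihA false).1)
          (by simpa [Boundary.dual_dual] using hd)
        simpa [Boundary.length_dual, add_comm] using h
    · constructor
      · intro d hd
        simp only [realizers, Bool.not_true, Formula.interp_dual] at hd ⊢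
        exact push_rev_mem_parSet (b := true) (hS A true) (hS B true) (ihA true).1 (ihB true).1
          (ihA true).2 (ihB true).2 hd
      · intro d hd
        simp only [realizers, Bool.not_true, Formula.length_interp_dual] at hd ⊢
        rw [add_comm]
        exact push_rev_mem_tensSet (hS B true) (hS A true) (ihB true).2 (ihA true).2 hd
  | par A B ihA ihB =>
    intro b
    simp only [Formula.interp, Formula.dual, List.length_append]
    cases b
    · constructor
      · intro d hd
        simp only [realizers, Bool.not_false, Formula.interp_dual] at hd ⊢
        exact push_rev_mem_parSet (b := false) (hS A false) (hS B false) (ihA false).1 (ihB false).1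
          (ihA false).2 (ihB false).2 hd
      · intro d hd
        simp only [realizers, Bool.not_false, Formula.length_interp_dual] at hd ⊢
        rw [add_comm]
        exact push_rev_mem_tensSet (hS B false) (hS A false) (ihB false).2 (ihA false).2 hd
    · constructor
      · intro d hd
        simp only [realizers, Formula.length_interp_dual] at hd
        exact push_rev_mem_tensSet (hS' A true) (hS' B true) (ihA true).1 (ihB true).1 hd
      · intro d hd
        simp only [realizers, Bool.not_true, Formula.interp_dual] at hd ⊢
        have h := push_rev_mem_parSet (b := true) (X := (B.interp ξ).dual) (Y := (A.interp ξ).dual)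
          (U₂ := realizers ξ L B true) (V₂ := realizers ξ L A true)
          (U₂' := realizers ξ L B false) (V₂' := realizers ξ L A false) (d := d)
          (by simpa [Boundary.length_dual] using hS' B true)
          (by simpa [Boundary.length_dual] using hS' A true)
          (by simpa [Boundary.length_dual] using (ihB true).2)
          (by simpa [Boundary.length_dual] using (ihA true).2)
          (by simpa [Boundary.length_dual] using (ihB true).1)
          (by simpa [Boundary.length_dual] using (ihA true).1)
          (by simpa [Boundary.dual_dual] using hd)
        simpa [Boundary.length_dual, add_comm] using h

theorem push_rev_mem_realizers {ξ : N → Boundary} {L : Bool → N → Set (Set (Edge T))}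
    (hL : ∀ b p, ∀ d ∈ L b p, Typed b (ξ p) d) {X : Formula N} {b : Bool} {d : Set (Edge T)}
    (hd : d ∈ realizers ξ L X b) :
    push (rev (X.interp ξ).length) d ∈ realizers ξ L X.dual (!b) :=
  (push_rev_realizers_aux hL X b).2 d hd

/-! ### Identity links -/

/-- The identity links between corresponding vertices in `Y.dual ++ Y`. -/
def link (b : Bool) (Y : Boundary) : Set (Edge T) :=
  {e | ∃ i, Y[i]? = some (pol b) ∧ e = ⟨Y.length + i, [], rev Y.length i⟩} ∪
    {e | ∃ i, Y[i]? = some (pol !b) ∧ e = ⟨rev Y.length i, [], Y.length + i⟩}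

theorem link_typed (b : Bool) (Y : Boundary) : Typed b (Y.dual ++ Y) (link b Y : Set (Edge T)) := by
  have key : ∀ i c, Y[i]? = some (pol c) → (Y.dual ++ Y)[Y.length + i]? = some (pol c) ∧
      (Y.dual ++ Y)[rev Y.length i]? = some (pol !c) := by
    intro i c h
    have hi := Boundary.lt_of_getElem? h
    constructor
    · rw [List.getElem?_append_right (by simp [Boundary.length_dual])]
      simpa [Boundary.length_dual] using h
    · rw [List.getElem?_append_left (by rw [Boundary.length_dual]; exact rev_lt hi),
        Boundary.getElem?_dual _ (rev_lt hi), rev_rev hi, h, Option.map_some, pol_flip]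
  rintro _ (⟨i, hi, rfl⟩ | ⟨i, hi, rfl⟩)
  · exact key i b hi
  · have := key i _ hi
    rw [Bool.not_not] at this
    exact this.symm

theorem link_cases {b : Bool} {Y : Boundary} {p q : ℕ} {w : List T}
    (h : (⟨p, w, q⟩ : Edge T) ∈ link b Y) : w = [] ∧ q = rev (Y.length + Y.length) p ∧
      (p < Y.length ↔ Y.length ≤ q) := by
  rcases h with ⟨i, hi, he⟩ | ⟨i, hi, he⟩ <;> simp only [Edge.mk.injEq] at he <;>
    obtain ⟨rfl, rfl, rfl⟩ := he <;> have := Boundary.lt_of_getElem? hi <;> unfold rev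
  · exact ⟨rfl, by omega, by omega⟩
  · exact ⟨rfl, by omega, by omega⟩

theorem mem_link_iff {b : Bool} {Y : Boundary} {p : ℕ} :
    (⟨p, [], rev (Y.length + Y.length) p⟩ : Edge T) ∈ link b Y ↔
      (Y.dual ++ Y)[p]? = some (pol b) := by
  refine ⟨fun h => (link_typed b Y _ h).1, fun h => ?_⟩
  by_cases hp : p < Y.length
  · rw [List.getElem?_append_left (by rwa [Boundary.length_dual]), Boundary.getElem?_dual _ hp,
      Option.map_eq_some_iff] at h
    obtain ⟨c, h1, h2⟩ := h
    refine Or.inr ⟨rev Y.length p, ?_, ?_⟩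
    · rw [h1, pol_not, ← h2, Polarity.flip_flip]
    · simp only [Edge.mk.injEq, true_and]
      unfold rev; omega
  · rw [List.getElem?_append_right (by rw [Boundary.length_dual]; omega),
      Boundary.length_dual] at h
    have := Boundary.lt_of_getElem? h
    refine Or.inl ⟨_, h, ?_⟩
    simp only [Edge.mk.injEq, true_and]
    unfold rev; omega

/-- Every link crosses between `S` and its complement, while `B` stays within `S`. A path that
starts and ends outside `S` is therefore link, `B`-edge, link, which reflects the `B`-edge at the
middle. -/
theorem path_link {b : Bool} {Y : Boundary} {B : Set (Edge T)} {S : Set ℕ}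
    (hS : ∀ e ∈ (link b Y : Set (Edge T)), e.src ∈ S ↔ e.tgt ∉ S)
    (hB : SuppIn S B) {p q : ℕ} {w : List T} (h : Path (link b Y) B p w q) (hp : p ∉ S)
    (hq : q ∉ S) :
    (⟨rev (Y.length + Y.length) p, w, rev (Y.length + Y.length) q⟩ : Edge T) ∈ B := by
  cases h with
  | single h => exact absurd ((hS _ h).2 hq) hp
  | step h1 h2 h3 =>
    obtain ⟨rfl, rfl, _⟩ := link_cases h1
    cases h3 with
    | single h3 =>
      have h4 := link_typed b Y _ h3
      have h5 := (link_typed b Y).suppIn _ h3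
      rw [List.length_append, Boundary.length_dual] at h5
      obtain ⟨rfl, rfl, _⟩ := link_cases h3
      rw [rev_rev h5.1]
      simpa using h2
    | step h3 h4 _ => exact absurd (hB.mem h4).1 ((hS _ h3).1 (hB.mem h2).2)

theorem path_link_of_mem {b : Bool} {Y : Boundary} {B : Set (Edge T)}
    (hB : Typed (!b) (Y.dual ++ Y) B) {p q : ℕ} {w : List T} (h : (⟨p, w, q⟩ : Edge T) ∈ B) :
    Path (link b Y) B (rev (Y.length + Y.length) p) w (rev (Y.length + Y.length) q) := by
  have h1 := hB _ h
  have h2 := hB.suppIn _ h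
  simp only [List.length_append, Boundary.length_dual, Set.mem_Iio] at h2
  rw [Bool.not_not] at h1
  have h3 := (mem_link_iff (T := T)).2 h1.2
  have h4 : (⟨rev (Y.length + Y.length) p, [], p⟩ : Edge T) ∈ link b Y := by
    have h5 := (mem_link_iff (T := T)).2 h1.1
    rcases h5 with ⟨i, hi, he⟩ | ⟨i, hi, he⟩ <;> simp only [Edge.mk.injEq, true_and] at he <;>
      have h6 := Boundary.lt_of_getElem? hi
    · refine Or.inr ⟨i, hi, ?_⟩
      simp only [Edge.mk.injEq, true_and]
      exact ⟨he.2, he.1⟩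
    · rw [Bool.not_not] at hi
      refine Or.inl ⟨i, hi, ?_⟩
      simp only [Edge.mk.injEq, true_and]
      exact ⟨he.2, he.1⟩
  simpa using Path.step h4 h (.single h3)

theorem pull_paths_link_left {b : Bool} {Y : Boundary} {a : Set (Edge T)}
    (ha : Typed (!b) Y.dual a) :
    pull (Y.length + ·) (Set.Iio Y.length) (paths (link b Y) a) = push (rev Y.length) a := by
  have hS := ha.suppIn
  rw [Boundary.length_dual] at hS
  ext ⟨i, w, j⟩
  simp only [mem_pull, mem_paths, mem_push, Set.mem_Iio]
  constructor
  · rintro ⟨hi, hj, h⟩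
    refine ⟨_, _, path_link (S := Set.Iio Y.length) (fun e he => ?_) hS h ?_ ?_, ?_, ?_⟩
    · have := (link_cases (p := e.src) (q := e.tgt) (w := e.label) he).2.2
      simp only [Set.mem_Iio]; omega
    · simp
    · simp
    · unfold rev; omega
    · unfold rev; omega
  · rintro ⟨p, q, h, rfl, rfl⟩
    have hpq := hS _ h
    simp only [Set.mem_Iio] at hpq
    refine ⟨rev_lt hpq.1, rev_lt hpq.2, ?_⟩
    have ht : Typed (!b) (Y.dual ++ Y) a := fun e he => by
      have h1 := ha e he
      have h2 := ha.suppIn e he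
      rwa [List.getElem?_append_left h2.1, List.getElem?_append_left h2.2]
    convert path_link_of_mem ht h using 1 <;> unfold rev <;> omega

theorem pull_paths_link_right {b : Bool} {Y : Boundary} {c : Set (Edge T)}
    (hc : Typed (!b) Y c) :
    pull id (Set.Iio Y.length) (paths (link b Y) (push (Y.length + ·) c)) =
      push (rev Y.length) c := by
  have hS := hc.suppIn
  ext ⟨i, w, j⟩
  simp only [mem_pull, mem_paths, mem_push, Set.mem_Iio, id]
  constructor
  · rintro ⟨hi, hj, h⟩
    have h1 := path_link (S := Set.Ico Y.length (Y.length + Y.length)) (fun e he => ?_)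
      (hS.push fun i hi => ?_) h ?_ ?_
    · obtain ⟨p, q, h2, h3, h4⟩ := mem_push.1 h1
      refine ⟨p, q, h2, ?_, ?_⟩ <;> unfold rev at * <;> omega
    · have h1 := (link_cases (p := e.src) (q := e.tgt) (w := e.label) he).2.2
      have h2 := (link_typed b Y).suppIn e he
      simp only [List.length_append, Boundary.length_dual, Set.mem_Iio] at h2
      simp only [Set.mem_Ico]; omega
    · simp only [Set.mem_Iio, Set.mem_Ico] at hi ⊢; omega
    · simp only [Set.mem_Ico]; omega
    · simp only [Set.mem_Ico]; omega
  · rintro ⟨p, q, h, rfl, rfl⟩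
    have hpq := hS _ h
    simp only [Set.mem_Iio] at hpq
    refine ⟨rev_lt hpq.1, rev_lt hpq.2, ?_⟩
    have ht : Typed (!b) (Y.dual ++ Y) (push (Y.length + ·) c) := by
      rintro _ ⟨e, he, rfl⟩
      simpa [List.getElem?_append_right, Boundary.length_dual] using hc e he
    convert path_link_of_mem ht (mem_push_of_mem h) using 1 <;> unfold rev <;> omega

/-- Whatever is plugged into one half of the links reappears reflected on the other half, so
membership reduces to closure under reversal. -/
theorem link_mem_parSet {b : Bool} {Y : Boundary} {U V U' V' : Set (Set (Edge T))}
    (hU' : ∀ a ∈ U', Typed (!b) Y.dual a) (hV' : ∀ c ∈ V', Typed (!b) Y c)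
    (hU : ∀ a ∈ U', push (rev Y.length) a ∈ V) (hV : ∀ c ∈ V', push (rev Y.length) c ∈ U) :
    link b Y ∈ parSet b Y.dual Y U V U' V' := by
  refine ⟨link_typed b Y, fun a ha _ => ?_, fun c hc _ => ?_⟩
  · rw [Boundary.length_dual, pull_paths_link_left (hU' a ha)]
    exact hU a ha
  · rw [Boundary.length_dual, pull_paths_link_right (hV' c hc)]
    exact hV c hc

theorem link_mem_realizers_par {ξ : N → Boundary} {L : Bool → N → Set (Set (Edge T))}
    (hL : ∀ b p, ∀ d ∈ L b p, Typed b (ξ p) d) (X : Formula N) :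
    link true (X.interp ξ) ∈ realizers ξ L (X.dual.par X) true := by
  have hl := Formula.length_interp_dual ξ X
  have ht := realizers_typed hL
  simp only [realizers, Formula.interp_dual]
  refine link_mem_parSet (fun a ha => ?_) (ht X _) (fun a ha => ?_) fun c hc => ?_
  · simpa [Formula.interp_dual] using ht _ _ a ha
  · simpa [hl, Formula.dual_dual] using push_rev_mem_realizers hL ha
  · simpa using push_rev_mem_realizers hL hc

/-- This is what a cut plugs in: cutting on `X` means forming `X ⊗ X^⊥` and inserting the identity
links as a test of it. -/
theorem link_mem_realizers_tensor {ξ : N → Boundary} {L : Bool → N → Set (Set (Edge T))}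
    (hL : ∀ b p, ∀ d ∈ L b p, Typed b (ξ p) d) (X : Formula N) :
    link false (X.dual.interp ξ) ∈ realizers ξ L (X.tensor X.dual) false := by
  have hl := Formula.length_interp_dual ξ X
  have ht := realizers_typed hL
  have h := link_mem_parSet (b := false) (Y := X.dual.interp ξ) (U := realizers ξ L X false)
    (V := realizers ξ L X.dual false) (U' := realizers ξ L X true) (V' := realizers ξ L X.dual true)
    (fun a ha => ?_) (ht X.dual _) (fun a ha => ?_) fun c hc => ?_
  · rw [← Formula.interp_dual, Formula.dual_dual] at h
    exact h
  · simpa [Formula.interp_dual, Boundary.dual_dual] using ht _ _ a ha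
  · simpa [hl] using push_rev_mem_realizers hL ha
  · simpa [Formula.dual_dual] using push_rev_mem_realizers hL hc

/-! ### Placed formulas -/

/-- A formula whose vertices are embedded by a map of positions. -/
abbrev Placed (N : Type v) := Formula N × (ℕ → ℕ)

/-- The positions of the vertices of a formula. -/
def dom (ξ : N → Boundary) (q : Placed N) : Set ℕ := Set.Iio (q.1.interp ξ).length

def zone (ξ : N → Boundary) (P : List (Placed N)) : Set ℕ :=
  {v | ∃ q ∈ P, ∃ i ∈ dom ξ q, q.2 i = v}

theorem mem_zone_cons {ξ : N → Boundary} {q : Placed N} {P : List (Placed N)} {v : ℕ} :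
    v ∈ zone ξ (q :: P) ↔ (∃ i ∈ dom ξ q, q.2 i = v) ∨ v ∈ zone ξ P := by
  simp [zone]

theorem mem_zone_of_mem {ξ : N → Boundary} {q : Placed N} {P : List (Placed N)} (h : q ∈ P) {i : ℕ}
    (hi : i ∈ dom ξ q) : q.2 i ∈ zone ξ P := ⟨q, h, i, hi, rfl⟩

theorem zone_mono {ξ : N → Boundary} {P Q : List (Placed N)} (h : P ⊆ Q) : zone ξ P ⊆ zone ξ Q :=
  fun _ ⟨q, hq, hi⟩ => ⟨q, h hq, hi⟩

/-- The edge sets that may be plugged into a list of placed formulas. -/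
def tests (F : Formula N → Bool → Set (Set (Edge T))) : List (Placed N) → Set (Set (Edge T))
  | [] => {∅}
  | q :: P => {d | ∃ t ∈ F q.1 false, ∃ B ∈ tests F P, d = push q.2 t ∪ B}

/-- Plugging edge sets into all but one of the placed formulas yields a realizer of the remaining
one. -/
def Realizes (ξ : N → Boundary) (F : Formula N → Bool → Set (Set (Edge T))) (P : List (Placed N))
    (σ : Set (Edge T)) : Prop :=
  ∀ q l, P.Perm (q :: l) → ∀ B ∈ tests F l, ¬ Cyc σ B → pull q.2 (dom ξ q) (paths σ B) ∈ F q.1 true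

/-! ### Realizability of lists of placed formulas -/

section Tests

variable {ξ : N → Boundary} {F : Formula N → Bool → Set (Set (Edge T))}

theorem mem_tests_cons {q : Placed N} {P : List (Placed N)} {d : Set (Edge T)} :
    d ∈ tests F (q :: P) ↔ ∃ t ∈ F q.1 false, ∃ B ∈ tests F P, d = push q.2 t ∪ B := Iff.rfl

theorem mem_tests_append {P Q : List (Placed N)} {d : Set (Edge T)} :
    d ∈ tests F (P ++ Q) ↔ ∃ B₁ ∈ tests F P, ∃ B₂ ∈ tests F Q, d = B₁ ∪ B₂ := by
  induction P generalizing d with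
  | nil => simp [tests]
  | cons q P ih =>
    simp only [List.cons_append, mem_tests_cons, ih]
    constructor
    · rintro ⟨t, ht, _, ⟨B₁, h1, B₂, h2, rfl⟩, rfl⟩
      exact ⟨_, ⟨t, ht, B₁, h1, rfl⟩, B₂, h2, by rw [Set.union_assoc]⟩
    · rintro ⟨_, ⟨t, ht, B₁, h1, rfl⟩, B₂, h2, rfl⟩
      exact ⟨t, ht, _, ⟨B₁, h1, B₂, h2, rfl⟩, by rw [Set.union_assoc]⟩

theorem tests_perm {P Q : List (Placed N)} (h : P.Perm Q) : tests F P = tests F Q := by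
  induction h with
  | nil => rfl
  | cons q _ ih => simp only [tests, ih]
  | swap q r P =>
    ext d
    simp only [mem_tests_cons]
    constructor
    · rintro ⟨t, ht, _, ⟨t', ht', B, hB, rfl⟩, rfl⟩
      exact ⟨t', ht', _, ⟨t, ht, B, hB, rfl⟩, by rw [Set.union_left_comm]⟩
    · rintro ⟨t, ht, _, ⟨t', ht', B, hB, rfl⟩, rfl⟩
      exact ⟨t', ht', _, ⟨t, ht, B, hB, rfl⟩, by rw [Set.union_left_comm]⟩
  | trans _ _ ih1 ih2 => exact ih1.trans ih2

theorem tests_suppIn (hF : ∀ X b, ∀ d ∈ F X b, SuppIn (Set.Iio (X.interp ξ).length) d)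
    {P : List (Placed N)} {B : Set (Edge T)} (hB : B ∈ tests F P) : SuppIn (zone ξ P) B := by
  induction P generalizing B with
  | nil =>
    obtain rfl : B = ∅ := hB
    exact fun _ h => h.elim
  | cons q P ih =>
    obtain ⟨t, ht, B, hB, rfl⟩ := hB
    refine SuppIn.union ((hF _ _ t ht).push fun i hi => ?_) ((ih hB).mono ?_)
    · exact mem_zone_of_mem List.mem_cons_self hi
    · exact zone_mono (List.subset_cons_self _ _)

theorem tests_mono {F' : Formula N → Bool → Set (Set (Edge T))} {P : List (Placed N)}
    (h : ∀ q ∈ P, F q.1 false ⊆ F' q.1 false) : tests F P ⊆ tests F' P := by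
  induction P with
  | nil => exact subset_rfl
  | cons q P ih =>
    rintro _ ⟨t, ht, B, hB, rfl⟩
    exact ⟨t, h q List.mem_cons_self ht, B,
      ih (fun r hr => h r (List.mem_cons_of_mem _ hr)) hB, rfl⟩

/-- `q'` is the placed formula `q` renamed by `g`. -/
def Renamed (ξ : N → Boundary) (g : ℕ → ℕ) (q q' : Placed N) : Prop :=
  q.1 = q'.1 ∧ ∀ i ∈ dom ξ q, g (q.2 i) = q'.2 i

theorem mem_tests_renamed (hF : ∀ X b, ∀ d ∈ F X b, SuppIn (Set.Iio (X.interp ξ).length) d)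
    {g : ℕ → ℕ} {P P' : List (Placed N)} (h : List.Forall₂ (Renamed ξ g) P P')
    {d : Set (Edge T)} : d ∈ tests F P' ↔ ∃ B ∈ tests F P, d = push g B := by
  induction h generalizing d with
  | nil => simp [tests]
  | @cons q q' P P' h1 h2 ih =>
    simp only [mem_tests_cons, ih]
    have key : ∀ t ∈ F q.1 false, push q'.2 t = push g (push q.2 t) := fun t ht => by
      rw [push_push]
      exact push_congr (hF _ _ t ht) fun i hi => (h1.2 i hi).symm
    constructor
    · rintro ⟨t, ht, _, ⟨B, hB, rfl⟩, rfl⟩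
      rw [← h1.1] at ht
      exact ⟨_, ⟨t, ht, B, hB, rfl⟩, by rw [push_union, key t ht]⟩
    · rintro ⟨_, ⟨t, ht, B, hB, rfl⟩, rfl⟩
      exact ⟨t, h1.1 ▸ ht, _, ⟨B, hB, rfl⟩, by rw [push_union, key t ht]⟩

theorem Renamed.exists_perm {g : ℕ → ℕ} {P P' : List (Placed N)}
    (h : List.Forall₂ (Renamed ξ g) P P') {q' : Placed N} {l' : List (Placed N)}
    (hp : P'.Perm (q' :: l')) : ∃ q l, P.Perm (q :: l) ∧ Renamed ξ g q q' ∧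
      List.Forall₂ (Renamed ξ g) l l' := by
  have h1 : Relation.Comp (List.Forall₂ (Renamed ξ g)) List.Perm P (q' :: l') := ⟨P', h, hp⟩
  rw [List.forall₂_comp_perm_eq_perm_comp_forall₂] at h1
  obtain ⟨Q, h2, h3⟩ := h1
  obtain ⟨q, l, h4, h5, rfl⟩ := List.forall₂_cons_right_iff.1 h3
  exact ⟨q, l, h2, h4, h5⟩

theorem Renamed.exists_perm' {g : ℕ → ℕ} {P P' : List (Placed N)}
    (h : List.Forall₂ (Renamed ξ g) P P') {q : Placed N} {l : List (Placed N)}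
    (hp : P.Perm (q :: l)) : ∃ q' l', P'.Perm (q' :: l') ∧ Renamed ξ g q q' ∧
      List.Forall₂ (Renamed ξ g) l l' := by
  have h1 : Relation.Comp List.Perm (List.Forall₂ (Renamed ξ g)) (q :: l) P' := ⟨P, hp.symm, h⟩
  rw [← List.forall₂_comp_perm_eq_perm_comp_forall₂] at h1
  obtain ⟨Q, h2, h3⟩ := h1
  obtain ⟨q', l', h4, h5, rfl⟩ := List.forall₂_cons_left_iff.1 h2
  exact ⟨q', l', h3.symm, h4, h5⟩

/-- The case distinction of every rule: the formula left unplugged is either the principal formula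
or a side formula. -/
theorem perm_cons_cons_iff {α : Type*} {a q : α} {P l : List α} (h : (a :: P).Perm (q :: l)) :
    (q = a ∧ P.Perm l) ∨ ∃ P', P.Perm (q :: P') ∧ l.Perm (a :: P') := by
  rcases List.mem_cons.1 (h.mem_iff.2 List.mem_cons_self) with rfl | hq
  · exact Or.inl ⟨rfl, h.cons_inv⟩
  · obtain ⟨s, t, rfl⟩ := List.append_of_mem hq
    refine Or.inr ⟨s ++ t, List.perm_middle, ?_⟩
    have h1 : (a :: (s ++ q :: t)).Perm (q :: a :: (s ++ t)) :=
      (List.perm_middle.cons a).trans (List.Perm.swap _ _ _)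
    exact (h.symm.trans h1).cons_inv

theorem Realizes.perm {P Q : List (Placed N)} {σ : Set (Edge T)} (h : Realizes ξ F P σ)
    (hPQ : P.Perm Q) : Realizes ξ F Q σ := fun q l hq => h q l (hPQ.trans hq)

theorem pull_comp_push {g f : ℕ → ℕ} {M K : Set ℕ} {E : Set (Edge T)} (hg : Set.InjOn g K)
    (hE : SuppIn K E) (hf : ∀ i ∈ M, f i ∈ K) : pull (g ∘ f) M (push g E) = pull f M E := by
  rw [← pull_pull hf, pull_push hE hg]

theorem Realizes.rename (hF : ∀ X b, ∀ d ∈ F X b, SuppIn (Set.Iio (X.interp ξ).length) d)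
    {P P' : List (Placed N)} {σ : Set (Edge T)} {g : ℕ → ℕ} {K : Set ℕ} (hg : Set.InjOn g K)
    (hσ : SuppIn K σ) (hP : zone ξ P ⊆ K) (hPP' : List.Forall₂ (Renamed ξ g) P P')
    (h : Realizes ξ F P σ) : Realizes ξ F P' (push g σ) := by
  intro q' l' hp B' hB' hcyc
  obtain ⟨q, l, h1, h2, h3⟩ := Renamed.exists_perm hPP' hp
  obtain ⟨B, hB, rfl⟩ := (mem_tests_renamed hF h3).1 hB'
  have hBK : SuppIn K B := (tests_suppIn hF hB).mono fun v hv => hP <|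
    zone_mono (fun r hr => h1.mem_iff.2 (List.mem_cons_of_mem _ hr)) hv
  rw [cyc_push_iff hg hσ hBK] at hcyc
  have h4 := h q l h1 B hB hcyc
  obtain ⟨h5, h6⟩ := h2
  have hdom : dom ξ q' = dom ξ q := by rw [dom, dom, h5]
  rw [← h5, hdom, paths_push hg hσ hBK, ← pull_congr (f := g ∘ q.2) h6,
    pull_comp_push hg (suppIn_paths hσ)]
  · exact h4
  · exact fun i hi => hP (mem_zone_of_mem (h1.mem_iff.2 List.mem_cons_self) hi)

/-- Associativity of plugging as an equality of edge sets. -/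
theorem pull_paths_pull {σ B C : Set (Edge T)} {f g : ℕ → ℕ} {K M : Set ℕ} (hC : SuppIn K C)
    (hg : ∀ i ∈ M, g i ∈ K) : pull g M (paths (pull f K (paths σ B)) C) =
      pull (f ∘ g) M (paths σ (B ∪ push f C)) := by
  ext ⟨i, w, j⟩
  simp only [mem_pull, mem_paths, Function.comp]
  refine and_congr_right fun hi => and_congr_right fun hj => ?_
  rw [path_union_push_iff hC (hg i hi) (hg j hj)]

/-- Realization after the contraction of a set `C` of links. -/
theorem Realizes.pull_of_contract
    (hF : ∀ X b, ∀ d ∈ F X b, SuppIn (Set.Iio (X.interp ξ).length) d)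
    {P P' : List (Placed N)} {σ C : Set (Edge T)} {g : ℕ → ℕ} (hcyc : ¬ Cyc σ C)
    (hPP' : List.Forall₂ (Renamed ξ g) P P')
    (h : ∀ q l, P'.Perm (q :: l) → ∀ B ∈ tests F l, ¬ Cyc σ (C ∪ B) →
      pull q.2 (dom ξ q) (paths σ (C ∪ B)) ∈ F q.1 true) :
    Realizes ξ F P (pull g Set.univ (paths σ C)) := by
  intro q l hp B hB hcyc'
  obtain ⟨q', l', h1, h2, h3⟩ := Renamed.exists_perm' hPP' hp
  have hS : SuppIn Set.univ B := fun _ _ => ⟨trivial, trivial⟩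
  have h4 := h q' l' h1 (push g B) ((mem_tests_renamed hF h3).2 ⟨B, hB, rfl⟩) (by
    rw [cyc_union_push_iff hS]
    exact not_or_intro hcyc hcyc')
  obtain ⟨h5, h6⟩ := h2
  have hdom : dom ξ q' = dom ξ q := by rw [dom, dom, h5]
  rw [pull_paths_pull hS fun _ _ => trivial, pull_congr (f := g ∘ q.2) (g := q'.2) h6, h5, ← hdom]
  exact h4

end Tests

/-! ### Realizability of the rules for par and tensor -/

section Rules

variable {ξ : N → Boundary} {L : Bool → N → Set (Set (Edge T))}

/-- Every source of an edge of `σ` at the placed formula is a left endpoint, every target a right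
endpoint. -/
def PolarizedAt (ξ : N → Boundary) (q : Placed N) (σ : Set (Edge T)) : Prop :=
  ∀ e ∈ σ, ∀ i ∈ dom ξ q, (e.src = q.2 i → (q.1.interp ξ)[i]? = some (pol true)) ∧
    (e.tgt = q.2 i → (q.1.interp ξ)[i]? = some (pol false))

theorem PolarizedAt.typed {q : Placed N} {σ B : Set (Edge T)} (h : PolarizedAt ξ q σ) :
    Typed true (q.1.interp ξ) (pull q.2 (dom ξ q) (paths σ B)) := by
  rintro ⟨i, w, j⟩ ⟨hi, hj, hp⟩
  obtain ⟨_, _, h1⟩ := Path.head hp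
  obtain ⟨_, _, h2⟩ := Path.last hp
  exact ⟨(h _ h1 i hi).1 rfl, (h _ h2 j hj).2 rfl⟩

/-- If the par itself is left unplugged, its two clauses are instances of the hypothesis, by
associativity of plugging. Otherwise a test of the par is plugged in, and this is a union of tests
of its two components. -/
theorem Realizes.par (hL : ∀ b p, ∀ d ∈ L b p, Typed b (ξ p) d) {X Y : Formula N} {f : ℕ → ℕ}
    {P : List (Placed N)} {σ : Set (Edge T)} (hσ : PolarizedAt ξ (X.par Y, f) σ)
    (h : Realizes ξ (realizers ξ L)
      ((X, f) :: (Y, fun i => f ((X.interp ξ).length + i)) :: P) σ) :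
    Realizes ξ (realizers ξ L) ((X.par Y, f) :: P) σ := by
  intro q l hp B hB hcyc
  have hlen : ((X.par Y).interp ξ).length = (X.interp ξ).length + (Y.interp ξ).length := by
    simp [Formula.interp]
  rcases perm_cons_cons_iff hp with ⟨rfl, hl⟩ | ⟨P', hP', hl⟩
  · rw [← tests_perm hl] at hB
    refine ⟨hσ.typed, fun a ha hc => ?_, fun c hc hc' => ?_⟩
    · have ha1 := realizers_suppIn hL _ _ a ha
      have ha2 : SuppIn (dom ξ (X.par Y, f)) a := ha1.mono fun i hi => by
        simp only [dom, hlen, Set.mem_Iio] at hi ⊢; omega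
      rw [pull_paths_pull ha2, Set.union_comm]
      · refine h _ _ (List.Perm.swap _ _ _) _ ⟨a, ha, B, hB, rfl⟩ ?_
        rw [Set.union_comm, cyc_union_push_iff ha2]
        exact not_or_intro hcyc hc
      · intro i hi
        simp only [dom, hlen, Set.mem_Iio] at hi ⊢; omega
    · have hc1 := realizers_suppIn hL _ _ c hc
      have hc2 : SuppIn (dom ξ (X.par Y, f)) (push ((X.interp ξ).length + ·) c) :=
        hc1.push fun i hi => by
          simp only [dom, hlen, Set.mem_Iio] at hi ⊢; omega
      rw [pull_paths_pull hc2, Set.union_comm]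
      · refine h _ _ (List.Perm.refl _) _ ⟨c, hc, B, hB, by rw [push_push]; rfl⟩ ?_
        rw [Set.union_comm, cyc_union_push_iff hc2]
        exact not_or_intro hcyc hc'
      · intro i hi
        simp only [dom, hlen, Set.mem_Iio, id] at hi ⊢; omega
  · rw [tests_perm hl] at hB
    obtain ⟨t, ⟨a, ha, c, hc, rfl⟩, B, hB, rfl⟩ := hB
    refine h q ((X, f) :: (Y, fun i => f ((X.interp ξ).length + i)) :: P')
      ?_ _ ⟨a, ha, _, ⟨c, hc, B, hB, rfl⟩, ?_⟩ hcyc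
    · exact ((hP'.cons _).cons _).trans (((List.Perm.swap _ _ _).cons _).trans (List.Perm.swap _ _ _))
    · rw [push_union, push_push, Set.union_assoc]; rfl

/-- Par is invertible in the model: if one component is left unplugged, the clauses of `parSet`
apply; if neither is, the two tests unite to a test of the par. -/
theorem Realizes.of_par (hL : ∀ b p, ∀ d ∈ L b p, Typed b (ξ p) d) {X Y : Formula N} {f : ℕ → ℕ}
    {P : List (Placed N)} {σ : Set (Edge T)}
    (h : Realizes ξ (realizers ξ L) ((X.par Y, f) :: P) σ) :
    Realizes ξ (realizers ξ L)
      ((X, f) :: (Y, fun i => f ((X.interp ξ).length + i)) :: P) σ := by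
  intro q l hp B hB hcyc
  have hlen : ((X.par Y).interp ξ).length = (X.interp ξ).length + (Y.interp ξ).length := by
    simp [Formula.interp]
  rcases perm_cons_cons_iff hp with ⟨rfl, hl⟩ | ⟨P', hP', hl⟩
  · rw [← tests_perm hl] at hB
    obtain ⟨c, hc, B, hB, rfl⟩ := hB
    have hc1 := realizers_suppIn hL _ _ c hc
    have hc2 : SuppIn (dom ξ (X.par Y, f)) (push ((X.interp ξ).length + ·) c) :=
      hc1.push fun i hi => by
        simp only [dom, hlen, Set.mem_Iio] at hi ⊢; omega
    have hpush : push (fun i => f ((X.interp ξ).length + i)) c =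
      push f (push ((X.interp ξ).length + ·) c) := by rw [push_push]; rfl
    simp only [hpush] at hcyc ⊢
    rw [Set.union_comm] at hcyc ⊢
    rw [cyc_union_push_iff hc2, not_or] at hcyc
    have h1 := (h _ _ (List.Perm.refl _) B hB hcyc.1).2.2 c hc hcyc.2
    rw [pull_paths_pull hc2] at h1
    · exact h1
    · intro i hi
      simp only [dom, hlen, Set.mem_Iio, id] at hi ⊢; omega
  · rw [tests_perm hl] at hB
    obtain ⟨a, ha, B, hB, rfl⟩ := hB
    rcases perm_cons_cons_iff hP' with ⟨rfl, hl'⟩ | ⟨P'', hP'', hl'⟩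
    · rw [← tests_perm hl'] at hB
      have ha1 := realizers_suppIn hL _ _ a ha
      have ha2 : SuppIn (dom ξ (X.par Y, f)) a := ha1.mono fun i hi => by
        simp only [dom, hlen, Set.mem_Iio] at hi ⊢; omega
      rw [Set.union_comm] at hcyc ⊢
      simp only at hcyc ⊢
      rw [cyc_union_push_iff ha2, not_or] at hcyc
      have h1 := (h _ _ (List.Perm.refl _) B hB hcyc.1).2.1 a ha hcyc.2
      rw [pull_paths_pull ha2] at h1
      · exact h1
      · intro i hi
        simp only [dom, hlen, Set.mem_Iio] at hi ⊢; omega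
    · rw [tests_perm hl'] at hB
      obtain ⟨c, hc, B, hB, rfl⟩ := hB
      refine h q ((X.par Y, f) :: P'') ((hP''.cons _).trans (List.Perm.swap _ _ _)) _
        ⟨_, ⟨a, ha, c, hc, rfl⟩, B, hB, ?_⟩ hcyc
      rw [push_union, push_push, Set.union_assoc]; rfl

theorem Realizes.singleton (hL : ∀ b p, ∀ d ∈ L b p, Typed b (ξ p) d) {q : Placed N}
    {d : Set (Edge T)} (hd : d ∈ realizers ξ L q.1 true) (hq : Set.InjOn q.2 (dom ξ q)) :
    Realizes ξ (realizers ξ L) [q] (push q.2 d) := by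
  intro q' l hp B hB hcyc
  obtain ⟨rfl, rfl⟩ : q = q' ∧ l = [] := by simpa using hp
  obtain rfl : B = ∅ := hB
  rw [paths_empty_right, pull_push (N := dom ξ q) (realizers_suppIn hL _ _ d hd) hq]
  exact hd

theorem path_restrict {s B : Set (Edge T)} {R : Set ℕ} (hs : SuppIn R s) {a b : ℕ} {w : List T}
    (h : Path s B a w b) : Path s {e | e ∈ B ∧ e.src ∈ R ∧ e.tgt ∈ R} a w b := by
  induction h with
  | single h => exact .single h
  | step h1 h2 h3 ih =>
    exact .step h1 ⟨h2, (hs.mem h1).2, (h3.mem_of_suppIn hs).1⟩ ih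

/-- The detours are computed in the coordinates of the connector: only the part of zone two visible
on `N₂` takes part, and it is plugged into `s` before the renaming. -/
theorem detour_push {A₂ B₂ s : Set (Edge T)} {Z₁ Z₂ N₁ N₂ : Set ℕ} {f : ℕ → ℕ}
    (hZ : Disjoint Z₁ Z₂) (hA₂ : SuppIn Z₂ A₂) (hs : SuppIn (N₁ ∪ N₂) s)
    (hf : Set.InjOn f (N₁ ∪ N₂)) (h1 : ∀ i ∈ N₁, f i ∈ Z₁) (h2 : ∀ i ∈ N₂, f i ∈ Z₂) :
    detour A₂ B₂ (push f s) Z₁ = push f (pull id N₁ (paths s (pull f N₂ (paths A₂ B₂)))) := by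
  have hd : ∀ {i}, i ∈ Z₁ → i ∈ Z₂ → False := fun h1 h2 => Set.disjoint_left.1 hZ h1 h2
  have hC : SuppIn (N₁ ∪ N₂) (pull f N₂ (paths A₂ B₂)) :=
    (suppIn_pull _ _ _).mono Set.subset_union_right
  ext ⟨x, w, y⟩
  rw [mem_push]
  constructor
  · rintro ⟨hx, hy, hp⟩
    have hp1 := path_restrict (hs.push (N' := f '' (N₁ ∪ N₂)) fun i hi => ⟨i, hi, rfl⟩) hp
    have hp2 : Path (push f s) (push f (pull f N₂ (paths A₂ B₂))) x w y := by
      refine hp1.mono subset_rfl ?_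
      rintro ⟨p, v, q⟩ ⟨h3, ⟨i, hi, rfl⟩, ⟨j, hj, rfl⟩⟩
      have h4 := suppIn_paths hA₂ _ h3
      have hi := hi.resolve_left fun hi => hd (h1 i hi) h4.1
      have hj := hj.resolve_left fun hj => hd (h1 j hj) h4.2
      exact mem_push_of_mem ⟨hi, hj, h3⟩
    obtain ⟨a, b, rfl, rfl, hp3⟩ := hp2.of_push hf hs hC
    have h5 := hp3.mem_of_suppIn hs
    refine ⟨a, b, ⟨?_, ?_, hp3⟩, rfl, rfl⟩
    · exact h5.1.resolve_right fun h => hd hx (h2 a h)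
    · exact h5.2.resolve_right fun h => hd hy (h2 b h)
  · rintro ⟨a, b, ⟨ha, hb, hp⟩, rfl, rfl⟩
    refine ⟨h1 a ha, h1 b hb, (Path.push f hp).mono subset_rfl ?_⟩
    rintro _ ⟨e, he, rfl⟩
    exact he.2.2

theorem Cyc.push {A B : Set (Edge T)} (f : ℕ → ℕ) (h : Cyc A B) :
    Cyc (push f A) (push f B) := by
  obtain ⟨a, u, x, v, h1, h2⟩ := h
  exact ⟨_, _, _, _, h1.push f, mem_push_of_mem h2⟩

theorem push_pull_subset (f : ℕ → ℕ) (K : Set ℕ) (E : Set (Edge T)) : push f (pull f K E) ⊆ E := by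
  rintro _ ⟨e, he, rfl⟩
  exact he.2.2

/-- Plugging into a realizer of `X` and further formulas through a connector `s` to another
multiword. -/
theorem Realizes.detour (hL : ∀ b p, ∀ d ∈ L b p, Typed b (ξ p) d)
    {q r : Placed N} {P P' Q : List (Placed N)} {A₁ A₂ B₁ B₂ s t : Set (Edge T)} {Z₁ Z₂ : Set ℕ}
    (h : Realizes ξ (realizers ξ L) (r :: P) A₁) (hP : P.Perm (q :: P'))
    (hZ : Disjoint Z₁ Z₂) (hPZ : zone ξ P ⊆ Z₁) (hQZ : zone ξ Q ⊆ Z₂)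
    (hA₁ : SuppIn Z₁ A₁) (hA₂ : SuppIn Z₂ A₂)
    (hB₁ : B₁ ∈ tests (realizers ξ L) P') (hB₂ : B₂ ∈ tests (realizers ξ L) Q)
    (hs : SuppIn (Z₁ ∪ Z₂) s) (ht : t ∈ realizers ξ L r.1 false)
    (hst : LinLog.detour A₂ B₂ s Z₁ = push r.2 t) (hcyc : ¬ Cyc (A₁ ∪ A₂) (B₁ ∪ B₂ ∪ s)) :
    pull q.2 (dom ξ q) (paths (A₁ ∪ A₂) (B₁ ∪ B₂ ∪ s)) ∈ realizers ξ L q.1 true := by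
  have hF := realizers_suppIn hL
  have hB₁' : SuppIn Z₁ B₁ := (tests_suppIn hF hB₁).mono fun v hv => hPZ <|
    zone_mono (fun r hr => hP.mem_iff.2 (List.mem_cons_of_mem _ hr)) hv
  have hB₂' : SuppIn Z₂ B₂ := (tests_suppIn hF hB₂).mono hQZ
  have hq : ∀ i ∈ dom ξ q, q.2 i ∈ Z₁ := fun i hi =>
    hPZ (mem_zone_of_mem (hP.mem_iff.2 List.mem_cons_self) hi)
  have key := h q (r :: P') ((hP.cons _).trans (List.Perm.swap _ _ _)) _
    ⟨t, ht, B₁, hB₁, rfl⟩ (by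
      rw [← hst, Set.union_comm]
      exact fun h => hcyc (cyc_of_cyc_detour h))
  rw [← hst, Set.union_comm] at key
  convert key using 1
  ext ⟨i, w, j⟩
  simp only [mem_pull, mem_paths]
  refine and_congr_right fun hi => and_congr_right fun hj => ?_
  exact path_zones_iff hZ hA₁ hA₂ hB₁' hB₂' hs (hq i hi) (hq j hj)

theorem path_disjoint_union {A₁ A₂ B₁ B₂ : Set (Edge T)} {Z₁ Z₂ : Set ℕ} (hZ : Disjoint Z₁ Z₂)
    (hA₁ : SuppIn Z₁ A₁) (hA₂ : SuppIn Z₂ A₂) (hB₁ : SuppIn Z₁ B₁) (hB₂ : SuppIn Z₂ B₂)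
    {a b : ℕ} {w : List T} :
    Path (A₁ ∪ A₂) (B₁ ∪ B₂) a w b ↔ Path A₁ B₁ a w b ∨ Path A₂ B₂ a w b := by
  have key : ∀ {A₁ A₂ B₁ B₂ : Set (Edge T)} {Z₁ Z₂ : Set ℕ} (_ : Disjoint Z₁ Z₂)
    (_ : SuppIn Z₁ A₁) (_ : SuppIn Z₂ A₂) (_ : SuppIn Z₁ B₁) (_ : SuppIn Z₂ B₂)
    {a b : ℕ} {w : List T}, Path (A₁ ∪ A₂) (B₁ ∪ B₂) a w b → b ∈ Z₁ → Path A₁ B₁ a w b := by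
    intro A₁ A₂ B₁ B₂ Z₁ Z₂ hZ hA₁ hA₂ hB₁ hB₂ a b w h hb
    have h1 := path_zones_cases hZ hA₁ hA₂ hB₁ hB₂ (s := ∅) (fun _ h => h.elim)
      (by rwa [Set.union_empty]) hb
    rcases (h.mem_of_suppIn (hA₁.mono Set.subset_union_left |>.union
      (hA₂.mono Set.subset_union_right))).1 with ha | ha
    · refine (h1.1 ha).mono subset_rfl (Set.union_subset subset_rfl ?_)
      rintro e ⟨_, _, h2⟩
      obtain ⟨_, _, h3⟩ := h2.head
      exact h3.elim
    · obtain ⟨_, _, _, _, _, _, h2, _⟩ := h1.2 ha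
      obtain ⟨_, _, h3⟩ := h2.head
      exact h3.elim
  constructor
  · intro h
    rcases (h.mem_of_suppIn (hA₁.mono Set.subset_union_left |>.union
      (hA₂.mono Set.subset_union_right))).2 with hb | hb
    · exact Or.inl (key hZ hA₁ hA₂ hB₁ hB₂ h hb)
    · rw [Set.union_comm A₁, Set.union_comm B₁] at h
      exact Or.inr (key hZ.symm hA₂ hA₁ hB₂ hB₁ h hb)
  · rintro (h | h)
    · exact h.mono Set.subset_union_left Set.subset_union_left
    · exact h.mono Set.subset_union_right Set.subset_union_right

/-- If the tensor is left unplugged, the zones are separate and the paths are the disjoint union of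
those of the premises. If a side formula of one premise is left, the test of the tensor connects the
zones: the other premise supplies a realizer, which turns this test into a test for the first
premise. That test is the detour through the other zone. -/
theorem Realizes.tensor (hL : ∀ b p, ∀ d ∈ L b p, Typed b (ξ p) d) {X Y : Formula N}
    {f fX fY : ℕ → ℕ} {P Q : List (Placed N)} {A₁ A₂ : Set (Edge T)} {Z₁ Z₂ : Set ℕ}
    (hX : Realizes ξ (realizers ξ L) ((X, fX) :: P) A₁)
    (hY : Realizes ξ (realizers ξ L) ((Y, fY) :: Q) A₂)
    (hZ : Disjoint Z₁ Z₂) (hPZ : zone ξ ((X, fX) :: P) ⊆ Z₁) (hQZ : zone ξ ((Y, fY) :: Q) ⊆ Z₂)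
    (hA₁ : SuppIn Z₁ A₁) (hA₂ : SuppIn Z₂ A₂)
    (hfX : ∀ i ∈ dom ξ (X, fX), f i = fX i)
    (hfY : ∀ i ∈ dom ξ (Y, fY), f ((X.interp ξ).length + i) = fY i)
    (hf : Set.InjOn f (dom ξ (X.tensor Y, f))) :
    Realizes ξ (realizers ξ L) ((X.tensor Y, f) :: (P ++ Q)) (A₁ ∪ A₂) := by
  intro q l hp B hB hcyc
  have hF := realizers_suppIn hL
  have hlen : ((X.tensor Y).interp ξ).length = (X.interp ξ).length + (Y.interp ξ).length := by
    simp [Formula.interp]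
  have hP : zone ξ P ⊆ Z₁ := (zone_mono (List.subset_cons_self _ _)).trans hPZ
  have hQ : zone ξ Q ⊆ Z₂ := (zone_mono (List.subset_cons_self _ _)).trans hQZ
  set m := (X.interp ξ).length with hm
  set n := (Y.interp ξ).length with hn
  have hN : dom ξ (X.tensor Y, f) = Set.Iio m ∪ Set.Ico m (m + n) := by
    ext i
    simp only [dom, hlen, Set.mem_Iio, Set.mem_union, Set.mem_Ico]; omega
  have hfZ₁ : ∀ i ∈ Set.Iio m, f i ∈ Z₁ := fun i hi => by
    rw [hfX i hi]
    exact hPZ (mem_zone_of_mem (q := (X, fX)) List.mem_cons_self hi)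
  have hfZ₂ : ∀ i ∈ Set.Ico m (m + n), f i ∈ Z₂ := fun i hi => by
    have hi' : i - m ∈ dom ξ (Y, fY) := by
      simp only [dom, Set.mem_Iio, Set.mem_Ico] at hi ⊢; omega
    have : f i = fY (i - m) := by
      rw [← hfY _ hi']
      congr 1
      simp only [Set.mem_Ico] at hi; omega
    rw [this]
    exact hQZ (mem_zone_of_mem (q := (Y, fY)) List.mem_cons_self hi')
  have hpullX : ∀ E : Set (Edge T), pull f (Set.Iio m) E = pull fX (dom ξ (X, fX)) E :=
    fun E => pull_congr hfX
  have hpullY : ∀ E : Set (Edge T), pull f (Set.Ico m (m + n)) E =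
      push (m + ·) (pull fY (dom ξ (Y, fY)) E) := fun E => by
    ext ⟨i, w, j⟩
    rw [mem_push]
    constructor
    · rintro ⟨hi, hj, h⟩
      simp only [Set.mem_Ico] at hi hj
      have hi' : i - m ∈ dom ξ (Y, fY) := by simp only [dom, Set.mem_Iio]; omega
      have hj' : j - m ∈ dom ξ (Y, fY) := by simp only [dom, Set.mem_Iio]; omega
      refine ⟨i - m, j - m, ⟨hi', hj', ?_⟩, by omega, by omega⟩
      simp only
      rw [← hfY _ hi', ← hfY _ hj', show m + (i - m) = i by omega, show m + (j - m) = j by omega]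
      exact h
    · rintro ⟨i, j, ⟨hi, hj, h⟩, rfl, rfl⟩
      have hi1 := hi
      have hj1 := hj
      simp only [dom, Set.mem_Iio] at hi1 hj1
      refine ⟨by simp only [Set.mem_Ico]; omega, by simp only [Set.mem_Ico]; omega, ?_⟩
      simp only
      rw [hfY i hi, hfY j hj]
      exact h
  rcases perm_cons_cons_iff hp with ⟨rfl, hl⟩ | ⟨R, hR, hl⟩
  · rw [← tests_perm hl, mem_tests_append] at hB
    obtain ⟨B₁, hB₁, B₂, hB₂, rfl⟩ := hB
    have h1 := hX _ _ (List.Perm.refl _) B₁ hB₁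
      fun h => hcyc (h.mono Set.subset_union_left Set.subset_union_left)
    have h2 := hY _ _ (List.Perm.refl _) B₂ hB₂
      fun h => hcyc (h.mono Set.subset_union_right Set.subset_union_right)
    refine ⟨_, h1, _, h2, ?_⟩
    simp only
    rw [← hpullX, ← hpullY, hN]
    have hB₁' := (tests_suppIn hF hB₁).mono hP
    have hB₂' := (tests_suppIn hF hB₂).mono hQ
    ext ⟨i, w, j⟩
    simp only [mem_pull, Set.mem_union, mem_paths, path_disjoint_union hZ hA₁ hA₂ hB₁' hB₂']
    have hd : ∀ {i}, i ∈ Z₁ → i ∈ Z₂ → False := fun h1 h2 => Set.disjoint_left.1 hZ h1 h2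
    constructor
    · rintro ⟨hi, hj, h | h⟩
      · have h3 := h.mem_of_suppIn hA₁
        exact Or.inl ⟨hi.resolve_right fun hi => hd h3.1 (hfZ₂ i hi),
          hj.resolve_right fun hj => hd h3.2 (hfZ₂ j hj), h⟩
      · have h3 := h.mem_of_suppIn hA₂
        exact Or.inr ⟨hi.resolve_left fun hi => hd (hfZ₁ i hi) h3.1,
          hj.resolve_left fun hj => hd (hfZ₁ j hj) h3.2, h⟩
    · rintro (⟨hi, hj, h⟩ | ⟨hi, hj, h⟩)
      · exact ⟨Or.inl hi, Or.inl hj, Or.inl h⟩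
      · exact ⟨Or.inr hi, Or.inr hj, Or.inr h⟩
  · rw [tests_perm hl] at hB
    obtain ⟨s, hs, B, hB, rfl⟩ := hB
    have hs' := hF _ _ s hs
    have hs1 : SuppIn (Set.Iio m ∪ Set.Ico m (m + n)) s := hN ▸ hs'
    rw [hN] at hf
    have hsZ : SuppIn (Z₁ ∪ Z₂) (push f s) := hs1.push fun i hi =>
      hi.imp (hfZ₁ i) (hfZ₂ i)
    rcases List.mem_append.1 (hR.mem_iff.2 List.mem_cons_self) with hq | hq
    · obtain ⟨P₁, P₂, rfl⟩ := List.append_of_mem hq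
      have hPq : (P₁ ++ q :: P₂).Perm (q :: (P₁ ++ P₂)) := List.perm_middle
      have hR' : R.Perm ((P₁ ++ P₂) ++ Q) :=
        (hR.symm.trans (hPq.append_right Q)).cons_inv
      rw [tests_perm hR', mem_tests_append] at hB
      obtain ⟨B₁, hB₁, B₂, hB₂, rfl⟩ := hB
      rw [Set.union_comm (push f s)] at hcyc ⊢
      -- The second premise provides a realizer of `Y`. Fed to the test `s` of the tensor, it leaves
      -- a test of `X`. The required absence of cycles holds since a cycle in a part expands to one
      -- in the whole.
      have hc := hY _ _ (List.Perm.refl _) B₂ hB₂ fun h => hcyc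
        (h.mono Set.subset_union_right (Set.subset_union_right.trans Set.subset_union_left))
      have hC : push (m + ·) (pull fY (dom ξ (Y, fY)) (paths A₂ B₂)) =
        pull f (Set.Ico m (m + n)) (paths A₂ B₂) := (hpullY _).symm
      have ht := hs.2.2 _ hc fun h => hcyc (cyc_of_cyc_connector ((h.push f).mono subset_rfl
        (by rw [hC]; exact push_pull_subset _ _ _)))
      rw [hC] at ht
      refine hX.detour hL hPq hZ hP hQ hA₁ hA₂ hB₁ hB₂ hsZ ht ?_ hcyc
      rw [detour_push hZ hA₂ hs1 hf hfZ₁ hfZ₂]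
      exact push_congr (suppIn_pull _ _ _) hfX
    · obtain ⟨P₁, P₂, rfl⟩ := List.append_of_mem hq
      have hPq : (P₁ ++ q :: P₂).Perm (q :: (P₁ ++ P₂)) := List.perm_middle
      have hR' : R.Perm (P ++ (P₁ ++ P₂)) :=
        (hR.symm.trans ((hPq.append_left P).trans List.perm_middle)).cons_inv
      rw [tests_perm hR', mem_tests_append] at hB
      obtain ⟨B₁, hB₁, B₂, hB₂, rfl⟩ := hB
      -- The output now lies on the side of `Y`, so the zones exchange their roles.
      rw [Set.union_comm (push f s), Set.union_comm A₁, Set.union_comm B₁] at hcyc ⊢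
      have hc := hX _ _ (List.Perm.refl _) B₁ hB₁ fun h => hcyc
        (h.mono Set.subset_union_right (Set.subset_union_right.trans Set.subset_union_left))
      have hC : pull fX (dom ξ (X, fX)) (paths A₁ B₁) = pull f (Set.Iio m) (paths A₁ B₁) :=
        (hpullX _).symm
      have ht := hs.2.1 _ hc fun h => hcyc (cyc_of_cyc_connector ((h.push f).mono subset_rfl
        (by simp only; rw [hC]; exact push_pull_subset _ _ _)))
      simp only at ht
      rw [hC] at ht
      rw [Set.union_comm] at hs1 hf
      refine hY.detour hL hPq hZ.symm hQ hP hA₂ hA₁ hB₂ hB₁ (Set.union_comm Z₁ Z₂ ▸ hsZ) ht ?_ hcyc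
      rw [detour_push hZ.symm hA₁ hs1 hf hfZ₂ hfZ₁]
      ext ⟨x, w, y⟩
      simp only [mem_push, mem_pull, mem_paths, id, Set.mem_Ico, Set.mem_Iio, ← hm, ← hn]
      constructor
      · rintro ⟨a, b, ⟨ha, hb, h⟩, rfl, rfl⟩
        have ha' : a - m ∈ dom ξ (Y, fY) := by simp only [dom, Set.mem_Iio]; omega
        have hb' : b - m ∈ dom ξ (Y, fY) := by simp only [dom, Set.mem_Iio]; omega
        refine ⟨a - m, b - m, ⟨ha', hb', ?_⟩, ?_, ?_⟩
        · rwa [show m + (a - m) = a by omega, show m + (b - m) = b by omega]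
        · rw [← hfY _ ha', show m + (a - m) = a by omega]
        · rw [← hfY _ hb', show m + (b - m) = b by omega]
      · rintro ⟨a, b, ⟨ha, hb, h⟩, rfl, rfl⟩
        exact ⟨m + a, m + b, ⟨by omega, by omega, h⟩, hfY a ha, hfY b hb⟩

end Rules

/-! ### Contraction by paths -/

namespace Multiword

theorem tensor_edges (k : ℕ) (M M' : Multiword T) :
    (tensor k M M').edges = M.edges ∪ push (k + ·) M'.edges := rfl

theorem tensor_isRegular {k : ℕ} {M M' : Multiword T} :
    (tensor k M M').IsRegular ↔ M.IsRegular ∧ M'.IsRegular := by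
  simp [IsRegular, tensor]

theorem identity_edges (X : Boundary) : (identity X : Multiword T).edges = link true X := by
  simp only [identity, link, pol, Bool.not_true, rev]

theorem cyc_singleton_iff {A : Set (Edge T)} {x y : ℕ} :
    Cyc A {⟨x, [], y⟩} ↔ ∃ w, (⟨y, w, x⟩ : Edge T) ∈ A := by
  constructor
  · rintro ⟨a, u, z, v, h1, h2⟩
    simp only [Set.mem_singleton_iff, Edge.mk.injEq] at h2
    obtain ⟨rfl, rfl, rfl⟩ := h2
    cases h1 with
    | single h => exact ⟨_, h⟩
    | step h1 h2 _ =>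
      simp only [Set.mem_singleton_iff, Edge.mk.injEq] at h2
      obtain ⟨rfl, rfl, rfl⟩ := h2
      exact ⟨_, h1⟩
  · rintro ⟨w, h⟩
    exact ⟨y, w, x, [], .single h, rfl⟩

theorem contractPair_isRegular {n x y : ℕ} {M : Multiword T} :
    (M.contractPair n x y).IsRegular ↔ M.IsRegular ∧ ¬ Cyc M.edges {⟨x, [], y⟩} := by
  rw [cyc_singleton_iff, contractPair]
  split_ifs with h
  · simp [IsRegular, h]
  · simp [IsRegular, h]

/-- A path can pass the glued pair only once: a second passage would need an edge from `y` to `x`,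
which the absence of cycles forbids. -/
theorem contractPair_edges {n x y : ℕ} {M : Multiword T} (h : ¬ Cyc M.edges {⟨x, [], y⟩}) :
    (M.contractPair n x y).edges = pull (shift n) Set.univ (paths M.edges {⟨x, [], y⟩}) := by
  rw [cyc_singleton_iff] at h
  rw [contractPair, dif_neg h]
  ext ⟨a, w, b⟩
  simp only [Set.mem_union, restrict, Set.mem_ofPred_eq, mem_pull, Set.mem_univ, true_and, mem_paths,
    Edge.mk.injEq]
  constructor
  · rintro (h1 | ⟨a', u, v, b', h1, h2, rfl, rfl, rfl⟩)
    · exact .single h1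
    · exact .step h1 (v := []) rfl (.single h2)
  · intro h1
    cases h1 with
    | single h1 => exact Or.inl h1
    | step h1 h2 h3 =>
      simp only [Set.mem_singleton_iff, Edge.mk.injEq] at h2
      obtain ⟨rfl, rfl, rfl⟩ := h2
      cases h3 with
      | single h3 => exact Or.inr ⟨a, _, _, b, h1, h3, rfl, rfl, rfl⟩
      | step h3 h4 _ =>
        simp only [Set.mem_singleton_iff, Edge.mk.injEq] at h4
        obtain ⟨rfl, rfl, rfl⟩ := h4
        exact (h ⟨_, h3⟩).elim

/-- The embedding that skips `n` vertices from `i` on. -/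
def skip (i n v : ℕ) : ℕ := if v < i then v else v + n

theorem mem_link_cons {b : Bool} {p : Polarity} {Y : Boundary} {x y : ℕ} :
    (⟨x, [], y⟩ : Edge T) ∈ link b (p :: Y) ↔
      (p = pol b ∧ x = Y.length + 1 ∧ y = Y.length) ∨
      (p = pol (!b) ∧ x = Y.length ∧ y = Y.length + 1) ∨
      ∃ x' y', (⟨x', [], y'⟩ : Edge T) ∈ link b Y ∧ shift Y.length x' = x ∧
        shift Y.length y' = y := by
  have h1 : ∀ {i}, i < Y.length → shift Y.length (Y.length + i) = Y.length + 1 + (i + 1) ∧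
      shift Y.length (rev Y.length i) = rev (Y.length + 1) (i + 1) := fun {i} hi => by
    unfold shift rev
    rw [if_neg (by omega), if_pos (by omega)]
    omega
  constructor
  · rintro (⟨i, hi, he⟩ | ⟨i, hi, he⟩) <;> simp only [Edge.mk.injEq, true_and, List.length_cons] at he <;>
      obtain ⟨rfl, rfl⟩ := he
    · cases i with
      | zero => exact Or.inl ⟨by simpa using hi, rfl, rfl⟩
      | succ i =>
        have hi' : Y[i]? = some (pol b) := by simpa using hi
        have := h1 (Boundary.lt_of_getElem? hi')
        exact Or.inr (Or.inr ⟨_, _, Or.inl ⟨i, hi', rfl⟩, this⟩)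
    · cases i with
      | zero => exact Or.inr (Or.inl ⟨by simpa using hi, rfl, rfl⟩)
      | succ i =>
        have hi' : Y[i]? = some (pol !b) := by simpa using hi
        have := h1 (Boundary.lt_of_getElem? hi')
        exact Or.inr (Or.inr ⟨_, _, Or.inr ⟨i, hi', rfl⟩, this.symm⟩)
  · rintro (⟨rfl, rfl, rfl⟩ | ⟨rfl, rfl, rfl⟩ | ⟨x', y', ⟨i, hi, he⟩ | ⟨i, hi, he⟩, rfl, rfl⟩)
    · exact Or.inl ⟨0, rfl, rfl⟩
    · exact Or.inr ⟨0, rfl, rfl⟩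
    all_goals
      simp only [Edge.mk.injEq, true_and] at he
      obtain ⟨rfl, rfl⟩ := he
      have := h1 (Boundary.lt_of_getElem? hi)
      rw [this.1, this.2]
    · exact Or.inl ⟨i + 1, by simpa using hi, rfl⟩
    · exact Or.inr ⟨i + 1, by simpa using hi, rfl⟩

/-- The links of `p :: Y` consist of the innermost pair and the links of `Y` moved apart around it.
This matches the order of `contractAlong`, which glues from the middle outwards. -/
theorem link_cons (p : Polarity) (Y : Boundary) (i : ℕ) :
    ∃ x y, (∀ M : Multiword T, M.contract (i + Y.length) p = M.contractPair (i + Y.length) x y) ∧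
      push (i + ·) (link false (p :: Y) : Set (Edge T)) =
        {⟨x, [], y⟩} ∪ push (shift (i + Y.length)) (push (i + ·) (link false Y)) := by
  have hshift : ∀ a, shift (i + Y.length) (i + a) = i + shift Y.length a := fun a => by
    unfold shift; split_ifs <;> omega
  have key : ∀ x y, (∀ a b, (p = pol false ∧ a = Y.length + 1 ∧ b = Y.length) ∨
      (p = pol (!false) ∧ a = Y.length ∧ b = Y.length + 1) ↔ (a = x ∧ b = y)) →
      push (i + ·) (link false (p :: Y) : Set (Edge T)) =
        {⟨i + x, [], i + y⟩} ∪ push (shift (i + Y.length)) (push (i + ·) (link false Y)) := by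
    intro x y h
    ext ⟨a, w, b⟩
    rw [push_push, Set.mem_union, mem_push, mem_push, Set.mem_singleton_iff, Edge.mk.injEq]
    simp only [Function.comp, hshift]
    constructor
    · rintro ⟨a, b, h1, rfl, rfl⟩
      obtain ⟨rfl, -⟩ := link_cases h1
      rw [mem_link_cons, ← or_assoc, h] at h1
      rcases h1 with ⟨rfl, rfl⟩ | ⟨a', b', h2, rfl, rfl⟩
      · exact Or.inl ⟨rfl, rfl, rfl⟩
      · exact Or.inr ⟨a', b', h2, rfl, rfl⟩
    · rintro (⟨rfl, rfl, rfl⟩ | ⟨a', b', h1, rfl, rfl⟩)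
      · exact ⟨x, y, by rw [mem_link_cons, ← or_assoc, h]; exact Or.inl ⟨rfl, rfl⟩, rfl, rfl⟩
      · obtain ⟨rfl, -⟩ := link_cases h1
        exact ⟨_, _, by rw [mem_link_cons]; exact Or.inr (Or.inr ⟨a', b', h1, rfl, rfl⟩), rfl, rfl⟩
  cases p
  · exact ⟨_, _, fun _ => rfl, key Y.length (Y.length + 1) fun a b => by simp [pol]⟩
  · exact ⟨_, _, fun _ => rfl, key (Y.length + 1) Y.length fun a b => by simp [pol]⟩

/-- Iterated gluing is the same as plugging in all links at once, by induction with associativity of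
plugging. The edges are described only when no cycle closes; in the other case the result is
singular and irrelevant for the language. -/
theorem contractAlong_spec (i : ℕ) (Y : Boundary) (M : Multiword T) :
    ((M.contractAlong i Y).IsRegular ↔
      M.IsRegular ∧ ¬ Cyc M.edges (push (i + ·) (link false Y))) ∧
    (¬ Cyc M.edges (push (i + ·) (link false Y)) → (M.contractAlong i Y).edges =
      pull (skip i (Y.length + Y.length)) Set.univ
        (paths M.edges (push (i + ·) (link false Y)))) := by
  induction Y generalizing M with
  | nil =>
    have h0 : (link false [] : Set (Edge T)) = ∅ := by simp [link]
    have h1 : skip i 0 = id := by funext v; simp [skip]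
    simp only [contractAlong, h0, push_empty, not_cyc_empty, paths_empty_right, List.length_nil,
      add_zero, h1, not_false_eq_true, and_true, true_implies, true_and]
    ext ⟨a, w, b⟩
    simp
  | cons p Y ih =>
    obtain ⟨x, y, h1, h2⟩ := link_cons (T := T) p Y i
    have hS : SuppIn Set.univ (push (i + ·) (link false Y : Set (Edge T))) :=
      fun _ _ => ⟨trivial, trivial⟩
    rw [h2, cyc_union_push_iff hS, contractAlong, h1, not_or]
    obtain ⟨ih1, ih2⟩ := ih (M.contractPair (i + Y.length) x y)
    rw [contractPair_isRegular] at ih1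
    constructor
    · rw [ih1, and_assoc]
      refine and_congr_right fun _ => and_congr_right fun h => ?_
      rw [contractPair_edges h]
    · rintro ⟨h3, h4⟩
      rw [contractPair_edges h3] at ih2
      rw [ih2 h4, pull_paths_pull hS fun _ _ => trivial]
      refine pull_congr fun v _ => ?_
      simp only [Function.comp, skip, shift, List.length_cons]
      split_ifs <;> omega

end Multiword

/-! ### Sequents -/

/-- The formulas of a sequent, placed consecutively from `o` on. -/
def place (ξ : N → Boundary) : ℕ → List (Formula N) → List (Placed N)
  | _, [] => []
  | o, X :: Γ => (X, (o + ·)) :: place ξ (o + (X.interp ξ).length) Γ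

section Place

variable {ξ : N → Boundary}

theorem seqInterp_cons (X : Formula N) (Γ : List (Formula N)) :
    seqInterp ξ (X :: Γ) = X.interp ξ ++ seqInterp ξ Γ := by simp [seqInterp]

theorem seqInterp_nil : seqInterp ξ [] = [] := rfl

theorem seqInterp_append (Γ Δ : List (Formula N)) :
    seqInterp ξ (Γ ++ Δ) = seqInterp ξ Γ ++ seqInterp ξ Δ := by simp [seqInterp]

theorem seqInterp_singleton (X : Formula N) : seqInterp ξ [X] = X.interp ξ := by simp [seqInterp]

theorem place_append (o : ℕ) (Γ Δ : List (Formula N)) :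
    place ξ o (Γ ++ Δ) = place ξ o Γ ++ place ξ (o + (seqInterp ξ Γ).length) Δ := by
  induction Γ generalizing o with
  | nil => simp [place, seqInterp]
  | cons X Γ ih => simp [place, ih, seqInterp_cons, add_assoc]

theorem place_renamed {g : ℕ → ℕ} {o o' : ℕ} {Γ : List (Formula N)}
    (h : ∀ i < (seqInterp ξ Γ).length, g (o + i) = o' + i) :
    List.Forall₂ (Renamed ξ g) (place ξ o Γ) (place ξ o' Γ) := by
  induction Γ generalizing o o' with
  | nil => exact .nil
  | cons X Γ ih =>
    rw [seqInterp_cons, List.length_append] at h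
    refine .cons ⟨rfl, fun i hi => ?_⟩ (ih fun i hi => ?_)
    · simp only [dom, Set.mem_Iio] at hi
      exact h i (by omega)
    · rw [add_assoc, h _ (by omega), add_assoc]

theorem zone_place_subset (o : ℕ) (Γ : List (Formula N)) :
    zone ξ (place ξ o Γ) ⊆ Set.Ico o (o + (seqInterp ξ Γ).length) := by
  induction Γ generalizing o with
  | nil =>
    rintro v ⟨q, hq, _⟩
    simp [place] at hq
  | cons X Γ ih =>
    intro v hv
    rw [place, mem_zone_cons] at hv
    rw [seqInterp_cons, List.length_append]
    rcases hv with ⟨i, hi, rfl⟩ | hv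
    · simp only [dom, Set.mem_Iio, Set.mem_Ico] at hi ⊢; omega
    · have := ih _ hv
      simp only [Set.mem_Ico] at this ⊢; omega

theorem place_getElem? {o : ℕ} {Γ : List (Formula N)} {q : Placed N} (hq : q ∈ place ξ o Γ) {i : ℕ}
    (hi : i ∈ dom ξ q) : o ≤ q.2 i ∧ (seqInterp ξ Γ)[q.2 i - o]? = (q.1.interp ξ)[i]? := by
  induction Γ generalizing o with
  | nil => simp [place] at hq
  | cons X Γ ih =>
    rw [seqInterp_cons]
    rcases List.mem_cons.1 hq with rfl | hq
    · simp only [dom, Set.mem_Iio] at hi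
      simp only [Nat.le_add_right, Nat.add_sub_cancel_left, true_and]
      rw [List.getElem?_append_left hi]
    · obtain ⟨h1, h2⟩ := ih hq
      refine ⟨by omega, ?_⟩
      rw [List.getElem?_append_right (by omega), ← h2]
      congr 1
      omega

theorem Typed.polarizedAt {Γ : List (Formula N)} {σ : Set (Edge T)}
    (h : Typed true (seqInterp ξ Γ) σ) {q : Placed N} (hq : q ∈ place ξ 0 Γ) :
    PolarizedAt ξ q σ := by
  intro e he i hi
  have h1 := (place_getElem? hq hi).2
  rw [Nat.sub_zero] at h1
  exact ⟨fun h2 => by rw [← h1, ← h2]; exact (h e he).1, fun h2 => by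
    rw [← h1, ← h2]; exact (h e he).2⟩

end Place

/-! ### Soundness of derivations -/

section Sound

variable {ξ : N → Boundary} {L : Bool → N → Set (Set (Edge T))}

theorem Typed.of_isCowordism {Γ : List (Formula N)} {σ : Multiword T}
    (h : Multiword.IsCowordism [] (seqInterp ξ Γ) σ) : Typed true (seqInterp ξ Γ) σ.edges :=
  h.polarity

/-- The links realize the single formula `X^⊥ ⅋ X`; invertibility of par breaks it up into the
sequent. -/
theorem realizes_id (hL : ∀ b p, ∀ d ∈ L b p, Typed b (ξ p) d) (X : Formula N) :
    Realizes ξ (realizers ξ L) (place ξ 0 [X.dual, X]) (link true (X.interp ξ)) := by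
  have h1 := Realizes.singleton (q := (X.dual.par X, (0 + ·))) hL (link_mem_realizers_par hL X)
    (fun i _ j _ h => by simpa using h)
  have h2 := h1.of_par hL
  have h3 : push (0 + ·) (link true (X.interp ξ) : Set (Edge T)) = link true (X.interp ξ) := by
    simp [push]
  simp only [h3] at h2
  simpa [place, add_assoc] using h2

theorem realizes_ex {F : Formula N → Bool → Set (Set (Edge T))}
    (hF : ∀ X b, ∀ d ∈ F X b, SuppIn (Set.Iio (X.interp ξ).length) d)
    {Γ Δ : List (Formula N)} {X Y : Formula N} {σ : Set (Edge T)}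
    (h : Realizes ξ F (place ξ 0 (Γ ++ [X, Y] ++ Δ)) σ) :
    Realizes ξ F (place ξ 0 (Γ ++ [Y, X] ++ Δ))
      (push (exchange (seqInterp ξ Γ).length (X.interp ξ).length (Y.interp ξ).length) σ) := by
  have hinj : Set.InjOn
      (exchange (seqInterp ξ Γ).length (X.interp ξ).length (Y.interp ξ).length) Set.univ := by
    intro i _ j _ hij
    unfold exchange at hij
    split_ifs at hij <;> omega
  simp only [List.append_assoc, place_append, place, List.cons_append, List.nil_append,
    zero_add] at h ⊢
  have hperm := List.Perm.append_left (place ξ 0 Γ) (List.Perm.swap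
    ((Y, ((seqInterp ξ Γ).length + (X.interp ξ).length + ·)) : Placed N)
    (X, ((seqInterp ξ Γ).length + ·))
    (place ξ ((seqInterp ξ Γ).length + (X.interp ξ).length + (Y.interp ξ).length) Δ))
  refine (h.perm hperm).rename hF hinj (fun _ _ => ⟨trivial, trivial⟩)
    (fun _ _ => trivial) ?_
  refine List.rel_append (place_renamed fun i hi => ?_)
    (.cons ⟨rfl, fun i hi => ?_⟩ (.cons ⟨rfl, fun i hi => ?_⟩ (place_renamed fun i hi => ?_)))
  all_goals
    try simp only [dom, Set.mem_Iio] at hi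
    simp only [exchange]
    split_ifs <;> omega

theorem exchange_getElem? {X Y Z W : Boundary} {i : ℕ} {p : Polarity}
    (h : (Z ++ X ++ Y ++ W)[i]? = some p) :
    (Z ++ Y ++ X ++ W)[exchange Z.length X.length Y.length i]? = some p := by
  have hlt := Boundary.lt_of_getElem? h
  simp only [List.length_append] at hlt
  simp only [List.getElem?_append, List.length_append] at h ⊢
  unfold exchange
  split_ifs at h ⊢ <;> first | omega | (rw [← h]; congr 1; omega)

/-- The common core of tensor and cut, with the tensor formula listed first among the placed
formulas. -/
theorem realizes_juxtapose (hL : ∀ b p, ∀ d ∈ L b p, Typed b (ξ p) d) {Γ Δ : List (Formula N)}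
    {X Y : Formula N} {σ τ : Set (Edge T)}
    (hσ : Realizes ξ (realizers ξ L) (place ξ 0 (Γ ++ [X])) σ)
    (hτ : Realizes ξ (realizers ξ L) (place ξ 0 ([Y] ++ Δ)) τ)
    (hσ' : Typed true (seqInterp ξ (Γ ++ [X])) σ) (hτ' : Typed true (seqInterp ξ ([Y] ++ Δ)) τ) :
    Realizes ξ (realizers ξ L) ((X.tensor Y, ((seqInterp ξ Γ).length + ·)) :: (place ξ 0 Γ ++
        place ξ ((seqInterp ξ (Γ ++ [X])).length + (Y.interp ξ).length) Δ))
      (σ ∪ push ((seqInterp ξ (Γ ++ [X])).length + ·) τ) := by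
  have hF := realizers_suppIn hL
  set k := (seqInterp ξ (Γ ++ [X])).length with hk
  have hk' : k = (seqInterp ξ Γ).length + (X.interp ξ).length := by
    rw [hk, seqInterp_append, seqInterp_singleton, List.length_append]
  have hinj : ∀ S, Set.InjOn (k + ·) S := fun S i _ j _ h => by simpa using h
  have h1 : Realizes ξ (realizers ξ L) ((X, ((seqInterp ξ Γ).length + ·)) :: place ξ 0 Γ) σ := by
    refine hσ.perm ?_
    rw [place_append, zero_add]
    exact List.perm_append_singleton _ _
  have h2 : Realizes ξ (realizers ξ L) (place ξ k ([Y] ++ Δ)) (push (k + ·) τ) :=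
    hτ.rename hF (hinj Set.univ) (fun _ _ => ⟨trivial, trivial⟩) (fun _ _ => trivial)
      (place_renamed fun i _ => by simp)
  have hz1 := zone_place_subset (ξ := ξ) 0 (Γ ++ [X])
  have hz2 := zone_place_subset (ξ := ξ) k ([Y] ++ Δ)
  refine Realizes.tensor (Z₁ := Set.Iio k) (Z₂ := Set.Ici k) (fY := (k + ·)) hL h1 h2 ?_ ?_ ?_ ?_
    ?_ (fun _ _ => rfl) (fun i _ => ?_) (fun i _ j _ h => by simpa using h)
  · rw [Set.disjoint_left]
    intro i h1 h2
    simp only [Set.mem_Iio, Set.mem_Ici] at h1 h2; omega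
  · intro v hv
    have : v ∈ zone ξ (place ξ 0 (Γ ++ [X])) := by
      refine zone_mono ?_ hv
      rw [place_append, zero_add]
      exact (List.perm_append_singleton _ _).symm.subset
    have := hz1 this
    simp only [Set.mem_Ico, Set.mem_Iio] at this ⊢; omega
  · intro v hv
    have := hz2 hv
    simp only [Set.mem_Ico, Set.mem_Ici] at this ⊢; omega
  · exact hσ'.suppIn
  · exact hτ'.suppIn.push fun i _ => by simp
  · omega

theorem typed_juxtapose {Γ Δ : List (Formula N)} {X Y : Formula N} {σ τ : Set (Edge T)}
    (hσ : Typed true (seqInterp ξ (Γ ++ [X])) σ) (hτ : Typed true (seqInterp ξ ([Y] ++ Δ)) τ) :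
    Typed true (seqInterp ξ (Γ ++ [X.tensor Y] ++ Δ))
      (σ ∪ push ((seqInterp ξ (Γ ++ [X])).length + ·) τ) := by
  have := hσ.union_push hτ
  simpa [seqInterp_append, seqInterp_cons, seqInterp_nil, Formula.interp] using this

theorem realizes_tensor (hL : ∀ b p, ∀ d ∈ L b p, Typed b (ξ p) d) {Γ Δ : List (Formula N)}
    {X Y : Formula N} {σ τ : Set (Edge T)}
    (hσ : Realizes ξ (realizers ξ L) (place ξ 0 (Γ ++ [X])) σ)
    (hτ : Realizes ξ (realizers ξ L) (place ξ 0 ([Y] ++ Δ)) τ)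
    (hσ' : Typed true (seqInterp ξ (Γ ++ [X])) σ) (hτ' : Typed true (seqInterp ξ ([Y] ++ Δ)) τ) :
    Realizes ξ (realizers ξ L) (place ξ 0 (Γ ++ [X.tensor Y] ++ Δ))
      (σ ∪ push ((seqInterp ξ (Γ ++ [X])).length + ·) τ) := by
  refine (realizes_juxtapose hL hσ hτ hσ' hτ').perm ?_
  have h1 : (seqInterp ξ (Γ ++ [X])).length + (Y.interp ξ).length =
      (seqInterp ξ (Γ ++ [X.tensor Y])).length := by
    simp [seqInterp_append, seqInterp_singleton, Formula.interp, add_assoc]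
  rw [place_append, place_append, zero_add, zero_add, h1, List.append_assoc]
  exact List.perm_middle.symm

theorem skip_renamed {i n : ℕ} {Γ Δ : List (Formula N)} (h : i = (seqInterp ξ Γ).length) :
    List.Forall₂ (Renamed ξ (Multiword.skip i n)) (place ξ 0 (Γ ++ Δ))
      (place ξ 0 Γ ++ place ξ (i + n) Δ) := by
  subst h
  rw [place_append, zero_add]
  refine List.rel_append (place_renamed fun i hi => ?_) (place_renamed fun i hi => ?_) <;>
    unfold Multiword.skip <;> split_ifs <;> omega

/-- The disjoint union of the premises realizes a sequent with `X ⊗ X^⊥`, and the contracted links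
are a test of that formula. -/
theorem realizes_cut (hL : ∀ b p, ∀ d ∈ L b p, Typed b (ξ p) d) {Γ Δ : List (Formula N)}
    {X : Formula N} {σ τ : Set (Edge T)}
    (hσ : Realizes ξ (realizers ξ L) (place ξ 0 (Γ ++ [X])) σ)
    (hτ : Realizes ξ (realizers ξ L) (place ξ 0 ([X.dual] ++ Δ)) τ)
    (hσ' : Typed true (seqInterp ξ (Γ ++ [X])) σ)
    (hτ' : Typed true (seqInterp ξ ([X.dual] ++ Δ)) τ)
    (hcyc : ¬ Cyc (σ ∪ push ((seqInterp ξ (Γ ++ [X])).length + ·) τ)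
      (push ((seqInterp ξ Γ).length + ·) (link false (X.dual.interp ξ)))) :
    Realizes ξ (realizers ξ L) (place ξ 0 (Γ ++ Δ))
      (pull (Multiword.skip (seqInterp ξ Γ).length
        ((X.dual.interp ξ).length + (X.dual.interp ξ).length)) Set.univ
        (paths (σ ∪ push ((seqInterp ξ (Γ ++ [X])).length + ·) τ)
          (push ((seqInterp ξ Γ).length + ·) (link false (X.dual.interp ξ))))) := by
  have h := realizes_juxtapose hL hσ hτ hσ' hτ'
  refine Realizes.pull_of_contract (realizers_suppIn hL) hcyc (skip_renamed rfl) ?_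
  intro q l hp B hB hcyc'
  refine h q ((X.tensor X.dual, ((seqInterp ξ Γ).length + ·)) :: l) ?_ _
    ⟨_, link_mem_realizers_tensor hL X, B, hB, rfl⟩ hcyc'
  refine List.Perm.trans ?_ ((hp.cons _).trans (List.Perm.swap _ _ _))
  rw [seqInterp_append, seqInterp_singleton, List.length_append, Formula.length_interp_dual,
    add_assoc]

theorem typed_cut {Γ Δ : List (Formula N)} {X : Formula N} {σ τ C : Set (Edge T)}
    (hσ : Typed true (seqInterp ξ (Γ ++ [X])) σ)
    (hτ : Typed true (seqInterp ξ ([X.dual] ++ Δ)) τ) :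
    Typed true (seqInterp ξ (Γ ++ Δ))
      (pull (Multiword.skip (seqInterp ξ Γ).length
        ((X.dual.interp ξ).length + (X.dual.interp ξ).length)) Set.univ
        (paths (σ ∪ push ((seqInterp ξ (Γ ++ [X])).length + ·) τ) C)) := by
  have h := (hσ.union_push hτ).paths (F := C)
  rintro e ⟨-, -, he⟩
  have h1 := h _ he
  rw [seqInterp_append] at h1 ⊢
  simp only [seqInterp_append, seqInterp_singleton] at h1
  have key : ∀ v p, ((seqInterp ξ Γ ++ X.interp ξ) ++ (X.dual.interp ξ ++ seqInterp ξ Δ))[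
      Multiword.skip (seqInterp ξ Γ).length
        ((X.dual.interp ξ).length + (X.dual.interp ξ).length) v]? = some p →
      (seqInterp ξ Γ ++ seqInterp ξ Δ)[v]? = some p := by
    intro v p hv
    have hl := Formula.length_interp_dual ξ X
    rw [← hv]
    simp only [Multiword.skip, List.getElem?_append, List.length_append]
    split_ifs <;> first | omega | rfl | (congr 1; omega)
  exact ⟨key _ _ h1.1, key _ _ h1.2⟩

end Sound

namespace LLG

variable {G : LLG.{u, v} T}

/-- Regularity descends from the conclusion of a rule to its premises, and it is what makes the path
description of the edges after a cut available. -/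
theorem Derivable.typed {Γ : List (Formula G.Atom)} {σ : Multiword T} (h : G.Derivable Γ σ) :
    σ.IsRegular → Typed true (seqInterp G.ξ Γ) σ.edges := by
  induction h with
  | lex h => exact fun _ => .of_isCowordism (G.lex_typed _ h)
  | id X =>
    intro _
    rw [Multiword.identity_edges, seqInterp_cons, seqInterp_singleton, Formula.interp_dual]
    exact link_typed true _
  | cut hσ hτ ihσ ihτ =>
    intro hr
    obtain ⟨h1, h2⟩ := Multiword.contractAlong_spec (seqInterp G.ξ _).length _ _
    obtain ⟨h3, h4⟩ := h1.1 hr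
    rw [Multiword.tensor_isRegular] at h3
    rw [h2 h4]
    exact typed_cut (ihσ h3.1) (ihτ h3.2)
  | ex hσ ih =>
    intro hr
    rintro _ ⟨e, he, rfl⟩
    have h1 := ih hr e he
    simp only [seqInterp_append, seqInterp_cons, seqInterp_nil, List.append_assoc, List.nil_append] at h1 ⊢
    simp only [← List.append_assoc] at h1 ⊢
    exact ⟨exchange_getElem? h1.1, exchange_getElem? h1.2⟩
  | par hσ ih =>
    intro hr
    simpa [seqInterp_append, seqInterp_cons, seqInterp_nil, Formula.interp] using ih hr
  | tensor hσ hτ ihσ ihτ =>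
    intro hr
    rw [Multiword.tensor_isRegular] at hr
    exact typed_juxtapose (ihσ hr.1) (ihτ hr.2)

/-- If the axioms realize their sequents, then so do all regular derivable multiwords. -/
theorem Derivable.realizes {L : Bool → G.Atom → Set (Set (Edge T))}
    (hL : ∀ b p, ∀ d ∈ L b p, Typed b (G.ξ p) d)
    (hlex : ∀ α ∈ G.Lex, α.2.IsRegular →
      Realizes G.ξ (realizers G.ξ L) (place G.ξ 0 α.1) α.2.edges)
    {Γ : List (Formula G.Atom)} {σ : Multiword T} (h : G.Derivable Γ σ) :
    σ.IsRegular → Realizes G.ξ (realizers G.ξ L) (place G.ξ 0 Γ) σ.edges := by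
  induction h with
  | lex h => exact hlex _ h
  | id X =>
    intro _
    rw [Multiword.identity_edges]
    exact realizes_id hL X
  | cut hσ hτ ihσ ihτ =>
    intro hr
    obtain ⟨h1, h2⟩ := Multiword.contractAlong_spec (seqInterp G.ξ _).length _ _
    obtain ⟨h3, h4⟩ := h1.1 hr
    rw [Multiword.tensor_isRegular] at h3
    rw [h2 h4]
    exact realizes_cut hL (ihσ h3.1) (ihτ h3.2) (hσ.typed h3.1) (hτ.typed h3.2) h4
  | ex hσ ih => exact fun hr => realizes_ex (realizers_suppIn hL) (ih hr)
  | @par Γ X Y σ hσ ih =>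
    intro hr
    have ht := (Derivable.par hσ).typed hr
    have h1 := ih hr
    rw [place_append, zero_add] at h1 ⊢
    have h2 := Realizes.par hL (ht.polarizedAt (by
      rw [place_append, zero_add]
      exact List.mem_append_right _ List.mem_cons_self)) ((h1.perm (List.perm_append_comm)).perm (by
        simp only [place, add_assoc]
        exact List.Perm.refl _))
    exact h2.perm (List.perm_append_comm (l₁ := [_]))
  | tensor hσ hτ ihσ ihτ =>
    intro hr
    rw [Multiword.tensor_isRegular] at hr
    exact realizes_tensor hL (ihσ hr.1) (ihτ hr.2) (hσ.typed hr.1) (hτ.typed hr.2)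

end LLG

/-! ### Plugging closed multiwords -/

theorem Path.eq_or_last {A B : Set (Edge T)} {a b : ℕ} {w : List T} (h : Path A B a w b) :
    (⟨a, w, b⟩ : Edge T) ∈ A ∨ ∃ u y v z w', Path A B a u y ∧ (⟨y, v, z⟩ : Edge T) ∈ B ∧
      (⟨z, w', b⟩ : Edge T) ∈ A := by
  induction h with
  | single h => exact Or.inl h
  | step h1 h2 _ ih =>
    rcases ih with h3 | ⟨u, y, v, z, w', h3, h4, h5⟩
    · exact Or.inr ⟨_, _, _, _, _, .single h1, h2, h3⟩
    · exact Or.inr ⟨_, y, v, z, w', .step h1 h2 h3, h4, h5⟩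

/-- No closed path stays within zone two, since connector edges that start there lead to zone one
and nothing else is plugged in there. The cycle can thus be rotated so that its closing edge starts
in zone one; its excursions then become detours. -/
theorem cyc_detour_of_cyc {A₁ A₂ B₁ s : Set (Edge T)} {Z₁ Z₂ : Set ℕ} (hZ : Disjoint Z₁ Z₂)
    (hA₁ : SuppIn Z₁ A₁) (hA₂ : SuppIn Z₂ A₂) (hB₁ : SuppIn Z₁ B₁) (hs : SuppIn (Z₁ ∪ Z₂) s)
    (hs' : ∀ e ∈ s, e.src ∈ Z₂ → e.tgt ∈ Z₁) (h : Cyc (A₁ ∪ A₂) (B₁ ∪ s)) :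
    Cyc A₁ (B₁ ∪ detour A₂ ∅ s Z₁) := by
  have hd : ∀ {i}, i ∈ Z₁ → i ∈ Z₂ → False := fun h1 h2 => Set.disjoint_left.1 hZ h1 h2
  have hA : SuppIn (Z₁ ∪ Z₂) (A₁ ∪ A₂) :=
    (hA₁.mono Set.subset_union_left).union (hA₂.mono Set.subset_union_right)
  have hB₂ : SuppIn Z₂ (∅ : Set (Edge T)) := fun _ h => h.elim
  have key : ∀ a u x v, Path (A₁ ∪ A₂) (B₁ ∪ s) a u x → (⟨x, v, a⟩ : Edge T) ∈ B₁ ∪ s → x ∈ Z₁ →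
      Cyc A₁ (B₁ ∪ detour A₂ ∅ s Z₁) := by
    intro a u x v h1 h2 hx
    have h3 := path_zones_cases (B₁ := B₁) (B₂ := ∅) (s := s) hZ hA₁ hA₂ hB₁ hB₂ hs
      (by rwa [Set.union_empty]) hx
    rcases (h1.mem_of_suppIn hA).1 with ha | ha
    · exact ⟨_, _, _, v, h3.1 ha, h2.imp_right fun h2 => ⟨hx, ha, .single h2⟩⟩
    · obtain ⟨u, z, v', y, w', h4, h5, h6, h7, -⟩ := h3.2 ha
      have h2 := h2.resolve_left fun h2 => hd (hB₁.mem h2).2 ha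
      exact ⟨_, _, _, _, h7, Or.inr ⟨hx, h6, .step h2 h4 h5⟩⟩
  obtain ⟨a, u, x, v, h1, h2⟩ := h
  rcases (h1.mem_of_suppIn hA).2 with hx | hx
  · exact key a u x v h1 h2 hx
  · have h3 := h2.resolve_left fun h2 => hd (hB₁.mem h2).1 hx
    have ha : a ∈ Z₁ := hs' _ h3 hx
    rcases h1.eq_or_last with h4 | ⟨u, y, v', z, w', h4, h5, h6⟩
    · rcases h4 with h4 | h4
      · exact (hd (hA₁.mem h4).2 hx).elim
      · exact (hd ha (hA₂.mem h4).1).elim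
    · have h6' := h6.resolve_left fun h6 => hd (hA₁.mem h6).2 hx
      have hz := (hA₂.mem h6').1
      have h5' := h5.resolve_left fun h5 => hd (hB₁.mem h5).2 hz
      -- The closing edge starts in zone two. The cycle is rotated by one step, so that the plugged
      -- edge from `y` to `z`, with `y` in zone one, closes it.
      refine key z _ y _ (.step h6 h2 h4) h5 ?_
      exact (hs.mem h5').1.resolve_right fun hy => hd (hs' _ h5' hy) hz

theorem pull_paths_detour {A₁ A₂ B₁ s : Set (Edge T)} {Z₁ Z₂ : Set ℕ} (hZ : Disjoint Z₁ Z₂)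
    (hA₁ : SuppIn Z₁ A₁) (hA₂ : SuppIn Z₂ A₂) (hB₁ : SuppIn Z₁ B₁) (hs : SuppIn (Z₁ ∪ Z₂) s)
    {f : ℕ → ℕ} {K : Set ℕ} (hf : ∀ i ∈ K, f i ∈ Z₁) :
    pull f K (paths (A₁ ∪ A₂) (B₁ ∪ s)) = pull f K (paths A₁ (B₁ ∪ detour A₂ ∅ s Z₁)) := by
  ext ⟨i, w, j⟩
  simp only [mem_pull, mem_paths]
  refine and_congr_right fun hi => and_congr_right fun hj => ?_
  have h := path_zones_iff (B₁ := B₁) (B₂ := ∅) (w := w) hZ hA₁ hA₂ hB₁ (fun _ h => h.elim) hs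
    (hf i hi) (hf j hj)
  rwa [Set.union_empty] at h

/-! ### Closed derivable multiwords and cuts against them -/

namespace LLG

/-- The edge sets of regular derivable multiwords of type `X`. -/
def closed (G : LLG.{u, v} T) (X : Formula G.Atom) : Set (Set (Edge T)) :=
  {d | ∃ ρ, G.Derivable [X] ρ ∧ ρ.IsRegular ∧ ρ.edges = d}

/-- The multiwords of type `X` for `true`, those that can be cut against `X` for `false`. -/
def closedPair (G : LLG.{u, v} T) (X : Formula G.Atom) : Bool → Set (Set (Edge T))
  | true => G.closed X
  | false => push (rev (X.interp G.ξ).length) '' G.closed X.dual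

variable {G : LLG.{u, v} T}

theorem typed_closed {X : Formula G.Atom} {d : Set (Edge T)} (hd : d ∈ G.closed X) :
    Typed true (X.interp G.ξ) d := by
  obtain ⟨ρ, h1, h2, rfl⟩ := hd
  simpa [seqInterp_singleton] using h1.typed h2

theorem typed_closedPair (X : Formula G.Atom) (b : Bool) :
    ∀ d ∈ G.closedPair X b, Typed b (X.interp G.ξ) d := by
  cases b
  · rintro _ ⟨d, hd, rfl⟩
    have := typed_closed hd
    rw [Formula.interp_dual] at this
    exact this.push_rev
  · exact fun d hd => typed_closed hd

theorem suppIn_closedPair (X : Formula G.Atom) (b : Bool) :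
    ∀ d ∈ G.closedPair X b, SuppIn (Set.Iio (X.interp G.ξ).length) d :=
  fun d hd => (typed_closedPair X b d hd).suppIn

/-- Seen from `σ`, a cut against a closed multiword `τ` is a detour through `τ`, which is `τ`
reflected onto the first block of `σ`. The set `B` of further plugged edges is arbitrary, so that
several cuts can be performed in succession. -/
theorem exists_cut_front {X : Formula G.Atom} {Δ : List (Formula G.Atom)} {σ : Multiword T}
    (hσ : G.Derivable (X :: Δ) σ) (hr : σ.IsRegular) {t : Set (Edge T)}
    (ht : t ∈ G.closedPair X false) (hcyc : ¬ Cyc σ.edges t) :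
    ∃ ρ, G.Derivable Δ ρ ∧ ρ.IsRegular ∧ ∀ B : Set (Edge T),
      (¬ Cyc σ.edges (t ∪ push ((X.interp G.ξ).length + ·) B) → ¬ Cyc ρ.edges B) ∧
      ∀ f K, pull f K (paths ρ.edges B) = pull (fun i => (X.interp G.ξ).length + f i) K
        (paths σ.edges (t ∪ push ((X.interp G.ξ).length + ·) B)) := by
  obtain ⟨_, ⟨τ, hτ, hτr, rfl⟩, rfl⟩ := ht
  set n := (X.interp G.ξ).length with hn
  have hXd : (X.dual.interp G.ξ).length = n := Formula.length_interp_dual _ _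
  have hcut := Derivable.cut (Γ := []) (Δ := Δ) (X := X.dual) hτ
    (by rw [Formula.dual_dual]; exact hσ)
  simp only [List.nil_append, Formula.dual_dual, seqInterp_nil, List.length_nil,
    seqInterp_singleton, hXd] at hcut
  obtain ⟨h1, h2⟩ := Multiword.contractAlong_spec 0 (X.interp G.ξ) (Multiword.tensor n τ σ)
  have hid : ∀ E : Set (Edge T), push (0 + ·) E = E := fun E => by simp [push]
  rw [hid, Multiword.tensor_edges, Set.union_comm τ.edges] at h1 h2
  have hτt := typed_closed ⟨τ, hτ, hτr, rfl⟩
  rw [Formula.interp_dual] at hτt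
  have hτs : SuppIn (Set.Iio n) τ.edges := by
    have := hτt.suppIn; rwa [Boundary.length_dual] at this
  have hZ : Disjoint (Set.Ici n) (Set.Iio n) := by
    rw [Set.disjoint_left]; intro i; simp
  have hA₁ : SuppIn (Set.Ici n) (push (n + ·) σ.edges) := by
    rintro _ ⟨e, _, rfl⟩; simp
  have hl : ∀ e ∈ (link false (X.interp G.ξ) : Set (Edge T)), e.src < n + n ∧ e.tgt < n + n ∧
      (e.src < n ↔ n ≤ e.tgt) := fun e he => by
    have h3 := (link_typed false (X.interp G.ξ)).suppIn e he
    simp only [List.length_append, Boundary.length_dual, Set.mem_Iio] at h3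
    exact ⟨h3.1, h3.2, (link_cases (p := e.src) (q := e.tgt) (w := e.label) he).2.2⟩
  have hls : ∀ S : Set ℕ, S ∪ Set.Iio n = Set.univ →
      SuppIn (S ∪ Set.Iio n) (link false (X.interp G.ξ) : Set (Edge T)) := fun S hS _ _ => by
    rw [hS]; exact ⟨trivial, trivial⟩
  have hun : Set.Ici n ∪ Set.Iio n = Set.univ := by
    ext i; simp only [Set.mem_union, Set.mem_Ici, Set.mem_Iio, Set.mem_univ, iff_true]; omega
  have hls' : ∀ e ∈ (link false (X.interp G.ξ) : Set (Edge T)), e.src ∈ Set.Iio n →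
      e.tgt ∈ Set.Ici n := fun e he h3 => (hl e he).2.2.1 h3
  -- The connector is the set of identity links, and these reflect `τ` onto the block of `σ` that
  -- starts at `n`.
  have hdet : detour τ.edges ∅ (link false (X.interp G.ξ)) (Set.Ici n) =
      push (n + ·) (push (rev n) τ.edges) := by
    have h3 := detour_push (f := id) (B₂ := ∅) (N₁ := Set.Ici n) (N₂ := Set.Iio n) hZ hτs
      (hls _ hun) Function.injective_id.injOn (fun _ h => h) (fun _ h => h)
    have hid' : ∀ E : Set (Edge T), push id E = E := fun E => by simp [push]
    have hτid : pull id (Set.Iio n) τ.edges = τ.edges := by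
      conv_lhs => rw [← hid' τ.edges]
      exact pull_push hτs Function.injective_id.injOn
    rw [hid', paths_empty_right, hid', hτid] at h3
    rw [h3, ← pull_paths_link_left (b := false) (by exact hτt)]
    ext ⟨i, w, j⟩
    simp only [mem_pull, mem_paths, mem_push, id, Set.mem_Ici, Set.mem_Iio]
    constructor
    · rintro ⟨hi, hj, h⟩
      obtain ⟨_, _, h4⟩ := h.head
      obtain ⟨_, _, h5⟩ := h.last
      have h6 := (hl _ h4).1
      have h7 := (hl _ h5).2.1
      simp only at h6 h7
      refine ⟨i - n, j - n, ⟨by omega, by omega, ?_⟩, by omega, by omega⟩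
      rwa [show (X.interp G.ξ).length + (i - n) = i by omega,
        show (X.interp G.ξ).length + (j - n) = j by omega]
    · rintro ⟨i, j, ⟨hi, hj, h⟩, rfl, rfl⟩
      exact ⟨by omega, by omega, h⟩
  have hinj : Set.InjOn (n + ·) Set.univ := fun i _ j _ h => by simpa using h
  have huniv : ∀ E : Set (Edge T), SuppIn Set.univ E := fun _ _ _ => ⟨trivial, trivial⟩
  have hskip : ∀ B : Set (Edge T), push (Multiword.skip 0 (n + n)) B =
      push (n + ·) (push (n + ·) B) := fun B => by
    rw [push_push]
    refine push_congr (huniv B) fun i _ => ?_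
    simp only [Multiword.skip, Function.comp]
    rw [if_neg (by omega)]; omega
  have hsk : ∀ B : Set (Edge T), SuppIn (Set.Ici n) (push (Multiword.skip 0 (n + n)) B) :=
    fun B => by
      rintro _ ⟨e, _, rfl⟩
      simp only [Multiword.skip, Set.mem_Ici]
      split_ifs <;> omega
  have hcyc' : ∀ B : Set (Edge T), ¬ Cyc σ.edges (push (rev n) τ.edges ∪ push (n + ·) B) →
      ¬ Cyc (push (n + ·) σ.edges ∪ τ.edges)
        (link false (X.interp G.ξ) ∪ push (Multiword.skip 0 (n + n)) B) := by
    intro B h3 h4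
    rw [Set.union_comm (link _ _)] at h4
    have h5 := cyc_detour_of_cyc hZ hA₁ hτs (hsk B) (hls _ hun) hls' h4
    rw [hdet, hskip, ← push_union, cyc_push_iff hinj (huniv _) (huniv _), Set.union_comm] at h5
    exact h3 h5
  have hcyc0 : ¬ Cyc (push (n + ·) σ.edges ∪ τ.edges) (link false (X.interp G.ξ)) := by
    have := hcyc' ∅ (by simpa using hcyc)
    simpa using this
  refine ⟨_, hcut, h1.2 ⟨Multiword.tensor_isRegular.2 ⟨hτr, hr⟩, hcyc0⟩, fun B => ⟨fun h3 => ?_,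
    fun f K => ?_⟩⟩
  · rw [h2 hcyc0]
    have := hcyc' B h3
    rw [cyc_union_push_iff (huniv B), not_or] at this
    exact this.2
  · rw [h2 hcyc0, pull_paths_pull (huniv B) fun _ _ => trivial, ← hn, Set.union_comm (link _ _),
      pull_paths_detour hZ hA₁ hτs (hsk B) (hls _ hun), hdet, hskip, ← push_union,
      paths_push hinj (huniv _) (huniv _), Set.union_comm (push _ B)]
    · refine Eq.trans ?_ (pull_comp_push (f := fun i => n + f i) hinj (huniv _) fun _ _ => trivial)
      refine pull_congr fun i _ => ?_
      simp only [Multiword.skip, Function.comp]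
      rw [if_neg (by omega)]; omega
    · intro i _
      simp only [Function.comp, Multiword.skip, Set.mem_Ici]
      split_ifs <;> omega

/-- The same for the last formula, with `τ` as the right premise of the cut. The other plugged edges
lie in front of the removed block, where `skip` does not move vertices. -/
theorem exists_cut_back {X : Formula G.Atom} {Γ : List (Formula G.Atom)} {σ : Multiword T}
    (hσ : G.Derivable (Γ ++ [X]) σ) (hr : σ.IsRegular) {t : Set (Edge T)}
    (ht : t ∈ G.closedPair X false)
    (hcyc : ¬ Cyc σ.edges (push ((seqInterp G.ξ Γ).length + ·) t)) :
    ∃ ρ, G.Derivable Γ ρ ∧ ρ.IsRegular ∧ ∀ B : Set (Edge T),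
      SuppIn (Set.Iio (seqInterp G.ξ Γ).length) B →
      (¬ Cyc σ.edges (push ((seqInterp G.ξ Γ).length + ·) t ∪ B) → ¬ Cyc ρ.edges B) ∧
      ∀ f K, (∀ i ∈ K, f i ∈ Set.Iio (seqInterp G.ξ Γ).length) →
        pull f K (paths ρ.edges B) =
          pull f K (paths σ.edges (push ((seqInterp G.ξ Γ).length + ·) t ∪ B)) := by
  obtain ⟨_, ⟨τ, hτ, hτr, rfl⟩, rfl⟩ := ht
  set n := (X.interp G.ξ).length with hn
  set o := (seqInterp G.ξ Γ).length with ho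
  have hXd : (X.dual.interp G.ξ).length = n := Formula.length_interp_dual _ _
  have hlen : (seqInterp G.ξ (Γ ++ [X])).length = o + n := by
    rw [seqInterp_append, seqInterp_singleton, List.length_append]
  have hcut := Derivable.cut (Γ := Γ) (Δ := []) hσ (by rw [List.append_nil]; exact hτ)
  rw [List.append_nil, hlen] at hcut
  obtain ⟨h1, h2⟩ := Multiword.contractAlong_spec o (X.dual.interp G.ξ)
    (Multiword.tensor (o + n) σ τ)
  rw [Multiword.tensor_edges] at h1 h2
  rw [hXd] at h2
  have hτt := typed_closed ⟨τ, hτ, hτr, rfl⟩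
  have hτs : SuppIn (Set.Iio n) τ.edges := by
    have := hτt.suppIn; rwa [hXd] at this
  have hZ : Disjoint (Set.Iio (o + n)) (Set.Ici (o + n)) := by
    rw [Set.disjoint_left]; intro i; simp
  have hA₁ : SuppIn (Set.Iio (o + n)) σ.edges := by
    have := (hσ.typed hr).suppIn
    rwa [hlen] at this
  have hA₂ : SuppIn (Set.Ici (o + n)) (push (o + n + ·) τ.edges) := by
    rintro _ ⟨e, _, rfl⟩; simp
  set l : Set (Edge T) := link false (X.dual.interp G.ξ) with hldef
  have hl : ∀ e ∈ l, e.src < n + n ∧ e.tgt < n + n ∧ (e.src < n ↔ n ≤ e.tgt) := fun e he => by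
    have h3 := (link_typed false (X.dual.interp G.ξ)).suppIn e he
    simp only [List.length_append, Boundary.length_dual, Set.mem_Iio, hXd] at h3
    have h4 := (link_cases (p := e.src) (q := e.tgt) (w := e.label) he).2.2
    rw [hXd] at h4
    exact ⟨h3.1, h3.2, h4⟩
  have hls : SuppIn (Set.Iio n ∪ Set.Ico n (n + n)) l := fun e he => by
    have := hl e he
    simp only [Set.mem_union, Set.mem_Iio, Set.mem_Ico]; omega
  have hls2 : SuppIn (Set.Iio (o + n) ∪ Set.Ici (o + n)) (push (o + ·) l) := by
    rintro _ ⟨e, _, rfl⟩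
    simp only [Set.mem_union, Set.mem_Iio, Set.mem_Ici]; omega
  have hls' : ∀ e ∈ push (o + ·) l, e.src ∈ Set.Ici (o + n) → e.tgt ∈ Set.Iio (o + n) := by
    rintro _ ⟨e, he, rfl⟩ h3
    have := hl e he
    simp only [Set.mem_Ici, Set.mem_Iio] at h3 ⊢; omega
  have hinj : ∀ S, Set.InjOn (o + ·) S := fun S i _ j _ h => by simpa using h
  have hdet : detour (push (o + n + ·) τ.edges) ∅ (push (o + ·) l) (Set.Iio (o + n)) =
      push (o + ·) (push (rev n) τ.edges) := by
    have h3 := detour_push (f := (o + ·)) (B₂ := ∅) (N₁ := Set.Iio n) (N₂ := Set.Ico n (n + n))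
      hZ hA₂ hls (hinj _) (fun i hi => by simp only [Set.mem_Iio] at hi ⊢; omega)
      (fun i hi => by simp only [Set.mem_Ico, Set.mem_Ici] at hi ⊢; omega)
    rw [h3, paths_empty_right]
    congr 1
    have h4 : pull (o + ·) (Set.Ico n (n + n)) (push (o + n + ·) τ.edges) =
        push (n + ·) τ.edges := by
      have : push (o + n + ·) τ.edges = push (o + ·) (push (n + ·) τ.edges) := by
        rw [push_push]
        exact push_congr hτs fun i _ => by simp only [Function.comp]; omega
      rw [this, pull_push _ (hinj _)]
      exact hτs.push fun i hi => by simp only [Set.mem_Iio, Set.mem_Ico] at hi ⊢; omega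
    rw [h4]
    have h5 := pull_paths_link_right (b := false) (by exact hτt)
    rwa [hXd] at h5
  have huniv : ∀ E : Set (Edge T), SuppIn Set.univ E := fun _ _ _ => ⟨trivial, trivial⟩
  have hskip : ∀ i ∈ Set.Iio o, Multiword.skip o (n + n) i = i := fun i hi => if_pos hi
  have hcyc' : ∀ B : Set (Edge T), SuppIn (Set.Iio o) B →
      ¬ Cyc σ.edges (push (o + ·) (push (rev n) τ.edges) ∪ B) →
      ¬ Cyc (σ.edges ∪ push (o + n + ·) τ.edges)
        (push (o + ·) l ∪ push (Multiword.skip o (n + n)) B) := by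
    intro B hB h3 h4
    rw [Set.union_comm (push _ l), push_eq_self hB hskip] at h4
    have h5 := cyc_detour_of_cyc hZ hA₁ hA₂ (hB.mono fun i hi => by
      simp only [Set.mem_Iio] at hi ⊢; omega) hls2 hls' h4
    rw [hdet, Set.union_comm] at h5
    exact h3 h5
  have hcyc0 : ¬ Cyc (σ.edges ∪ push (o + n + ·) τ.edges) (push (o + ·) l) := by
    have := hcyc' ∅ (fun _ h => h.elim) (by simpa using hcyc)
    simpa using this
  refine ⟨_, hcut, h1.2 ⟨Multiword.tensor_isRegular.2 ⟨hr, hτr⟩, hcyc0⟩, fun B hB => ⟨fun h3 => ?_,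
    fun f K hf => ?_⟩⟩
  · rw [h2 hcyc0]
    have := hcyc' B hB h3
    rw [cyc_union_push_iff (huniv B), not_or] at this
    exact this.2
  · rw [h2 hcyc0, pull_paths_pull (huniv B) fun _ _ => trivial, Set.union_comm (push _ l),
      push_eq_self hB hskip, pull_congr (f := Multiword.skip o (n + n) ∘ f) (g := f)
        (fun i hi => hskip _ (hf i hi)),
      pull_paths_detour hZ hA₁ hA₂ (hB.mono fun i hi => by
        simp only [Set.mem_Iio] at hi ⊢; omega) hls2, hdet, Set.union_comm B]
    exact fun i hi => by
      have := hf i hi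
      simp only [Set.mem_Iio] at this ⊢; omega

/-- Cutting a derivable multiword against closed ones. -/
theorem Derivable.pull_mem_closed {Γ Δ : List (Formula G.Atom)} {X : Formula G.Atom}
    {σ : Multiword T} (hσ : G.Derivable (Γ ++ X :: Δ) σ) (hr : σ.IsRegular) {B : Set (Edge T)}
    (hB : B ∈ tests G.closedPair (place G.ξ 0 Γ ++
      place G.ξ ((seqInterp G.ξ Γ).length + (X.interp G.ξ).length) Δ)) (hcyc : ¬ Cyc σ.edges B) :
    pull ((seqInterp G.ξ Γ).length + ·) (Set.Iio (X.interp G.ξ).length) (paths σ.edges B) ∈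
      G.closed X := by
  induction Γ generalizing σ B with
  | nil =>
    simp only [List.nil_append, place, seqInterp_nil, List.length_nil, zero_add] at hσ hB ⊢
    induction Δ using List.reverseRecOn generalizing σ B with
    | nil =>
      obtain rfl : B = ∅ := hB
      refine ⟨σ, hσ, hr, ?_⟩
      rw [paths_empty_right]
      ext ⟨i, w, j⟩
      simp only [mem_pull]
      refine ⟨fun h => ?_, fun h => h.2.2⟩
      have := (hσ.typed hr).suppIn _ h
      rw [seqInterp_singleton] at this
      exact ⟨this.1, this.2, h⟩
    | append_singleton Δ Y ih =>
      rw [place_append, mem_tests_append] at hB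
      obtain ⟨B, hB, _, ⟨t, ht, _, rfl, rfl⟩, rfl⟩ := hB
      have hlen : (seqInterp G.ξ (X :: Δ)).length =
        (X.interp G.ξ).length + (seqInterp G.ξ Δ).length := by
        rw [seqInterp_cons, List.length_append]
      rw [Set.union_empty, Set.union_comm] at hcyc ⊢
      simp only [← hlen] at hcyc ⊢
      obtain ⟨ρ, h1, h2, h3⟩ := exists_cut_back (Γ := X :: Δ) hσ hr ht
        fun h => hcyc (h.mono subset_rfl Set.subset_union_left)
      have hBs : SuppIn (Set.Iio (seqInterp G.ξ (X :: Δ)).length) B :=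
        (tests_suppIn suppIn_closedPair hB).mono ((zone_place_subset _ _).trans fun i hi => by
          simp only [Set.mem_Ico, Set.mem_Iio] at hi ⊢; omega)
      obtain ⟨h4, h5⟩ := h3 B hBs
      rw [← h5]
      · exact ih h1 h2 (h4 hcyc) hB
      · intro i hi
        simp only [Set.mem_Iio] at hi ⊢; omega
  | cons Y Γ ih =>
    obtain ⟨t, ht, B', hB', rfl⟩ := hB
    have hid : push (0 + ·) t = t := by simp [push]
    have hlen : (seqInterp G.ξ (Y :: Γ)).length =
        (Y.interp G.ξ).length + (seqInterp G.ξ Γ).length := by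
      rw [seqInterp_cons, List.length_append]
    simp only [hid] at hcyc ⊢
    have hren : List.Forall₂ (Renamed G.ξ ((Y.interp G.ξ).length + ·))
        (place G.ξ 0 Γ ++ place G.ξ ((seqInterp G.ξ Γ).length + (X.interp G.ξ).length) Δ)
        (place G.ξ (0 + (Y.interp G.ξ).length) Γ ++
          place G.ξ ((seqInterp G.ξ (Y :: Γ)).length + (X.interp G.ξ).length) Δ) :=
      List.rel_append (place_renamed fun i _ => by omega) (place_renamed fun i _ => by omega)
    obtain ⟨B, hB, rfl⟩ := (mem_tests_renamed suppIn_closedPair hren).1 hB'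
    obtain ⟨ρ, h1, h2, h3⟩ := exists_cut_front hσ hr ht
      fun h => hcyc (h.mono subset_rfl Set.subset_union_left)
    obtain ⟨h4, h5⟩ := h3 B
    have h6 := ih h1 h2 hB (h4 hcyc)
    rw [h5] at h6
    simpa only [hlen, add_assoc] using h6

/-- Derivable multiwords realize their sequents if formulas are interpreted by closed derivable
multiwords. -/
theorem Derivable.realizes_closedPair {Γ : List (Formula G.Atom)} {σ : Multiword T}
    (hσ : G.Derivable Γ σ) (hr : σ.IsRegular) :
    Realizes G.ξ G.closedPair (place G.ξ 0 Γ) σ.edges := by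
  intro q l hp B hB hcyc
  have key : ∀ (o : ℕ) (Γ : List (Formula G.Atom)), q ∈ place G.ξ o Γ → ∃ Γ₁ X Γ₂,
      Γ = Γ₁ ++ X :: Γ₂ ∧ q = (X, (o + (seqInterp G.ξ Γ₁).length + ·)) := by
    intro o Γ
    induction Γ generalizing o with
    | nil => intro h; simp [place] at h
    | cons Y Γ ih =>
      intro h
      rcases List.mem_cons.1 h with rfl | h
      · exact ⟨[], Y, Γ, rfl, by simp [seqInterp_nil]⟩
      · obtain ⟨Γ₁, X, Γ₂, rfl, rfl⟩ := ih _ h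
        exact ⟨Y :: Γ₁, X, Γ₂, rfl, by simp [seqInterp_cons, add_assoc]⟩
  obtain ⟨Γ₁, X, Γ₂, rfl, rfl⟩ := key 0 Γ (hp.mem_iff.2 List.mem_cons_self)
  have hl : (place G.ξ 0 Γ₁ ++ place G.ξ ((seqInterp G.ξ Γ₁).length + (X.interp G.ξ).length) Γ₂).Perm
      l := by
    rw [place_append] at hp
    simp only [zero_add, place] at hp
    exact (List.perm_middle.symm.trans hp).cons_inv
  rw [← tests_perm hl] at hB
  simp only [zero_add]
  exact hσ.pull_mem_closed hr hB hcyc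

/-- The interpretation of literals by closed derivable multiwords. -/
def closedLiteral (G : LLG.{u, v} T) (b : Bool) (p : G.Atom) : Set (Set (Edge T)) :=
  G.closedPair (.pos p) b

theorem typed_closedLiteral (b : Bool) (p : G.Atom) :
    ∀ d ∈ G.closedLiteral b p, Typed b (G.ξ p) d := typed_closedPair (.pos p) b

end LLG

/-! ### Invertibility of the par rule -/

section CycCut

variable {ξ : N → Boundary} {Γ Δ : List (Formula N)} {X : Formula N} {σ τ : Set (Edge T)}

theorem link_dual_cases (X : Formula N) : ∀ e ∈ (link false (X.dual.interp ξ) : Set (Edge T)),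
    e.src < (X.interp ξ).length + (X.interp ξ).length ∧
    e.tgt < (X.interp ξ).length + (X.interp ξ).length ∧
    (e.src < (X.interp ξ).length ↔ (X.interp ξ).length ≤ e.tgt) := fun e he => by
  have h3 := (link_typed false (X.dual.interp ξ)).suppIn e he
  simp only [List.length_append, Boundary.length_dual, Set.mem_Iio,
    Formula.length_interp_dual] at h3
  have h4 := (link_cases (p := e.src) (q := e.tgt) (w := e.label) he).2.2
  rw [Formula.length_interp_dual] at h4
  exact ⟨h3.1, h3.2, h4⟩

theorem add_left_injOn (k : ℕ) (S : Set ℕ) : Set.InjOn (k + ·) S :=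
  fun i _ j _ h => by simpa using h

/-- A cycle closed by a cut is viewed from the left premise: the right premise enters only by its
edges with both ends at the cut formula, reflected by the links. -/
theorem cyc_cut_left (hσ : Typed true (seqInterp ξ (Γ ++ [X])) σ)
    (hτ : Typed true (seqInterp ξ ([X.dual] ++ Δ)) τ)
    (h : Cyc (σ ∪ push ((seqInterp ξ (Γ ++ [X])).length + ·) τ)
      (push ((seqInterp ξ Γ).length + ·) (link false (X.dual.interp ξ)))) :
    Cyc σ (push ((seqInterp ξ Γ).length + ·)
      (push (rev (X.interp ξ).length) (pull id (Set.Iio (X.interp ξ).length) τ))) := by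
  have hl := link_dual_cases (T := T) (ξ := ξ) X
  have hlen : (seqInterp ξ (Γ ++ [X])).length = (seqInterp ξ Γ).length + (X.interp ξ).length := by
    rw [seqInterp_append, seqInterp_singleton, List.length_append]
  have hXd := Formula.length_interp_dual ξ X
  have hA₁ := hσ.suppIn
  rw [hlen] at h hA₁
  have hτt : Typed true (X.dual.interp ξ) (pull id (Set.Iio (X.interp ξ).length) τ) := by
    rintro e ⟨h1, h2, he⟩
    have := hτ e he
    simp only [Set.mem_Iio] at h1 h2
    rwa [seqInterp_append, seqInterp_singleton, List.getElem?_append_left (by omega),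
      List.getElem?_append_left (by omega)] at this
  set o := (seqInterp ξ Γ).length
  set n := (X.interp ξ).length
  set l : Set (Edge T) := link false (X.dual.interp ξ)
  have hZ : Disjoint (Set.Iio (o + n)) (Set.Ici (o + n)) := by
    rw [Set.disjoint_left]; intro i; simp
  have hA₂ : SuppIn (Set.Ici (o + n)) (push (o + n + ·) τ) := by
    rintro _ ⟨e, _, rfl⟩; simp
  have hls : SuppIn (Set.Iio n ∪ Set.Ico n (n + n)) l := fun e he => by
    have := hl e he
    simp only [Set.mem_union, Set.mem_Iio, Set.mem_Ico]; omega
  have hls2 : SuppIn (Set.Iio (o + n) ∪ Set.Ici (o + n)) (push (o + ·) l) := by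
    rintro _ ⟨e, _, rfl⟩
    simp only [Set.mem_union, Set.mem_Iio, Set.mem_Ici]; omega
  have hls' : ∀ e ∈ push (o + ·) l, e.src ∈ Set.Ici (o + n) → e.tgt ∈ Set.Iio (o + n) := by
    rintro _ ⟨e, he, rfl⟩ h3
    have := hl e he
    simp only [Set.mem_Ici, Set.mem_Iio] at h3 ⊢; omega
  rw [← Set.empty_union (push (o + ·) l)] at h
  have h2 := cyc_detour_of_cyc hZ hA₁ hA₂ (fun _ h => h.elim) hls2 hls' h
  rw [Set.empty_union, detour_push (f := (o + ·)) (N₁ := Set.Iio n) (N₂ := Set.Ico n (n + n))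
      hZ hA₂ hls (add_left_injOn _ _) (fun i hi => by simp only [Set.mem_Iio] at hi ⊢; omega)
      (fun i hi => by simp only [Set.mem_Ico, Set.mem_Ici] at hi ⊢; omega)] at h2
  have h4 : pull (o + ·) (Set.Ico n (n + n)) (push (o + n + ·) τ) =
      push (n + ·) (pull id (Set.Iio n) τ) := by
    ext ⟨i, w, j⟩
    simp only [mem_pull, mem_push, Set.mem_Ico, Set.mem_Iio, id]
    constructor
    · rintro ⟨hi, hj, p, q, hpq, hp, hq⟩
      exact ⟨p, q, ⟨by omega, by omega, hpq⟩, by omega, by omega⟩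
    · rintro ⟨p, q, ⟨hp, hq, hpq⟩, rfl, rfl⟩
      exact ⟨by omega, by omega, p, q, hpq, by omega, by omega⟩
  have h5 := pull_paths_link_right (b := false) (by exact hτt)
  rw [hXd] at h5
  rwa [paths_empty_right, h4, h5] at h2

theorem cyc_cut_right (hσ : Typed true (seqInterp ξ (Γ ++ [X])) σ)
    (h : Cyc (σ ∪ push ((seqInterp ξ (Γ ++ [X])).length + ·) τ)
      (push ((seqInterp ξ Γ).length + ·) (link false (X.dual.interp ξ)))) :
    Cyc τ (push (rev (X.interp ξ).length)
      (pull ((seqInterp ξ Γ).length + ·) (Set.Iio (X.interp ξ).length) σ)) := by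
  have hl := link_dual_cases (T := T) (ξ := ξ) X
  have hlen : (seqInterp ξ (Γ ++ [X])).length = (seqInterp ξ Γ).length + (X.interp ξ).length := by
    rw [seqInterp_append, seqInterp_singleton, List.length_append]
  have hXd := Formula.length_interp_dual ξ X
  have hA₂ := hσ.suppIn
  rw [hlen] at h hA₂
  have hσt : Typed true (X.dual.interp ξ).dual
      (pull ((seqInterp ξ Γ).length + ·) (Set.Iio (X.interp ξ).length) σ) := by
    rintro e ⟨h1, h2, he⟩
    have := hσ _ he
    rw [seqInterp_append, seqInterp_singleton, List.getElem?_append_right (by simp),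
      List.getElem?_append_right (by simp)] at this
    rw [Formula.interp_dual, Boundary.dual_dual]
    simpa using this
  set o := (seqInterp ξ Γ).length
  set n := (X.interp ξ).length
  set l : Set (Edge T) := link false (X.dual.interp ξ)
  have hZ : Disjoint (Set.Ici (o + n)) (Set.Iio (o + n)) := by
    rw [Set.disjoint_left]; intro i; simp
  have hA₁ : SuppIn (Set.Ici (o + n)) (push (o + n + ·) τ) := by
    rintro _ ⟨e, _, rfl⟩; simp
  have hls : SuppIn (Set.Ico n (n + n) ∪ Set.Iio n) l := fun e he => by
    have := hl e he
    simp only [Set.mem_union, Set.mem_Iio, Set.mem_Ico]; omega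
  have hls2 : SuppIn (Set.Ici (o + n) ∪ Set.Iio (o + n)) (push (o + ·) l) := by
    rintro _ ⟨e, _, rfl⟩
    simp only [Set.mem_union, Set.mem_Iio, Set.mem_Ici]; omega
  have hls' : ∀ e ∈ push (o + ·) l, e.src ∈ Set.Iio (o + n) → e.tgt ∈ Set.Ici (o + n) := by
    rintro _ ⟨e, he, rfl⟩ h3
    have := hl e he
    simp only [Set.mem_Ici, Set.mem_Iio] at h3 ⊢; omega
  rw [← Set.empty_union (push (o + ·) l), Set.union_comm σ] at h
  have h2 := cyc_detour_of_cyc hZ hA₁ hA₂ (fun _ h => h.elim) hls2 hls' h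
  rw [Set.empty_union, detour_push (f := (o + ·)) (N₁ := Set.Ico n (n + n)) (N₂ := Set.Iio n)
      hZ hA₂ hls (add_left_injOn _ _)
      (fun i hi => by simp only [Set.mem_Ico, Set.mem_Ici] at hi ⊢; omega)
      (fun i hi => by simp only [Set.mem_Iio] at hi ⊢; omega), paths_empty_right] at h2
  have h4 : ∀ E : Set (Edge T), pull id (Set.Ico n (n + n)) E =
      push (n + ·) (pull (n + ·) (Set.Iio n) E) := fun E => by
    ext ⟨i, w, j⟩
    simp only [mem_pull, mem_push, Set.mem_Ico, Set.mem_Iio, id]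
    constructor
    · rintro ⟨hi, hj, h⟩
      refine ⟨i - n, j - n, ⟨by omega, by omega, ?_⟩, by omega, by omega⟩
      rwa [show n + (i - n) = i by omega, show n + (j - n) = j by omega]
    · rintro ⟨p, q, ⟨hp, hq, hpq⟩, rfl, rfl⟩
      exact ⟨by omega, by omega, hpq⟩
  have h5 := pull_paths_link_left (b := false) (by exact hσt)
  rw [hXd] at h5
  rw [h4, h5, push_push] at h2
  have h6 : ((o + ·) ∘ (n + ·) : ℕ → ℕ) = (o + n + ·) := by
    funext i; simp only [Function.comp]; omega
  have huniv : ∀ E : Set (Edge T), SuppIn Set.univ E := fun _ _ _ => ⟨trivial, trivial⟩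
  rwa [h6, cyc_push_iff (add_left_injOn _ Set.univ) (huniv _) (huniv _)] at h2

end CycCut

/-! ### Cuts that plug one side of a par -/

section ParCut

variable {XA XB : Boundary} {ρ τ : Set (Edge T)}

/-- The result of cutting `A ⅋ B` against the tensor of an identity of `B` and a closed `τ` is not
traced by hand. It follows from soundness in a model tailored to it: `A` has the single test coming
from `τ`, and `B` has the expected result as its single realizer. Membership in a singleton is the
desired equality. -/
theorem par_cut_left (hρ : Typed true (XA ++ XB) ρ) (hτ : Typed true XA.dual τ)
    (hcyc : ¬ Cyc ρ (push (rev XA.length) τ)) :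
    let A := link true XB.dual ∪ push (XB.length + XB.length + ·) τ ∪
      push (XB.length + (XB.length + XA.length) + ·) ρ
    let C := push (XB.length + ·) (link false (XA ++ XB))
    ¬ Cyc A C ∧ pull (Multiword.skip XB.length ((XA ++ XB).length + (XA ++ XB).length)) Set.univ
      (paths A C) =
        pull (XA.length + ·) (Set.Iio XB.length) (paths ρ (push (rev XA.length) τ)) := by
  intro A C
  set m := XA.length with hm
  set n := XB.length with hn
  set a := push (rev m) τ with ha
  set E := pull (m + ·) (Set.Iio n) (paths ρ a) with hE
  let ξ : Bool → Boundary := fun b => if b then XA else XB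
  -- The atom `true` stands for `A`, with `a` as its only test; the atom `false` stands for `B`,
  -- with `E` as its only realizer.
  let L : Bool → Bool → Set (Set (Edge T)) := fun b p =>
    if b = false ∧ p = true then {a} else if b = true ∧ p = false then {E} else ∅
  have hat : Typed false XA a := hτ.push_rev
  have hEt : Typed true XB E := by
    rintro e ⟨h1, h2, h3⟩
    have := hρ.paths _ h3
    rw [List.getElem?_append_right (by simp [hm]), List.getElem?_append_right (by simp [hm])] at this
    simpa [hm] using this
  have hL : ∀ b p, ∀ d ∈ L b p, Typed b (ξ p) d := by
    rintro (_ | _) (_ | _) d hd <;> simp only [L] at hd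
    · simp at hd
    · simp at hd; subst hd; exact hat
    · simp at hd; subst hd; exact hEt
    · simp at hd
  let FA : Formula Bool := .pos true
  let FB : Formula Bool := .pos false
  have hρ1 : ρ ∈ realizers ξ L (FA.par FB) true := by
    refine ⟨hρ, fun a' ha' _ => ?_, fun c hc _ => ?_⟩
    · obtain rfl : a' = a := by simpa [FA, realizers, L] using ha'
      simp [FB, realizers, L, ξ, hE, FA, Formula.interp, ← hm, ← hn]
    · simp [FB, realizers, L] at hc
  have hid : ∀ D : Set (Edge T), push (0 + ·) D = D := fun D => by simp [push]
  have h1 : Realizes ξ (realizers ξ L) (place ξ 0 [FA.par FB]) ρ := by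
    have := Realizes.singleton (q := (FA.par FB, (0 + ·))) hL hρ1 (add_left_injOn _ _)
    rwa [hid] at this
  have h2 : Realizes ξ (realizers ξ L) (place ξ 0 [FA.dual]) τ := by
    have h3 : τ ∈ realizers ξ L FA.dual true := by
      refine ⟨a, by simp [L], ?_⟩
      have := hτ.suppIn
      rw [Boundary.length_dual] at this
      exact push_rev_push_rev this
    have := Realizes.singleton (q := (FA.dual, (0 + ·))) hL h3 (add_left_injOn _ _)
    rwa [hid] at this
  have h3 : Realizes ξ (realizers ξ L) (place ξ 0 ([FB] ++ [FB.dual])) (link true XB.dual) :=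
    realizes_id (T := T) hL FB.dual
  have t1 : Typed true (seqInterp ξ [FA.par FB]) ρ := by
    rw [seqInterp_singleton]; exact hρ
  have t2 : Typed true (seqInterp ξ [FA.dual]) τ := by
    rw [seqInterp_singleton]; exact hτ
  have t3 : Typed true (seqInterp ξ ([FB] ++ [FB.dual])) (link true XB.dual : Set (Edge T)) := by
    rw [seqInterp_append, seqInterp_singleton, seqInterp_singleton]
    have := link_typed (T := T) true XB.dual
    rwa [Boundary.dual_dual] at this
  have hB : (seqInterp ξ [FB]).length = n := by rw [seqInterp_singleton]; rfl
  have hBB : (seqInterp ξ ([FB] ++ [FB.dual])).length = n + n := by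
    rw [seqInterp_append, List.length_append, hB, seqInterp_singleton]
    exact congrArg _ (Boundary.length_dual XB)
  have h4 := realizes_tensor (Δ := []) hL h3 h2 t3 t2
  have t4 := typed_juxtapose (Δ := []) t3 t2
  rw [List.append_nil, hBB] at h4 t4
  have hX : ((FB.dual.tensor FA.dual).interp ξ).length = n + m := by
    change (XB.dual ++ XA.dual).length = _
    rw [List.length_append, Boundary.length_dual, Boundary.length_dual]
  have hBX : (seqInterp ξ ([FB] ++ [FB.dual.tensor FA.dual])).length = n + (n + m) := by
    rw [seqInterp_append, List.length_append, hB, seqInterp_singleton, hX]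
  have h5 : ¬ Cyc A C := by
    intro h
    have h6 := cyc_cut_right (τ := ρ) t4 (by rw [hB, hBX]; exact h)
    rw [hB, hX] at h6
    refine hcyc (h6.mono subset_rfl ?_)
    -- The identity links have one end outside the cut formula, so only the edges of `τ` remain, and
    -- these are the given test.
    rintro _ ⟨⟨i, w, j⟩, ⟨hi, hj, he⟩, rfl⟩
    simp only [Set.mem_Iio] at hi hj
    rcases he with he | he
    · have h7 := (link_cases he).2
      have h8 := (link_typed true XB.dual).suppIn _ he
      simp only [List.length_append, Boundary.length_dual, Set.mem_Iio, rev] at h7 h8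
      omega
    · obtain ⟨p, q, hpq, hp, hq⟩ := mem_push.1 he
      have := hτ.suppIn _ hpq
      simp only [Boundary.length_dual, Set.mem_Iio] at this hp hq
      refine mem_push.2 ⟨p, q, hpq, ?_, ?_⟩ <;> simp only [rev] <;> omega
  refine ⟨h5, ?_⟩
  have h6 := realizes_cut (Δ := []) (τ := ρ) hL h4 h1 t4 t1 (by rw [hB, hBX]; exact h5)
  have t6 := typed_cut (Δ := []) (X := FB.dual.tensor FA.dual) (τ := ρ)
    (C := C) t4 t1
  rw [List.append_nil, hB, hBX] at h6 t6
  have h7 := h6 _ _ (List.Perm.refl _) ∅ rfl (not_cyc_empty _)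
  rw [paths_empty_right] at h7
  have h8 : pull (0 + ·) (Set.Iio n) (pull (Multiword.skip n ((XA ++ XB).length + (XA ++ XB).length)) Set.univ
      (paths A C)) = E := by
    have h9 : _ ∈ L true false := h7
    rw [show L true false = {E} by simp [L]] at h9
    exact h9
  rw [← h8]
  rw [seqInterp_singleton] at t6
  have t7 : SuppIn (Set.Iio n) (pull (Multiword.skip n
      ((XA ++ XB).length + (XA ++ XB).length)) Set.univ (paths A C)) := t6.suppIn
  have h10 := pull_push t7 (add_left_injOn 0 _)
  rw [hid] at h10
  exact h10.symm

/-- The mirror image: now `B` has a single test and `A` a single realizer. -/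
theorem par_cut_right (hρ : Typed true (XA ++ XB) ρ) (hτ : Typed true XB.dual τ)
    (hcyc : ¬ Cyc ρ (push (XA.length + ·) (push (rev XB.length) τ))) :
    let A := ρ ∪ push (XA.length + XB.length + ·) (τ ∪ push (XB.length + ·) (link true XA))
    let C := link false (XB.dual ++ XA.dual)
    ¬ Cyc A C ∧ pull (Multiword.skip 0 ((XB.dual ++ XA.dual).length + (XB.dual ++ XA.dual).length))
      Set.univ (paths A C) =
        pull id (Set.Iio XA.length) (paths ρ (push (XA.length + ·) (push (rev XB.length) τ))) := by
  intro A C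
  set m := XA.length with hm
  set n := XB.length with hn
  set c := push (rev n) τ with hc
  set E := pull id (Set.Iio m) (paths ρ (push (m + ·) c)) with hE
  let ξ : Bool → Boundary := fun b => if b then XA else XB
  let L : Bool → Bool → Set (Set (Edge T)) := fun b p =>
    if b = false ∧ p = false then {c} else if b = true ∧ p = true then {E} else ∅
  have hct : Typed false XB c := hτ.push_rev
  have hEt : Typed true XA E := by
    rintro e ⟨h1, h2, h3⟩
    have := hρ.paths _ h3
    simp only [Set.mem_Iio, hm] at h1 h2
    simp only [id] at this
    rwa [List.getElem?_append_left h1, List.getElem?_append_left h2] at this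
  have hL : ∀ b p, ∀ d ∈ L b p, Typed b (ξ p) d := by
    rintro (_ | _) (_ | _) d hd <;> simp only [L] at hd
    · simp at hd; subst hd; exact hct
    · simp at hd
    · simp at hd
    · simp at hd; subst hd; exact hEt
  let FA : Formula Bool := .pos true
  let FB : Formula Bool := .pos false
  have hρ1 : ρ ∈ realizers ξ L (FA.par FB) true := by
    refine ⟨hρ, fun a ha _ => ?_, fun c' hc' _ => ?_⟩
    · simp [FA, realizers, L] at ha
    · obtain rfl : c' = c := by simpa [FB, realizers, L] using hc'
      have : L true true = {E} := by simp [L]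
      change _ ∈ L true true
      rw [this]
      rfl
  have hid : ∀ D : Set (Edge T), push (0 + ·) D = D := fun D => by simp [push]
  have h1 : Realizes ξ (realizers ξ L) (place ξ 0 [FA.par FB]) ρ := by
    have := Realizes.singleton (q := (FA.par FB, (0 + ·))) hL hρ1 (add_left_injOn _ _)
    rwa [hid] at this
  have h2 : Realizes ξ (realizers ξ L) (place ξ 0 [FB.dual]) τ := by
    have h3 : τ ∈ realizers ξ L FB.dual true := by
      refine ⟨c, by simp [L], ?_⟩
      have := hτ.suppIn
      rw [Boundary.length_dual] at this
      exact push_rev_push_rev this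
    have := Realizes.singleton (q := (FB.dual, (0 + ·))) hL h3 (add_left_injOn _ _)
    rwa [hid] at this
  have h3 : Realizes ξ (realizers ξ L) (place ξ 0 ([FA.dual] ++ [FA])) (link true XA) :=
    realizes_id (T := T) hL FA
  have t1 : Typed true (seqInterp ξ [FA.par FB]) ρ := by
    rw [seqInterp_singleton]; exact hρ
  have t2 : Typed true (seqInterp ξ [FB.dual]) τ := by
    rw [seqInterp_singleton]; exact hτ
  have t3 : Typed true (seqInterp ξ ([FA.dual] ++ [FA])) (link true XA : Set (Edge T)) := by
    rw [seqInterp_append, seqInterp_singleton, seqInterp_singleton]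
    exact link_typed (T := T) true XA
  have hB : (seqInterp ξ ([] ++ [FB.dual])).length = n := by
    rw [List.nil_append, seqInterp_singleton]; exact Boundary.length_dual XB
  have h4 := realizes_tensor (Γ := []) hL h2 h3 t2 t3
  have t4 := typed_juxtapose (Γ := []) t2 t3
  rw [hB] at h4 t4
  have hX : ((FA.par FB).interp ξ).length = m + n := by
    change (XA ++ XB).length = _
    rw [List.length_append]
  have hBX : (seqInterp ξ ([] ++ [FA.par FB])).length = m + n := by
    rw [List.nil_append, seqInterp_singleton, hX]
  have h5 : ¬ Cyc A C := by
    intro h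
    have h6 := cyc_cut_left (Γ := []) (X := FA.par FB) (Δ := [FA]) t1 t4
      (by rw [hBX, seqInterp_nil, List.length_nil, hid]; exact h)
    rw [seqInterp_nil, List.length_nil, hid, hX] at h6
    refine hcyc (h6.mono subset_rfl ?_)
    rintro _ ⟨⟨i, w, j⟩, ⟨hi, hj, he⟩, rfl⟩
    simp only [Set.mem_Iio] at hi hj
    rcases he with he | he
    · have := hτ.suppIn _ he
      simp only [Boundary.length_dual, Set.mem_Iio, id] at this
      rw [hc, push_push]
      refine mem_push.2 ⟨i, j, he, ?_, ?_⟩ <;> simp only [rev, Function.comp] <;> omega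
    · obtain ⟨p, q, hpq, hp, hq⟩ := mem_push.1 he
      have h7 := (link_cases hpq).2
      have h8 := (link_typed true XA).suppIn _ hpq
      simp only [List.length_append, Boundary.length_dual, Set.mem_Iio, rev, id] at h7 h8 hp hq
      omega
  refine ⟨h5, ?_⟩
  have h6 := realizes_cut (Γ := []) (X := FA.par FB) (Δ := [FA]) hL h1 h4 t1 t4
    (by rw [hBX, seqInterp_nil, List.length_nil, hid]; exact h5)
  have t6 := typed_cut (Γ := []) (X := FA.par FB) (Δ := [FA]) (C := C) t1 t4
  rw [seqInterp_nil, List.length_nil, hid, hBX] at h6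
  rw [seqInterp_nil, List.length_nil, hBX] at t6
  have h7 := h6 _ _ (List.Perm.refl _) ∅ rfl (not_cyc_empty _)
  rw [paths_empty_right] at h7
  have h8 : pull (0 + ·) (Set.Iio m) (pull (Multiword.skip 0
      ((XB.dual ++ XA.dual).length + (XB.dual ++ XA.dual).length)) Set.univ (paths A C)) = E := by
    have h9 : _ ∈ L true true := h7
    rw [show L true true = {E} by simp [L]] at h9
    exact h9
  rw [← h8]
  rw [List.nil_append, seqInterp_singleton] at t6
  have t7 : SuppIn (Set.Iio m) (pull (Multiword.skip 0
      ((XB.dual ++ XA.dual).length + (XB.dual ++ XA.dual).length)) Set.univ (paths A C)) := t6.suppIn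
  have h10 := pull_push t7 (add_left_injOn 0 _)
  rw [hid] at h10
  exact h10.symm

end ParCut

namespace LLG

variable {G : LLG.{u, v} T}

/-- Plugging the test into `A` is performed by a derivation: the identity of `B` is tensored with
the closed multiword of type `A^⊥`, and the result is cut against `A ⅋ B`. -/
theorem pull_mem_closed_right {A B : Formula G.Atom} {d a : Set (Edge T)}
    (hd : d ∈ G.closed (A.par B)) (ha : a ∈ G.closedPair A false) (hcyc : ¬ Cyc d a) :
    pull ((A.interp G.ξ).length + ·) (Set.Iio (B.interp G.ξ).length) (paths d a) ∈ G.closed B := by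
  have hdt := typed_closed hd
  obtain ⟨ρ, hρ, hρr, rfl⟩ := hd
  obtain ⟨_, ⟨τ, hτ, hτr, rfl⟩, rfl⟩ := ha
  have hτt := typed_closed ⟨τ, hτ, hτr, rfl⟩
  rw [Formula.interp_dual] at hτt
  obtain ⟨h1, h2⟩ := par_cut_left hdt hτt hcyc
  have h3 := Derivable.id (G := G) B.dual
  rw [Formula.dual_dual] at h3
  have h4 := Derivable.tensor (Γ := [B]) (Δ := []) h3 hτ
  rw [List.append_nil] at h4
  have h5 := Derivable.cut (Γ := [B]) (Δ := []) h4
    (by simpa [Formula.dual, Formula.dual_dual] using hρ)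
  rw [List.append_nil] at h5
  refine ⟨_, h5, ?_⟩
  obtain ⟨h6, h7⟩ := Multiword.contractAlong_spec (seqInterp G.ξ [B]).length
    ((B.dual.tensor A.dual).dual.interp G.ξ) (Multiword.tensor
      (seqInterp G.ξ ([B] ++ [B.dual.tensor A.dual])).length
      (Multiword.tensor (seqInterp G.ξ ([B] ++ [B.dual])).length
        (Multiword.identity (B.dual.interp G.ξ)) τ) ρ)
  have hX : (B.dual.tensor A.dual).dual.interp G.ξ = A.interp G.ξ ++ B.interp G.ξ := by
    simp [Formula.dual, Formula.dual_dual, Formula.interp]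
  have hl1 : (seqInterp G.ξ [B]).length = (B.interp G.ξ).length := by rw [seqInterp_singleton]
  have hl2 : (seqInterp G.ξ ([B] ++ [B.dual])).length =
      (B.interp G.ξ).length + (B.interp G.ξ).length := by
    rw [seqInterp_append, List.length_append, hl1, seqInterp_singleton, Formula.length_interp_dual]
  have hl3 : (seqInterp G.ξ ([B] ++ [B.dual.tensor A.dual])).length =
      (B.interp G.ξ).length + ((B.interp G.ξ).length + (A.interp G.ξ).length) := by
    rw [seqInterp_append, List.length_append, hl1, seqInterp_singleton]
    simp [Formula.interp, Formula.length_interp_dual]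
  rw [Multiword.tensor_edges, Multiword.tensor_edges, Multiword.identity_edges, hX, hl1, hl2, hl3,
    Formula.interp_dual] at h6 h7
  rw [hX, hl1, hl2, hl3, Formula.interp_dual]
  exact ⟨h6.2 ⟨Multiword.tensor_isRegular.2 ⟨Multiword.tensor_isRegular.2 ⟨rfl, hτr⟩, hρr⟩, h1⟩,
    (h7 h1).trans h2⟩

theorem pull_mem_closed_left {A B : Formula G.Atom} {d c : Set (Edge T)}
    (hd : d ∈ G.closed (A.par B)) (hc : c ∈ G.closedPair B false)
    (hcyc : ¬ Cyc d (push ((A.interp G.ξ).length + ·) c)) :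
    pull id (Set.Iio (A.interp G.ξ).length) (paths d (push ((A.interp G.ξ).length + ·) c)) ∈
      G.closed A := by
  have hdt := typed_closed hd
  obtain ⟨ρ, hρ, hρr, rfl⟩ := hd
  obtain ⟨_, ⟨τ, hτ, hτr, rfl⟩, rfl⟩ := hc
  have hτt := typed_closed ⟨τ, hτ, hτr, rfl⟩
  rw [Formula.interp_dual] at hτt
  obtain ⟨h1, h2⟩ := par_cut_right hdt hτt hcyc
  have h4 := Derivable.tensor (Γ := []) (Δ := [A]) hτ (Derivable.id (G := G) A)
  rw [List.nil_append] at h4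
  have h5 := Derivable.cut (Γ := []) (Δ := [A]) (X := A.par B) hρ h4
  rw [List.nil_append] at h5
  refine ⟨_, h5, ?_⟩
  obtain ⟨h6, h7⟩ := Multiword.contractAlong_spec (seqInterp G.ξ []).length
    ((A.par B).dual.interp G.ξ) (Multiword.tensor
      (seqInterp G.ξ ([] ++ [A.par B])).length ρ
      (Multiword.tensor (seqInterp G.ξ ([] ++ [B.dual])).length τ
        (Multiword.identity (A.interp G.ξ))))
  have hX : (A.par B).dual.interp G.ξ = (B.interp G.ξ).dual ++ (A.interp G.ξ).dual := by
    simp [Formula.dual, Formula.interp, Formula.interp_dual]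
  have hl1 : (seqInterp G.ξ []).length = 0 := rfl
  have hl2 : (seqInterp G.ξ ([] ++ [B.dual])).length = (B.interp G.ξ).length := by
    rw [List.nil_append, seqInterp_singleton, Formula.length_interp_dual]
  have hl3 : (seqInterp G.ξ ([] ++ [A.par B])).length =
      (A.interp G.ξ).length + (B.interp G.ξ).length := by
    rw [List.nil_append, seqInterp_singleton]
    simp [Formula.interp]
  have hid : ∀ D : Set (Edge T), push (0 + ·) D = D := fun D => by simp [push]
  rw [Multiword.tensor_edges, Multiword.tensor_edges, Multiword.identity_edges, hX, hl1, hl2, hl3,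
    hid] at h6 h7
  rw [hX, hl1, hl2, hl3]
  exact ⟨h6.2 ⟨Multiword.tensor_isRegular.2 ⟨hρr, Multiword.tensor_isRegular.2 ⟨hτr, rfl⟩⟩, h1⟩,
    (h7 h1).trans h2⟩

/-- For a par, the first inclusion is invertibility by cuts. The second holds since closed
multiwords for the duals of the components combine by the tensor rule. A closed multiword of tensor
type need not split into two parts, which is why the formula has to be ⊗-free. -/
theorem closed_tensorFree (X : Formula G.Atom) (hX : X.TensorFree) :
    G.closed X ⊆ realizers G.ξ G.closedLiteral X true ∧
    realizers G.ξ G.closedLiteral X false ⊆ G.closedPair X false := by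
  induction X with
  | pos p => exact ⟨subset_rfl, subset_rfl⟩
  | neg p =>
    constructor
    · intro d hd
      have hs := (typed_closed hd).suppIn
      simp only [Formula.interp, Boundary.length_dual] at hs
      refine ⟨_, ⟨d, hd, rfl⟩, ?_⟩
      exact push_rev_push_rev hs
    · rintro _ ⟨d, hd, rfl⟩
      refine ⟨d, hd, ?_⟩
      simp only [Formula.interp, Boundary.length_dual]
  | tensor A B => exact hX.elim
  | par A B ihA ihB =>
    obtain ⟨ihA1, ihA2⟩ := ihA hX.1
    obtain ⟨ihB1, ihB2⟩ := ihB hX.2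
    constructor
    · intro d hd
      exact ⟨typed_closed hd, fun a ha hcyc => ihB1 (pull_mem_closed_right hd (ihA2 ha) hcyc),
        fun c hc hcyc => ihA1 (pull_mem_closed_left hd (ihB2 hc) hcyc)⟩
    · rintro _ ⟨a, ha, c, hc, rfl⟩
      have ha' := (typed_closedPair _ _ _ (ihA2 ha)).suppIn
      have hc' := (typed_closedPair _ _ _ (ihB2 hc)).suppIn
      obtain ⟨_, ⟨ρ, h1, h2, rfl⟩, rfl⟩ := ihA2 ha
      obtain ⟨_, ⟨τ, h3, h4, rfl⟩, rfl⟩ := ihB2 hc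
      have h5 := Derivable.tensor (Γ := []) (Δ := []) (X := B.dual) (Y := A.dual) h3 h1
      refine ⟨_, ⟨_, h5, Multiword.tensor_isRegular.2 ⟨h4, h2⟩, rfl⟩, ?_⟩
      have hρs := (typed_closed ⟨ρ, h1, h2, rfl⟩).suppIn
      have hτs := (typed_closed ⟨τ, h3, h4, rfl⟩).suppIn
      rw [Formula.length_interp_dual] at hρs hτs
      rw [Multiword.tensor_edges, push_union, push_push, push_push, Set.union_comm,
        List.nil_append, seqInterp_singleton, Formula.length_interp_dual]
      have hl : ((A.par B).interp G.ξ).length = (A.interp G.ξ).length + (B.interp G.ξ).length := by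
        simp [Formula.interp]
      rw [hl]
      congr 1
      · refine push_congr hρs fun i hi => ?_
        simp only [Function.comp, rev]; omega
      · refine push_congr hτs fun i hi => ?_
        simp only [Set.mem_Iio] at hi
        simp only [Function.comp, rev]; omega

/-- The tests over literals are closed multiwords, so they can be cut in, and the closed multiword
obtained is a realizer over literals. -/
theorem Derivable.realizes_closedLiteral {Γ : List (Formula G.Atom)} {σ : Multiword T}
    (hΓ : ∀ X ∈ Γ, X.TensorFree) (hσ : G.Derivable Γ σ) (hr : σ.IsRegular) :
    Realizes G.ξ (realizers G.ξ G.closedLiteral) (place G.ξ 0 Γ) σ.edges := by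
  have hP : ∀ q ∈ place G.ξ 0 Γ, q.1.TensorFree := by
    have key : ∀ (o : ℕ) (Γ : List (Formula G.Atom)), (∀ X ∈ Γ, X.TensorFree) →
        ∀ q ∈ place G.ξ o Γ, q.1.TensorFree := by
      intro o Γ
      induction Γ generalizing o with
      | nil => intro _ q hq; simp [place] at hq
      | cons Y Γ ih =>
        intro h q hq
        rcases List.mem_cons.1 hq with rfl | hq
        · exact h _ List.mem_cons_self
        · exact ih _ (fun X hX => h X (List.mem_cons_of_mem _ hX)) q hq
    exact key 0 Γ hΓ
  intro q l hp B hB hcyc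
  refine (closed_tensorFree q.1 (hP q (hp.mem_iff.2 List.mem_cons_self))).1 ?_
  refine hσ.realizes_closedPair hr q l hp B (tests_mono (fun r hr' => ?_) hB) hcyc
  exact (closed_tensorFree r.1 (hP r (hp.mem_iff.2 (List.mem_cons_of_mem _ hr')))).2

end LLG

/-! ### Literals -/

/-- The literals of a `⊗`-free formula. -/
def Formula.leaves : Formula N → List (Formula N)
  | .par A B => A.leaves ++ B.leaves
  | X => [X]

def Formula.IsLiteral (X : Formula N) : Prop := ∃ p, X = .pos p ∨ X = .neg p

/-- The first atom of a formula. -/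
def Formula.atom : Formula N → N
  | .pos p => p
  | .neg p => p
  | .tensor A _ => A.atom
  | .par A _ => A.atom

theorem Formula.TensorFree.isLiteral_of_mem {X : Formula N} (hX : X.TensorFree) :
    ∀ Y ∈ X.leaves, Y.IsLiteral := by
  induction X with
  | pos p => intro Y hY; exact ⟨p, Or.inl (by simpa [Formula.leaves] using hY)⟩
  | neg p => intro Y hY; exact ⟨p, Or.inr (by simpa [Formula.leaves] using hY)⟩
  | tensor A B => exact hX.elim
  | par A B ihA ihB =>
    intro Y hY
    rcases List.mem_append.1 hY with h | h
    exacts [ihA hX.1 Y h, ihB hX.2 Y h]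

theorem seqInterp_leaves (ξ : N → Boundary) (X : Formula N) :
    seqInterp ξ X.leaves = X.interp ξ := by
  induction X with
  | pos p => simp [Formula.leaves, seqInterp]
  | neg p => simp [Formula.leaves, seqInterp]
  | tensor A B => simp [Formula.leaves, seqInterp]
  | par A B ihA ihB => rw [Formula.leaves, seqInterp_append, ihA, ihB, Formula.interp]

theorem seqInterp_flatMap_leaves (ξ : N → Boundary) (Γ : List (Formula N)) :
    seqInterp ξ (Γ.flatMap Formula.leaves) = seqInterp ξ Γ := by
  induction Γ with
  | nil => rfl
  | cons X Γ ih => rw [List.flatMap_cons, seqInterp_append, ih, seqInterp_leaves, seqInterp_cons]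

section Leaves

variable {ξ : N → Boundary} {L : Bool → N → Set (Set (Edge T))}

theorem place_par (o : ℕ) (A B : Formula N) (P : List (Placed N)) :
    ((A, (o + ·)) :: (B, fun i => (o + ·) ((A.interp ξ).length + i)) :: P) =
      (A, (o + ·)) :: (B, (o + (A.interp ξ).length + ·)) :: P := by
  simp only [add_assoc]

theorem PolarizedAt.par_left {A B : Formula N} {f : ℕ → ℕ} {σ : Set (Edge T)}
    (h : PolarizedAt ξ (A.par B, f) σ) : PolarizedAt ξ (A, f) σ := by
  intro e he i hi
  have h1 := h e he i (by
    simp only [dom, Formula.interp, List.length_append, Set.mem_Iio] at hi ⊢; omega)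
  rw [Formula.interp, List.getElem?_append_left hi] at h1
  exact h1

theorem PolarizedAt.par_right {A B : Formula N} {f : ℕ → ℕ} {σ : Set (Edge T)}
    (h : PolarizedAt ξ (A.par B, f) σ) :
    PolarizedAt ξ (B, fun i => f ((A.interp ξ).length + i)) σ := by
  intro e he i hi
  have h1 := h e he ((A.interp ξ).length + i) (by
    simp only [dom, Formula.interp, List.length_append, Set.mem_Iio] at hi ⊢; omega)
  rw [Formula.interp, List.getElem?_append_right (by simp)] at h1
  simpa using h1

/-- Both directions of the par rule hold in the model, so the pars of a formula may be dissolved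
into the commas of a sequent. -/
theorem realizes_leaves_iff (hL : ∀ b p, ∀ d ∈ L b p, Typed b (ξ p) d) {X : Formula N}
    {o : ℕ} {P : List (Placed N)} {σ : Set (Edge T)} (hσ : PolarizedAt ξ (X, (o + ·)) σ) :
    Realizes ξ (realizers ξ L) (place ξ o X.leaves ++ P) σ ↔
      Realizes ξ (realizers ξ L) ((X, (o + ·)) :: P) σ := by
  induction X generalizing o P with
  | pos p => exact Iff.rfl
  | neg p => exact Iff.rfl
  | tensor A B => exact Iff.rfl
  | par A B ihA ihB =>
    have hA := hσ.par_left
    have hB : PolarizedAt ξ (B, (o + (A.interp ξ).length + ·)) σ := by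
      simpa only [add_assoc] using hσ.par_right
    rw [Formula.leaves, place_append, seqInterp_leaves, List.append_assoc, ihA hA]
    have h1 : Realizes ξ (realizers ξ L) ((A, (o + ·)) ::
        (place ξ (o + (A.interp ξ).length) B.leaves ++ P)) σ ↔
        Realizes ξ (realizers ξ L) (place ξ (o + (A.interp ξ).length) B.leaves ++
          (A, (o + ·)) :: P) σ :=
      ⟨fun h => h.perm List.perm_middle.symm, fun h => h.perm List.perm_middle⟩
    rw [h1, ihB hB]
    constructor
    · intro h
      refine Realizes.par hL hσ ?_
      rw [place_par]
      exact h.perm (List.Perm.swap _ _ _)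
    · intro h
      have h2 := h.of_par hL
      rw [place_par] at h2
      exact h2.perm (List.Perm.swap _ _ _)

theorem realizes_flatMap_leaves_iff (hL : ∀ b p, ∀ d ∈ L b p, Typed b (ξ p) d)
    {Γ : List (Formula N)} {σ : Set (Edge T)} (hσ : Typed true (seqInterp ξ Γ) σ) :
    Realizes ξ (realizers ξ L) (place ξ 0 (Γ.flatMap Formula.leaves)) σ ↔
      Realizes ξ (realizers ξ L) (place ξ 0 Γ) σ := by
  have key : ∀ (o : ℕ) (Γ : List (Formula N)) (P : List (Placed N)),
      (∀ q ∈ place ξ o Γ, PolarizedAt ξ q σ) →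
      (Realizes ξ (realizers ξ L) (place ξ o (Γ.flatMap Formula.leaves) ++ P) σ ↔
        Realizes ξ (realizers ξ L) (place ξ o Γ ++ P) σ) := by
    intro o Γ
    induction Γ generalizing o with
    | nil => intro P _; exact Iff.rfl
    | cons X Γ ih =>
      intro P h
      rw [List.flatMap_cons, place_append, seqInterp_leaves, List.append_assoc,
        realizes_leaves_iff hL (h _ List.mem_cons_self)]
      have h1 : ∀ Q : List (Placed N), Realizes ξ (realizers ξ L) ((X, (o + ·)) :: (Q ++ P)) σ ↔
          Realizes ξ (realizers ξ L) (Q ++ (X, (o + ·)) :: P) σ := fun Q =>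
        ⟨fun h => h.perm List.perm_middle.symm, fun h => h.perm List.perm_middle⟩
      rw [h1, ih _ _ fun q hq => h q (List.mem_cons_of_mem _ hq), place, List.cons_append, h1]
  simpa using key 0 Γ [] fun q hq => hσ.polarizedAt hq

end Leaves

/-! ### Slots -/

/-- A placed literal, viewed as an embedding of the vertices of its atom. -/
structure Slot (N : Type v) where
  sign : Bool
  atom : N
  emb : ℕ → ℕ

/-- For `p^⊥` the reversal of the boundary is moved into the embedding and the duality into the
sign, so that both kinds of literals deal with edge sets over `ξ p`. On formulas other than literals
the value is a default. -/
def toSlot (ξ : N → Boundary) : Placed N → Slot N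
  | (.neg p, f) => ⟨false, p, fun i => f (rev (ξ p).length i)⟩
  | (X, f) => ⟨true, X.atom, f⟩

/-- The positions of a slot. -/
def Slot.dom (ξ : N → Boundary) (s : Slot N) : Set ℕ := Set.Iio (ξ s.atom).length

section ToSlot

variable {ξ : N → Boundary} {L : Bool → N → Set (Set (Edge T))}

theorem mem_realizers_toSlot (hL : ∀ b p, ∀ d ∈ L b p, Typed b (ξ p) d) {q : Placed N}
    (hq : q.1.IsLiteral) {E : Set (Edge T)} :
    pull q.2 (dom ξ q) E ∈ realizers ξ L q.1 true ↔
      pull (toSlot ξ q).emb ((toSlot ξ q).dom ξ) E ∈ L (toSlot ξ q).sign (toSlot ξ q).atom := by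
  obtain ⟨X, f⟩ := q
  obtain ⟨p, rfl | rfl⟩ := hq
  · exact Iff.rfl
  · have hdom : dom ξ ((.neg p, f) : Placed N) = Set.Iio (ξ p).length := by
      simp [dom, Formula.interp, Boundary.length_dual]
    have h1 : pull (fun i => f (rev (ξ p).length i)) (Set.Iio (ξ p).length) E =
        push (rev (ξ p).length) (pull f (Set.Iio (ξ p).length) E) := by
      ext ⟨i, w, j⟩
      simp only [mem_pull, mem_push, Set.mem_Iio]
      constructor
      · rintro ⟨hi, hj, h⟩
        exact ⟨_, _, ⟨rev_lt hi, rev_lt hj, h⟩, rev_rev hi, rev_rev hj⟩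
      · rintro ⟨i, j, ⟨hi, hj, h⟩, rfl, rfl⟩
        refine ⟨rev_lt hi, rev_lt hj, ?_⟩
        rwa [rev_rev hi, rev_rev hj]
    simp only [hdom, toSlot, Slot.dom, h1]
    constructor
    · rintro ⟨d, hd, he⟩
      have he' : push (rev (ξ p).length) d = pull f (Set.Iio (ξ p).length) E := he
      rw [← he', push_rev_push_rev (hL _ _ d hd).suppIn]
      exact hd
    · intro h
      exact ⟨_, h, push_rev_push_rev (suppIn_pull _ _ _)⟩

theorem exists_test_toSlot {q : Placed N} (hq : q.1.IsLiteral) {E : Set (Edge T)} :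
    (∃ t ∈ realizers ξ L q.1 false, E = push q.2 t) ↔
      ∃ t ∈ L (!(toSlot ξ q).sign) (toSlot ξ q).atom, E = push (toSlot ξ q).emb t := by
  obtain ⟨X, f⟩ := q
  obtain ⟨p, rfl | rfl⟩ := hq
  · exact Iff.rfl
  · constructor
    · rintro ⟨_, ⟨d, hd, rfl⟩, rfl⟩
      exact ⟨d, hd, push_push _ _ _⟩
    · rintro ⟨d, hd, rfl⟩
      refine ⟨push (rev (ξ p).length) d, ⟨d, hd, rfl⟩, ?_⟩
      rw [push_push]
      rfl

theorem mem_tests_ofFn {F : Formula N → Bool → Set (Set (Edge T))} {n : ℕ} {P : Fin n → Placed N}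
    {B : Set (Edge T)} : B ∈ tests F (List.ofFn P) ↔ ∃ t : Fin n → Set (Edge T),
      (∀ j, t j ∈ F (P j).1 false) ∧ B = ⋃ j, push (P j).2 (t j) := by
  induction n generalizing B with
  | zero =>
    simp only [List.ofFn_zero, tests, Set.mem_singleton_iff]
    constructor
    · rintro rfl
      exact ⟨fun _ => ∅, fun j => j.elim0, by simp⟩
    · rintro ⟨t, -, rfl⟩
      simp
  | succ n ih =>
    have hU : ∀ t : Fin (n + 1) → Set (Edge T),
        (⋃ j, push (P j).2 (t j)) = push (P 0).2 (t 0) ∪ ⋃ j : Fin n, push (P j.succ).2 (t j.succ) := by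
      intro t
      ext e
      simp only [Set.mem_iUnion, Set.mem_union]
      exact Fin.exists_fin_succ
    rw [List.ofFn_succ, mem_tests_cons]
    constructor
    · rintro ⟨t₀, h0, B, hB, rfl⟩
      obtain ⟨t, ht, rfl⟩ := ih.1 hB
      exact ⟨Fin.cons t₀ t, Fin.cases h0 ht, (hU (Fin.cons t₀ t)).symm⟩
    · rintro ⟨t, ht, rfl⟩
      exact ⟨t 0, ht 0, _, ih.2 ⟨fun j => t j.succ, fun j => ht j.succ, rfl⟩, hU t⟩

theorem mem_tests_iff {F : Formula N → Bool → Set (Set (Edge T))} {P : List (Placed N)}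
    {B : Set (Edge T)} : B ∈ tests F P ↔ ∃ t : Fin P.length → Set (Edge T),
      (∀ j, t j ∈ F (P.get j).1 false) ∧ B = ⋃ j, push (P.get j).2 (t j) := by
  conv_lhs => rw [← List.ofFn_get P]
  exact mem_tests_ofFn

theorem mem_tests_toSlot {P : List (Placed N)} (hP : ∀ q ∈ P, q.1.IsLiteral) {B : Set (Edge T)} :
    B ∈ tests (realizers ξ L) P ↔ ∃ t : Fin P.length → Set (Edge T),
      (∀ j, t j ∈ L (!(toSlot ξ (P.get j)).sign) (toSlot ξ (P.get j)).atom) ∧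
        B = ⋃ j, push (toSlot ξ (P.get j)).emb (t j) := by
  have key := fun (j : Fin P.length) (E : Set (Edge T)) =>
    exists_test_toSlot (ξ := ξ) (L := L) (hP _ (P.get_mem j)) (E := E)
  rw [mem_tests_iff]
  constructor
  · rintro ⟨t, ht, rfl⟩
    choose t' ht' he using fun j => (key j _).1 ⟨t j, ht j, rfl⟩
    exact ⟨t', ht', Set.iUnion_congr he⟩
  · rintro ⟨t, ht, rfl⟩
    choose t' ht' he using fun j => (key j _).2 ⟨t j, ht j, rfl⟩
    exact ⟨t', ht', Set.iUnion_congr he⟩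

/-- For literals, realizability is a closure condition: members plugged into all slots but one
produce a member at the remaining slot. This is the shape of a production. -/
theorem realizes_iff_toSlot (hL : ∀ b p, ∀ d ∈ L b p, Typed b (ξ p) d) {P : List (Placed N)}
    (hP : ∀ q ∈ P, q.1.IsLiteral) {σ : Set (Edge T)} :
    Realizes ξ (realizers ξ L) P σ ↔ ∀ q l, P.Perm (q :: l) → ∀ t : Fin l.length → Set (Edge T),
      (∀ j, t j ∈ L (!(toSlot ξ (l.get j)).sign) (toSlot ξ (l.get j)).atom) →
      ¬ Cyc σ (⋃ j, push (toSlot ξ (l.get j)).emb (t j)) →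
      pull (toSlot ξ q).emb ((toSlot ξ q).dom ξ)
        (paths σ (⋃ j, push (toSlot ξ (l.get j)).emb (t j))) ∈
          L (toSlot ξ q).sign (toSlot ξ q).atom := by
  refine forall_congr' fun q => forall_congr' fun l => forall_congr' fun hp => ?_
  have hq := hP q (hp.mem_iff.2 List.mem_cons_self)
  have hl : ∀ r ∈ l, r.1.IsLiteral := fun r hr => hP r (hp.mem_iff.2 (List.mem_cons_of_mem _ hr))
  constructor
  · intro h t ht hcyc
    exact (mem_realizers_toSlot hL hq).1 (h _ ((mem_tests_toSlot hl).2 ⟨t, ht, rfl⟩) hcyc)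
  · intro h B hB hcyc
    obtain ⟨t, ht, rfl⟩ := (mem_tests_toSlot hl).1 hB
    exact (mem_realizers_toSlot hL hq).2 (h t ht hcyc)

end ToSlot

/-! ### Positions -/

open Classical in
/-- The vertices of a boundary of polarity `pol b`. -/
noncomputable def Boundary.positions (b : Bool) (X : Boundary) : List ℕ :=
  (List.range X.length).filter fun i => X[i]? = some (pol b)

theorem Boundary.mem_positions {b : Bool} {X : Boundary} {i : ℕ} :
    i ∈ X.positions b ↔ X[i]? = some (pol b) := by
  simp only [Boundary.positions, List.mem_filter, List.mem_range, decide_eq_true_eq]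
  exact ⟨fun h => h.2, fun h => ⟨Boundary.lt_of_getElem? h, h⟩⟩

theorem Boundary.nodup_positions (b : Bool) (X : Boundary) : (X.positions b).Nodup :=
  List.nodup_range.filter _

theorem Boundary.positions_append (b : Bool) (X Y : Boundary) :
    (X ++ Y).positions b = X.positions b ++ (Y.positions b).map (X.length + ·) := by
  rw [Boundary.positions, List.length_append, List.range_add, List.filter_append, List.filter_map]
  congr 1
  · refine List.filter_congr fun i hi => ?_
    rw [List.getElem?_append_left (List.mem_range.1 hi)]
  · rw [Boundary.positions]
    congr 1
    refine List.filter_congr fun i _ => ?_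
    simp [List.getElem?_append_right (Nat.le_add_right X.length i)]

theorem Boundary.positions_dual (b : Bool) (X : Boundary) :
    ((X.positions !b).map (rev X.length)).Perm (X.dual.positions b) := by
  have hlt : ∀ {i}, i ∈ X.positions (!b) → i < X.length := fun h =>
    Boundary.lt_of_getElem? (Boundary.mem_positions.1 h)
  refine (List.perm_ext_iff_of_nodup ?_ (Boundary.nodup_positions _ _)).2 fun i => ?_
  · exact (Boundary.nodup_positions _ _).map_on fun i hi j hj h =>
      rev_injOn _ (hlt hi) (hlt hj) h
  · rw [List.mem_map, Boundary.mem_positions]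
    constructor
    · rintro ⟨j, hj, rfl⟩
      rw [Boundary.getElem?_dual _ (rev_lt (hlt hj)), rev_rev (hlt hj), Boundary.mem_positions.1 hj,
        Option.map_some, pol_flip, Bool.not_not]
    · intro h
      have hi : i < X.length := by
        have := Boundary.lt_of_getElem? h
        rwa [Boundary.length_dual] at this
      refine ⟨rev X.length i, Boundary.mem_positions.2 ?_, rev_rev hi⟩
      rw [Boundary.getElem?_dual _ hi] at h
      obtain ⟨p, h1, h2⟩ := Option.map_eq_some_iff.1 h
      rw [h1, pol_not, ← h2, Polarity.flip_flip]

/-- The vertices of a slot of polarity `pol b`, as vertices of the surrounding boundary. -/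
noncomputable def Slot.vertices (ξ : N → Boundary) (b : Bool) (s : Slot N) : List ℕ :=
  ((ξ s.atom).positions (s.sign == b)).map s.emb

theorem vertices_toSlot {ξ : N → Boundary} (b : Bool) {X : Formula N} (hX : X.IsLiteral)
    (f : ℕ → ℕ) :
    ((toSlot ξ (X, f)).vertices ξ b).Perm (((X.interp ξ).positions b).map f) := by
  obtain ⟨p, rfl | rfl⟩ := hX
  · cases b <;> exact List.Perm.refl _
  · have h := (Boundary.positions_dual b (ξ p)).map f
    rw [List.map_map] at h
    cases b <;> exact h

theorem flatMap_vertices {ξ : N → Boundary} (b : Bool) (o : ℕ) {Δ : List (Formula N)}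
    (hΔ : ∀ X ∈ Δ, X.IsLiteral) :
    ((place ξ o Δ).flatMap fun q => (toSlot ξ q).vertices ξ b).Perm
      (((seqInterp ξ Δ).positions b).map (o + ·)) := by
  induction Δ generalizing o with
  | nil => exact List.Perm.refl _
  | cons X Δ ih =>
    rw [place, List.flatMap_cons, seqInterp_cons, Boundary.positions_append, List.map_append]
    refine (vertices_toSlot b (hΔ X List.mem_cons_self) _).append ?_
    have h := ih (o + (X.interp ξ).length) fun Y hY => hΔ Y (List.mem_cons_of_mem _ hY)
    rw [List.map_map]
    simpa only [Function.comp_def, add_assoc] using h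

theorem place_isLiteral {ξ : N → Boundary} {o : ℕ} {Δ : List (Formula N)}
    (hΔ : ∀ X ∈ Δ, X.IsLiteral) : ∀ q ∈ place ξ o Δ, q.1.IsLiteral := by
  induction Δ generalizing o with
  | nil => intro q hq; simp [place] at hq
  | cons X Δ ih =>
    intro q hq
    rcases List.mem_cons.1 hq with rfl | hq
    · exact hΔ X List.mem_cons_self
    · exact ih (fun Y hY => hΔ Y (List.mem_cons_of_mem _ hY)) q hq

/-- The edges of a multiword, as a list. -/
theorem Multiword.HasBoundary.exists_list {M : Multiword T} {X : Boundary} (h : M.HasBoundary X) :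
    ∃ E : List (Edge T), (∀ e, e ∈ E ↔ e ∈ M.edges) ∧ (E.map Edge.src).Perm (X.positions true) ∧
      (E.map Edge.tgt).Perm (X.positions false) := by
  have hu : ∀ e ∈ M.edges, ∀ e' ∈ M.edges, ∀ i, (e.src = i ∨ e.tgt = i) →
      (e'.src = i ∨ e'.tgt = i) → e = e' := by
    intro e he e' he' i h1 h2
    have hi : i < X.length := by
      rcases h1 with rfl | rfl
      exacts [Boundary.lt_of_getElem? (h.polarity e he).1,
        Boundary.lt_of_getElem? (h.polarity e he).2]
    exact (h.matching i hi).unique ⟨he, h1⟩ ⟨he', h2⟩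
  have hfin : M.edges.Finite := by
    refine Set.Finite.of_finite_image (f := Edge.src) ((Set.finite_Iio X.length).subset ?_) ?_
    · rintro _ ⟨e, he, rfl⟩
      exact Boundary.lt_of_getElem? (h.polarity e he).1
    · exact fun e he e' he' hs => hu e he e' he' _ (Or.inl rfl) (Or.inl hs.symm)
  refine ⟨hfin.toFinset.toList, fun e => by simp, ?_, ?_⟩
  · refine (List.perm_ext_iff_of_nodup ?_ (Boundary.nodup_positions _ _)).2 fun i => ?_
    · refine (Finset.nodup_toList _).map_on fun e he e' he' hs => ?_
      simp only [Finset.mem_toList, Set.Finite.mem_toFinset] at he he'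
      exact hu e he e' he' _ (Or.inl rfl) (Or.inl hs.symm)
    · simp only [List.mem_map, Finset.mem_toList, Set.Finite.mem_toFinset, Boundary.mem_positions]
      constructor
      · rintro ⟨e, he, rfl⟩
        exact (h.polarity e he).1
      · intro hi
        obtain ⟨e, ⟨he, h1 | h1⟩, -⟩ := h.matching i (Boundary.lt_of_getElem? hi)
        · exact ⟨e, he, h1⟩
        · have := (h.polarity e he).2
          rw [h1, hi] at this
          simp [pol] at this
  · refine (List.perm_ext_iff_of_nodup ?_ (Boundary.nodup_positions _ _)).2 fun i => ?_
    · refine (Finset.nodup_toList _).map_on fun e he e' he' hs => ?_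
      simp only [Finset.mem_toList, Set.Finite.mem_toFinset] at he he'
      exact hu e he e' he' _ (Or.inr rfl) (Or.inr hs.symm)
    · simp only [List.mem_map, Finset.mem_toList, Set.Finite.mem_toFinset, Boundary.mem_positions]
      constructor
      · rintro ⟨e, he, rfl⟩
        exact (h.polarity e he).2
      · intro hi
        obtain ⟨e, ⟨he, h1 | h1⟩, -⟩ := h.matching i (Boundary.lt_of_getElem? hi)
        · have := (h.polarity e he).1
          rw [h1, hi] at this
          simp [pol] at this
        · exact ⟨e, he, h1⟩

/-- An edge list that covers the vertices of a boundary. -/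
theorem Multiword.hasBoundary_of_list {X : Boundary} {E : List (Edge T)}
    (hs : (E.map Edge.src).Perm (X.positions true)) (ht : (E.map Edge.tgt).Perm (X.positions false)) :
    Multiword.HasBoundary ⟨{e | e ∈ E}, 0⟩ X := by
  have h1 : ∀ e ∈ E, X[e.src]? = some .left := fun e he =>
    Boundary.mem_positions.1 (hs.mem_iff.1 (List.mem_map_of_mem he))
  have h2 : ∀ e ∈ E, X[e.tgt]? = some .right := fun e he =>
    Boundary.mem_positions.1 (ht.mem_iff.1 (List.mem_map_of_mem he))
  refine ⟨fun e he => ⟨h1 e he, h2 e he⟩, fun i hi => ?_⟩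
  rcases exists_pol X[i] true with h | h
  · have hi' : X[i]? = some .left := by rw [List.getElem?_eq_getElem hi, h]; rfl
    obtain ⟨e, he, rfl⟩ := List.mem_map.1 (hs.mem_iff.2 (Boundary.mem_positions.2 hi'))
    refine ⟨e, ⟨he, Or.inl rfl⟩, ?_⟩
    rintro e' ⟨he', h3 | h3⟩
    · exact List.inj_on_of_nodup_map (hs.nodup_iff.2 (Boundary.nodup_positions _ _)) he' he h3
    · have := h2 e' he'
      rw [h3, hi'] at this
      simp at this
  · have hi' : X[i]? = some .right := by rw [List.getElem?_eq_getElem hi, h]; rfl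
    obtain ⟨e, he, rfl⟩ := List.mem_map.1 (ht.mem_iff.2 (Boundary.mem_positions.2 hi'))
    refine ⟨e, ⟨he, Or.inr rfl⟩, ?_⟩
    rintro e' ⟨he', h3 | h3⟩
    · have := h1 e' he'
      rw [h3, hi'] at this
      simp at this
    · exact List.inj_on_of_nodup_map (ht.nodup_iff.2 (Boundary.nodup_positions _ _)) he' he h3

/-! ### Deterministic paths -/

/-- Edges are determined by their sources. -/
def Functional (E : Set (Edge T)) : Prop :=
  ∀ e ∈ E, ∀ e' ∈ E, e.src = e'.src → e = e'

theorem Functional.eq {E : Set (Edge T)} (h : Functional E) {a b b' : ℕ} {w w' : List T}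
    (h1 : (⟨a, w, b⟩ : Edge T) ∈ E) (h2 : (⟨a, w', b'⟩ : Edge T) ∈ E) : w = w' ∧ b = b' := by
  have := h _ h1 _ h2 rfl
  simpa using this

theorem functional_of_nodup {E : List (Edge T)} (h : (E.map Edge.src).Nodup) :
    Functional {e | e ∈ E} :=
  fun _ he _ he' hs => List.inj_on_of_nodup_map h he he' hs

/-- Each step of the path is determined by the preceding one, and neither end admits a continuation
in `B`; so both paths stop at the same place. -/
theorem Path.unique {A B : Set (Edge T)} (hA : Functional A) (hB : Functional B) {a b b' : ℕ}
    {w w' : List T} (h : Path A B a w b) (h' : Path A B a w' b')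
    (hb : ∀ v y, (⟨b, v, y⟩ : Edge T) ∉ B) (hb' : ∀ v y, (⟨b', v, y⟩ : Edge T) ∉ B) :
    w = w' ∧ b = b' := by
  induction h generalizing w' with
  | single h1 =>
    cases h' with
    | single h2 => exact hA.eq h1 h2
    | step h2 h3 _ =>
      obtain ⟨-, rfl⟩ := hA.eq h1 h2
      exact (hb _ _ h3).elim
  | step h1 h2 _ ih =>
    cases h' with
    | single h3 =>
      obtain ⟨-, rfl⟩ := hA.eq h1 h3
      exact (hb' _ _ h2).elim
    | step h3 h4 h5 =>
      obtain ⟨rfl, rfl⟩ := hA.eq h1 h3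
      obtain ⟨rfl, rfl⟩ := hB.eq h2 h4
      obtain ⟨rfl, rfl⟩ := ih h5 hb
      exact ⟨rfl, rfl⟩

/-- A deterministic walk that enters a cycle never leaves it, whereas the walk from `a` arrives at a
vertex without continuation. -/
theorem Path.not_cyc {A B : Set (Edge T)} (hA : Functional A) (hB : Functional B) {a b : ℕ}
    {w : List T} (h : Path A B a w b) (hb : ∀ v y, (⟨b, v, y⟩ : Edge T) ∉ B) {u v : List T} {x : ℕ}
    (h' : Path A B a u x) : (⟨x, v, a⟩ : Edge T) ∉ B := by
  induction h generalizing u v x with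
  | single h1 =>
    intro hx
    cases h' with
    | single h2 =>
      obtain ⟨-, rfl⟩ := hA.eq h1 h2
      exact hb _ _ hx
    | step h2 h3 _ =>
      obtain ⟨-, rfl⟩ := hA.eq h1 h2
      exact hb _ _ h3
  | step h1 h2 h3 ih =>
    intro hx
    cases h' with
    | single h4 =>
      obtain ⟨rfl, rfl⟩ := hA.eq h1 h4
      obtain ⟨rfl, rfl⟩ := hB.eq h2 hx
      exact ih hb (.single h1) hx
    | step h4 h5 h6 =>
      obtain ⟨rfl, rfl⟩ := hA.eq h1 h4
      obtain ⟨rfl, rfl⟩ := hB.eq h2 h5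
      exact ih hb (h6.trans hx (.single h1)) h2

/-! ### Walks through words with variables -/

section Walk

variable {V : Type} (inV outV : V → ℕ) (z : ℕ)

/-- The edges that spell a word `s` and visit its variables `x` by entering `inV x` and leaving
`outV x`. -/
def walk : ℕ → List T → List (T ⊕ V) → List (Edge T)
  | y, acc, [] => [⟨y, acc, z⟩]
  | y, acc, .inl a :: s => walk y (acc ++ [a]) s
  | y, acc, .inr x :: s => ⟨y, acc, inV x⟩ :: walk (outV x) [] s

def vars : List (T ⊕ V) → List V
  | [] => []
  | .inl _ :: s => vars s
  | .inr x :: s => x :: vars s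

theorem count_vars [BEq T] [BEq V] (s : List (T ⊕ V)) (x : V) :
    (vars s).count x = s.count (.inr x) := by
  induction s with
  | nil => rfl
  | cons c s ih =>
    cases c with
    | inl a =>
      have h : ((.inl a : T ⊕ V) == .inr x) = false := rfl
      rw [vars, ih, List.count_cons, h]
      rfl
    | inr y =>
      have h : ((.inr y : T ⊕ V) == .inr x) = (y == x) := rfl
      rw [vars, List.count_cons, List.count_cons, ih, h]

theorem map_src_walk (y : ℕ) (acc : List T) (s : List (T ⊕ V)) :
    (walk inV outV z y acc s).map Edge.src = y :: (vars s).map outV := by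
  induction s generalizing y acc with
  | nil => rfl
  | cons c s ih => cases c <;> simp [walk, vars, ih]

theorem map_tgt_walk (y : ℕ) (acc : List T) (s : List (T ⊕ V)) :
    (walk inV outV z y acc s).map Edge.tgt = (vars s).map inV ++ [z] := by
  induction s generalizing y acc with
  | nil => rfl
  | cons c s ih => cases c <;> simp [walk, vars, ih]

variable {inV outV z}

/-- Each plugged edge from `inV x` to `outV x` inserts the word `t x` between two pieces of the
walk. The second conjunct says that every edge of the walk leads on to `z`, which excludes cycles by
`Path.not_cyc`. -/
theorem path_walk {A B : Set (Edge T)} {t : V → List T} {y : ℕ} {acc : List T} {s : List (T ⊕ V)}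
    (hA : ∀ e ∈ walk inV outV z y acc s, e ∈ A) (hB : ∀ x, (⟨inV x, t x, outV x⟩ : Edge T) ∈ B) :
    Path A B y (acc ++ substitute t s) z ∧
      ∀ e ∈ walk inV outV z y acc s, ∃ w, Path A B e.src w z := by
  induction s generalizing y acc with
  | nil =>
    have h : Path A B y (acc ++ substitute t []) z :=
      .single (by simpa [substitute] using hA _ List.mem_cons_self)
    refine ⟨h, fun e he => ?_⟩
    obtain rfl : e = ⟨y, acc, z⟩ := by simpa [walk] using he
    exact ⟨_, h⟩
  | cons c s ih =>
    cases c with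
    | inl a =>
      obtain ⟨h1, h2⟩ := ih hA
      refine ⟨?_, h2⟩
      simpa [substitute] using h1
    | inr x =>
      obtain ⟨h1, h2⟩ := ih fun e he => hA e (List.mem_cons_of_mem _ he)
      have h := Path.step (hA _ List.mem_cons_self) (hB x) h1
      refine ⟨by simpa [substitute] using h, fun e he => ?_⟩
      rcases List.mem_cons.1 he with rfl | he
      exacts [⟨_, h⟩, h2 e he]

end Walk

/-! ### From multiple context-free grammars to linear logic grammars -/

/-- The boundary of `k` edges, each from a left endpoint to the right endpoint that follows it. -/
def alternating (k : ℕ) : Boundary :=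
  (List.range (2 * k)).map fun i => if i % 2 = 0 then .left else .right

theorem length_alternating (k : ℕ) : (alternating k).length = 2 * k := by simp [alternating]

theorem getElem?_alternating {k i : ℕ} {b : Bool} :
    (alternating k)[i]? = some (pol b) ↔ ∃ m : Fin k, i = 2 * m + (if b then 0 else 1) := by
  have h : (alternating k)[i]? = some (pol b) ↔
      i < 2 * k ∧ (if i % 2 = 0 then Polarity.left else .right) = pol b := by
    by_cases hi : i < 2 * k
    · simp [alternating, hi]
    · simp [alternating, hi]
  rw [h]
  constructor
  · rintro ⟨h1, h2⟩
    refine ⟨⟨i / 2, by omega⟩, ?_⟩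
    cases b <;> simp only [pol] at h2 ⊢ <;> split_ifs at h2 <;> simp at * <;> omega
  · rintro ⟨m, rfl⟩
    have := m.2
    cases b
    · exact ⟨by simp; omega, by simp [pol]⟩
    · exact ⟨by simp, by simp [pol]⟩

theorem positions_alternating (k : ℕ) (b : Bool) :
    ((List.finRange k).map fun m : Fin k => 2 * (m : ℕ) + (if b then 0 else 1)).Perm
      ((alternating k).positions b) := by
  refine (List.perm_ext_iff_of_nodup ?_ (Boundary.nodup_positions _ _)).2 fun i => ?_
  · exact (List.nodup_finRange k).map fun m m' h => by simp at h; omega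
  · rw [Boundary.mem_positions, getElem?_alternating]
    simp [eq_comm]

/-- The edges that hold the components of a tuple of words. -/
def tupleEdges {k : ℕ} (t : Fin k → List T) : Set (Edge T) :=
  {e | ∃ m : Fin k, e = ⟨2 * m, t m, 2 * m + 1⟩}

theorem mem_tupleEdges {k : ℕ} {t : Fin k → List T} {a b : ℕ} {w : List T} :
    (⟨a, w, b⟩ : Edge T) ∈ tupleEdges t ↔ ∃ m : Fin k, a = 2 * m ∧ w = t m ∧ b = 2 * m + 1 := by
  simp [tupleEdges]

theorem typed_tupleEdges {k : ℕ} (t : Fin k → List T) :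
    Typed true (alternating k) (tupleEdges t) := by
  rintro _ ⟨m, rfl⟩
  exact ⟨getElem?_alternating.2 ⟨m, rfl⟩, getElem?_alternating.2 ⟨m, rfl⟩⟩

theorem exists_offset (ξ : N → Boundary) {n : ℕ} (F : Fin n → Formula N) (o : ℕ) :
    ∃ f : Fin n → ℕ, place ξ o (List.ofFn F) = List.ofFn fun j => (F j, (f j + ·)) := by
  induction n generalizing o with
  | zero => exact ⟨fun _ => 0, by simp [place]⟩
  | succ n ih =>
    obtain ⟨f, hf⟩ := ih (fun j => F j.succ) (o + ((F 0).interp ξ).length)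
    exact ⟨Fin.cons o f, by simp [place, List.ofFn_succ, hf]⟩

/-! ### Axioms from productions -/

namespace Production

variable {M : Type} {arity : M → ℕ}

/-- The interpretation of predicate symbols. -/
def predBoundary (arity : M → ℕ) (A : ULift.{v} M) : Boundary := alternating (arity A.down)

variable (p : Production T M arity)

def bodySeq : List (Formula (ULift.{v} M)) := List.ofFn fun j => .neg ⟨p.body j⟩

/-- The sequent of a production. -/
def sequent : List (Formula (ULift.{v} M)) := bodySeq.{u, v} p ++ [.pos ⟨p.head⟩]

noncomputable def offset : Fin p.n → ℕ :=
  (exists_offset.{v} (predBoundary arity) (fun j => .neg ⟨p.body j⟩) 0).choose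

theorem place_bodySeq : place (predBoundary arity) 0 (bodySeq.{u, v} p) =
    List.ofFn fun j => (.neg ⟨p.body j⟩, (offset.{u, v} p j + ·)) :=
  (exists_offset.{v} (predBoundary arity) (fun j => .neg ⟨p.body j⟩) 0).choose_spec

/-- The first vertex of the head. -/
def base : ℕ := (seqInterp (predBoundary arity) (bodySeq.{u, v} p)).length

/-- Body literals are negative, so the boundary of the predicate occurs in reversed order. -/
noncomputable def bodyVertex (j : Fin p.n) (a : ℕ) : ℕ :=
  offset.{u, v} p j + rev (2 * arity (p.body j)) a

/-- The plugged edge of component `m` runs from the even vertex `2 * m` to the odd vertex `2 * m +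
1` of the predicate; the wires arrive at the former and resume at the latter. -/
noncomputable def enter (x : (j : Fin p.n) × Fin (arity (p.body j))) : ℕ :=
  bodyVertex.{u, v} p x.1 (2 * x.2)

noncomputable def leave (x : (j : Fin p.n) × Fin (arity (p.body j))) : ℕ :=
  bodyVertex.{u, v} p x.1 (2 * x.2 + 1)

/-- The edges of the multiword of a production. -/
noncomputable def wires : List (Edge T) :=
  (List.finRange (arity p.head)).flatMap fun m : Fin (arity p.head) =>
    walk (enter.{u, v} p) (leave.{u, v} p) (base.{u, v} p + (2 * m + 1))
      (base.{u, v} p + 2 * m) [] (p.args m)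

noncomputable def allVars : List ((j : Fin p.n) × Fin (arity (p.body j))) :=
  (List.finRange p.n).flatMap fun j => (List.finRange (arity (p.body j))).map (Sigma.mk j)

/-- This is the linearity of the production, in the form that makes the wires meet each body vertex
exactly once. -/
theorem vars_perm : ((List.finRange (arity p.head)).flatMap fun m => vars (p.args m)).Perm
    p.allVars := by
  classical
  have h1 : ∀ x, ((List.finRange (arity p.head)).flatMap fun m => vars (p.args m)).count x = 1 := by
    intro x
    rw [List.count_flatMap, ← p.linear x, ← List.sum_ofFn, List.ofFn_eq_map]
    congr 1
    refine List.map_congr_left fun m _ => ?_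
    rw [Function.comp_apply, count_vars]
  have h2 : p.allVars.Nodup := by
    rw [allVars, List.nodup_flatMap]
    refine ⟨fun j _ => (List.nodup_finRange _).map sigma_mk_injective, ?_⟩
    refine (List.nodup_finRange _).imp fun {j j'} hj => ?_
    rw [Function.onFun, List.disjoint_left]
    intro x hx hx'
    obtain ⟨_, _, rfl⟩ := List.mem_map.1 hx
    obtain ⟨_, _, h⟩ := List.mem_map.1 hx'
    exact hj (congrArg Sigma.fst h).symm
  refine (List.perm_ext_iff_of_nodup ?_ h2).2 fun x => ?_
  · exact List.nodup_iff_count_le_one.2 fun x => (h1 x).le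
  · refine iff_of_true (List.count_pos_iff.1 (by rw [h1]; exact one_pos)) ?_
    exact List.mem_flatMap.2 ⟨x.1, List.mem_finRange _, List.mem_map.2 ⟨x.2, List.mem_finRange _, rfl⟩⟩

theorem positions_sequent (b : Bool) : ((p.allVars.map (if b then leave.{u, v} p else enter.{u, v} p)) ++
    (List.finRange (arity p.head)).map fun m : Fin _ =>
      base.{u, v} p + (2 * (m : ℕ) + if b then 0 else 1)).Perm
    ((seqInterp (predBoundary arity) (sequent.{u, v} p)).positions b) := by
  have hlit : ∀ X ∈ bodySeq.{u, v} p, X.IsLiteral := by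
    intro X hX
    obtain ⟨j, rfl⟩ := List.mem_ofFn.1 hX
    exact ⟨_, Or.inr rfl⟩
  rw [sequent, seqInterp_append, seqInterp_singleton, Boundary.positions_append]
  refine List.Perm.append ?_ ?_
  · have h := flatMap_vertices (ξ := predBoundary arity) b 0 hlit
    simp only [zero_add, List.map_id'] at h
    refine List.Perm.trans ?_ h
    rw [place_bodySeq, List.ofFn_eq_map, List.flatMap_map, allVars, List.map_flatMap]
    refine List.Perm.flatMap_left _ fun j _ => ?_
    have h1 := (positions_alternating (arity (p.body j)) (!b)).map (bodyVertex.{u, v} p j)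
    rw [List.map_map] at h1 ⊢
    have h2 : (toSlot (predBoundary arity)
        ((.neg ⟨p.body j⟩, (offset.{u, v} p j + ·)) : Placed (ULift.{v} M))).vertices
          (predBoundary arity) b =
        ((alternating (arity (p.body j))).positions (!b)).map (bodyVertex.{u, v} p j) := by
      simp only [Slot.vertices, toSlot, predBoundary, length_alternating]
      cases b <;> rfl
    rw [h2]
    cases b <;> exact h1
  · have h1 := (positions_alternating (arity p.head) b).map (base.{u, v} p + ·)
    rw [List.map_map] at h1
    exact h1

theorem src_wires : ((wires.{u, v} p).map Edge.src).Perm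
    ((seqInterp (predBoundary arity) (sequent.{u, v} p)).positions true) := by
  have h := positions_sequent.{u, v} p true
  simp only [if_true, add_zero] at h
  refine List.Perm.trans ?_ h
  rw [wires, List.map_flatMap]
  simp only [map_src_walk]
  refine List.Perm.trans ?_ ((p.vars_perm.map _).append_right _)
  rw [List.map_flatMap]
  refine List.Perm.trans ?_ List.perm_append_comm
  rw [List.map_eq_flatMap]
  exact (List.flatMap_append_perm _ (fun m : Fin _ => [base.{u, v} p + 2 * (m : ℕ)]) _).symm

theorem tgt_wires : ((wires.{u, v} p).map Edge.tgt).Perm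
    ((seqInterp (predBoundary arity) (sequent.{u, v} p)).positions false) := by
  have h := positions_sequent.{u, v} p false
  simp only [Bool.false_eq_true, if_false] at h
  refine List.Perm.trans ?_ h
  rw [wires, List.map_flatMap]
  simp only [map_tgt_walk]
  refine List.Perm.trans ?_ ((p.vars_perm.map _).append_right _)
  rw [List.map_flatMap, List.map_eq_flatMap (l := List.finRange _)]
  exact (List.flatMap_append_perm _ _ _).symm

/-- The tests that plug tuples of words into the body of a production. -/
noncomputable def bodyTests (t : (j : Fin p.n) → Fin (arity (p.body j)) → List T) : Set (Edge T) :=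
  ⋃ j, push (bodyVertex.{u, v} p j) (tupleEdges (t j))

theorem mem_bodyTests {t : (j : Fin p.n) → Fin (arity (p.body j)) → List T} {a b : ℕ} {w : List T} :
    (⟨a, w, b⟩ : Edge T) ∈ bodyTests.{u, v} p t ↔
      ∃ x, a = enter.{u, v} p x ∧ w = t x.1 x.2 ∧ b = leave.{u, v} p x := by
  simp only [bodyTests, Set.mem_iUnion, mem_push, mem_tupleEdges]
  constructor
  · rintro ⟨j, _, _, ⟨m, rfl, rfl, rfl⟩, rfl, rfl⟩
    exact ⟨⟨j, m⟩, rfl, rfl, rfl⟩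
  · rintro ⟨⟨j, m⟩, rfl, rfl, rfl⟩
    exact ⟨j, _, _, ⟨m, rfl, rfl, rfl⟩, rfl, rfl⟩

/-- The wires of each argument form a walk that spells the substituted word. All edges belong to
such walks and the edge sets are deterministic, so there are no other paths between head vertices
and no cycles. -/
theorem wires_spec (t : (j : Fin p.n) → Fin (arity (p.body j)) → List T) :
    ¬ Cyc {e | e ∈ wires.{u, v} p} (bodyTests.{u, v} p t) ∧
    pull (base.{u, v} p + ·) (Set.Iio (2 * arity p.head))
      (paths {e | e ∈ wires.{u, v} p} (bodyTests.{u, v} p t)) =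
        tupleEdges fun m => substitute (fun x => t x.1 x.2) (p.args m) := by
  set A : Set (Edge T) := {e | e ∈ wires.{u, v} p} with hAdef
  set B := bodyTests.{u, v} p t with hBdef
  have hA : Functional A :=
    functional_of_nodup ((src_wires p).nodup_iff.2 (Boundary.nodup_positions _ _))
  have hnd := (positions_sequent.{u, v} p false).nodup_iff.2 (Boundary.nodup_positions _ _)
  rw [List.nodup_append'] at hnd
  obtain ⟨hnd1, -, hnd2⟩ := hnd
  have hmem : ∀ x, x ∈ p.allVars := fun x => List.mem_flatMap.2
    ⟨x.1, List.mem_finRange _, List.mem_map.2 ⟨x.2, List.mem_finRange _, rfl⟩⟩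
  have hB : Functional B := by
    rintro ⟨a, w, b⟩ h ⟨a', w', b'⟩ h' rfl
    obtain ⟨x, h1, rfl, rfl⟩ := (mem_bodyTests p).1 h
    obtain ⟨y, h2, rfl, rfl⟩ := (mem_bodyTests p).1 h'
    obtain rfl := List.inj_on_of_nodup_map hnd1 (hmem x) (hmem y) (h1.symm.trans h2)
    rfl
  have hend : ∀ (m : Fin (arity p.head)) v y,
      (⟨base.{u, v} p + (2 * m + 1), v, y⟩ : Edge T) ∉ B := by
    intro m v y h
    obtain ⟨x, h1, -, -⟩ := (mem_bodyTests p).1 h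
    exact hnd2 (List.mem_map.2 ⟨x, hmem x, rfl⟩)
      (List.mem_map.2 ⟨m, List.mem_finRange _, h1⟩)
  have hwalk := fun m : Fin (arity p.head) => path_walk (inV := enter.{u, v} p) (outV := leave.{u, v} p)
    (z := base.{u, v} p + (2 * m + 1)) (A := A) (B := B) (t := fun x => t x.1 x.2)
    (y := base.{u, v} p + 2 * m) (acc := []) (s := p.args m)
    (fun e he => List.mem_flatMap.2 ⟨m, List.mem_finRange _, he⟩)
    (fun x => (mem_bodyTests p).2 ⟨x, rfl, rfl, rfl⟩)
  refine ⟨?_, ?_⟩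
  · rintro ⟨a, u, x, v, h1, h2⟩
    obtain ⟨_, _, h3⟩ := h1.head
    obtain ⟨m, -, h4⟩ := List.mem_flatMap.1 h3
    obtain ⟨w, h5⟩ := (hwalk m).2 _ h4
    exact Path.not_cyc hA hB h5 (hend m) h1 h2
  · have hpos : ∀ (b : Bool) i, i ∈ (seqInterp (predBoundary arity) (sequent.{u, v} p)).positions b →
        i ∉ (seqInterp (predBoundary arity) (sequent.{u, v} p)).positions !b := by
      intro b i h1 h2
      rw [Boundary.mem_positions] at h1 h2
      rw [h1] at h2
      have := pol_injective (Option.some.inj h2)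
      simp at this
    have hhead : ∀ (b : Bool) (m : Fin (arity p.head)),
        base.{u, v} p + (2 * (m : ℕ) + if b then 0 else 1) ∈
          (seqInterp (predBoundary arity) (sequent.{u, v} p)).positions b := fun b m =>
      (positions_sequent.{u, v} p b).mem_iff.1 (List.mem_append.2 (Or.inr
        (List.mem_map.2 ⟨m, List.mem_finRange _, rfl⟩)))
    ext ⟨a, w, b⟩
    rw [mem_pull, mem_paths, mem_tupleEdges]
    constructor
    · rintro ⟨ha, hb, h⟩
      obtain ⟨_, _, h1⟩ := h.head
      obtain ⟨_, _, h2⟩ := h.last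
      have h1' := (src_wires p).mem_iff.1 (List.mem_map_of_mem h1)
      have h2' := (tgt_wires p).mem_iff.1 (List.mem_map_of_mem h2)
      simp only [Set.mem_Iio] at ha hb
      -- A path starts at a left endpoint, and at the head these are the even vertices.
      have ha' : a % 2 = 0 := by
        by_contra hodd
        refine hpos true _ h1' ?_
        have := hhead false ⟨a / 2, by omega⟩
        simp only [Bool.false_eq_true, if_false] at this
        rwa [show 2 * (a / 2) + 1 = a by omega] at this
      have hb' : b % 2 = 1 := by
        by_contra hodd
        refine hpos false _ h2' ?_
        have := hhead true ⟨b / 2, by omega⟩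
        simp only [if_true] at this
        rwa [show 2 * (b / 2) + 0 = b by omega] at this
      obtain ⟨m, rfl⟩ : ∃ m : Fin (arity p.head), a = 2 * m := ⟨⟨a / 2, by omega⟩, by simp; omega⟩
      obtain ⟨m', rfl⟩ : ∃ m : Fin (arity p.head), b = 2 * m + 1 :=
        ⟨⟨b / 2, by omega⟩, by simp; omega⟩
      obtain ⟨h3, h4⟩ := h.unique hA hB (hwalk m).1 (hend m') (hend m)
      exact ⟨m, rfl, by simpa using h3, by omega⟩
    · rintro ⟨m, rfl, rfl, rfl⟩
      have := m.2
      exact ⟨by simp, by simp; omega, by simpa using (hwalk m).1⟩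

end Production

/-- With a single formula in the sequent there is nothing to plug in, so realizability means
membership. -/
theorem LLG.Derivable.edges_mem {G : LLG.{u, v} T} {p : G.Atom} {σ : Multiword T}
    (hσ : G.Derivable [.pos p] σ) (hr : σ.IsRegular) {L : Bool → G.Atom → Set (Set (Edge T))}
    (h : Realizes G.ξ (realizers G.ξ L) (place G.ξ 0 [.pos p]) σ.edges) : σ.edges ∈ L true p := by
  have h1 := h _ [] (List.Perm.refl _) ∅ rfl (not_cyc_empty _)
  rw [paths_empty_right] at h1
  have hs := (hσ.typed hr).suppIn
  rw [seqInterp_singleton] at hs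
  have h2 : pull (0 + ·) (Set.Iio (G.ξ p).length) σ.edges = σ.edges := by
    ext ⟨a, w, b⟩
    rw [mem_pull]
    simp only [zero_add]
    exact ⟨fun h => h.2.2, fun h => ⟨(hs.mem h).1, (hs.mem h).2, h⟩⟩
  rw [← h2]
  exact h1

/-! ### Correctness of the grammar of production axioms -/

namespace MCFG

open Production

variable (G : MCFG T)

/-- The axiom of a production. -/
noncomputable def axiomOf (p : Production T G.N G.arity) :
    List (Formula (ULift.{v} G.N)) × Multiword T :=
  (sequent.{u, v} p, ⟨{e | e ∈ wires.{u, v} p}, 0⟩)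

/-- The linear logic grammar of a multiple context-free grammar. -/
noncomputable def toLLG : LLG.{u, v} T where
  Atom := ULift.{v} G.N
  ξ := predBoundary G.arity
  Lex := G.axiomOf '' G.P
  lex_finite := G.finite_P.image _
  lex_typed := by
    rintro _ ⟨p, -, rfl⟩
    exact Multiword.hasBoundary_of_list (src_wires p) (tgt_wires p)
  S := ⟨G.S⟩
  card_S := by rw [predBoundary, length_alternating, G.arity_S]
  left_S := by
    refine ⟨0, ?_, fun i hi => ?_⟩
    · rw [predBoundary, G.arity_S]
      rfl
    · obtain ⟨m, rfl⟩ := getElem?_alternating (b := true).1 hi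
      have := m.2
      simp only [G.arity_S] at this
      simp
      omega

theorem tensorFreeLexicon_toLLG : (toLLG.{u, v} G).TensorFreeLexicon := by
  rintro _ ⟨p, -, rfl⟩ X hX
  rcases List.mem_append.1 hX with h | h
  · obtain ⟨j, rfl⟩ := List.mem_ofFn.1 h
    trivial
  · obtain rfl := List.mem_singleton.1 h
    trivial

theorem place_sequent (p : Production T G.N G.arity) :
    (place (predBoundary G.arity) 0 (sequent.{u, v} p)).Perm
      ((.pos ⟨p.head⟩, (base.{u, v} p + ·)) ::
        List.ofFn fun j => (.neg ⟨p.body j⟩, (offset.{u, v} p j + ·))) := by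
  rw [sequent, place_append, place_bodySeq, zero_add]
  exact List.perm_append_singleton _ _

theorem bodyTests_eq (p : Production T G.N G.arity)
    (t : (j : Fin p.n) → Fin (G.arity (p.body j)) → List T) :
    bodyTests.{u, v} p t = ⋃ j, push (offset.{u, v} p j + ·)
      (push (rev (2 * G.arity (p.body j))) (tupleEdges (t j))) := by
  simp only [push_push]
  rfl

variable {G}

/-- The axiom of the production is cut against the closed multiwords obtained for the body, and
`wires_spec` identifies the result. -/
theorem Derivable.mem_closed {A : G.N} {t : Fin (G.arity A) → List T} (h : G.Derivable A t) :
    tupleEdges t ∈ (toLLG.{u, v} G).closed (.pos ⟨A⟩) := by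
  induction h with
  | production p hp t _ ih =>
    have h1 : (toLLG.{u, v} G).Derivable (sequent.{u, v} p) ⟨{e | e ∈ wires.{u, v} p}, 0⟩ :=
      .lex ⟨p, hp, rfl⟩
    have h2 := h1.realizes_closedPair rfl _ _ (G.place_sequent p) (bodyTests.{u, v} p t) (by
      refine mem_tests_ofFn.2 ⟨_, fun j => ?_, G.bodyTests_eq p t⟩
      refine ⟨_, ih j, ?_⟩
      simp only [Formula.interp, Boundary.length_dual]
      show push (rev (alternating _).length) _ = _
      rw [length_alternating]) (wires_spec p t).1
    have h3 : dom (toLLG.{u, v} G).ξ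
        ((.pos ⟨p.head⟩, (base.{u, v} p + ·)) : Placed (ULift.{v} G.N)) =
          Set.Iio (2 * G.arity p.head) := by
      show Set.Iio (alternating _).length = _
      rw [length_alternating]
    rw [← (wires_spec.{u, v} p t).2, ← h3]
    exact h2

/-- The edge sets of derivable tuples. -/
def tupleSets (G : MCFG T) : Bool → ULift.{v} G.N → Set (Set (Edge T))
  | true, A => {d | ∃ t, G.Derivable A.down t ∧ tupleEdges t = d}
  | false, _ => ∅

theorem typed_tupleSets : ∀ b p, ∀ d ∈ tupleSets.{u, v} G b p, Typed b (predBoundary G.arity p) d := by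
  rintro (_ | _) p d hd
  · exact hd.elim
  · obtain ⟨t, -, rfl⟩ := hd
    exact typed_tupleEdges t

/-- If the head is left unplugged, this is one application of the production. If a body literal is
left, a test of the positive head would be required, and `tupleSets` provides none. -/
theorem realizes_sequent {p : Production T G.N G.arity} (hp : p ∈ G.P) :
    Realizes (predBoundary G.arity) (realizers (predBoundary G.arity) (tupleSets.{u, v} G))
      (place (predBoundary G.arity) 0 (sequent.{u, v} p)) {e | e ∈ wires.{u, v} p} := by
  intro q l hl B hB _
  rcases perm_cons_cons_iff ((G.place_sequent p).symm.trans hl) with ⟨rfl, h⟩ | ⟨P', -, h⟩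
  · rw [← tests_perm h] at hB
    obtain ⟨d, hd, rfl⟩ := mem_tests_ofFn.1 hB
    have hd' : ∀ j, ∃ t : Fin (G.arity (p.body j)) → List T, G.Derivable (p.body j) t ∧
        push (rev (2 * G.arity (p.body j))) (tupleEdges t) = d j := by
      intro j
      obtain ⟨_, ⟨t, ht, rfl⟩, h2⟩ := hd j
      refine ⟨t, ht, ?_⟩
      rw [← h2]
      show _ = push (rev (alternating _).length) _
      rw [length_alternating]
    choose t ht htd using hd'
    refine ⟨_, .production p hp t ht, ?_⟩
    rw [← (wires_spec.{u, v} p t).2, bodyTests_eq]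
    simp only [htd]
    show pull _ _ _ = pull _ (Set.Iio (alternating _).length) _
    rw [length_alternating]
  · rw [tests_perm h] at hB
    obtain ⟨_, h1, -⟩ := hB
    exact h1.elim

theorem language_toLLG : (toLLG.{u, v} G).language = G.language := by
  have hm : ∀ m : Fin (G.arity G.S), (m : ℕ) = 0 := fun m => by
    have := m.2
    have h := G.arity_S
    omega
  have h0 : 0 < G.arity G.S := by rw [G.arity_S]; exact one_pos
  ext w
  constructor
  · rintro ⟨σ, hσ, hr, e, he, rfl⟩
    have h1 := hσ.realizes (L := tupleSets.{u, v} G) typed_tupleSets (by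
      rintro _ ⟨p, hp, rfl⟩ _
      exact realizes_sequent hp) hr
    obtain ⟨t, ht, h2⟩ : ∃ t : Fin (G.arity G.S) → List T, G.Derivable G.S t ∧
      tupleEdges t = σ.edges := hσ.edges_mem hr h1
    rw [← h2] at he
    obtain ⟨m, rfl⟩ := he
    have h3 : t = fun _ => t m := funext fun m' => congrArg t (Fin.ext (by rw [hm, hm]))
    have h4 : G.Derivable G.S fun _ => t m := by rwa [← h3]
    exact h4
  · intro hw
    obtain ⟨σ, h1, h2, h3⟩ := Derivable.mem_closed.{u, v} (show G.Derivable G.S _ from hw)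
    exact ⟨σ, h1, h2, ⟨0, w, 1⟩, h3 ▸ ⟨⟨0, h0⟩, rfl⟩, rfl⟩

end MCFG

/-! ### Relabelling -/

section Relabel

variable {T' : Type u} {g : T' → List T} {A B : Set (Edge T')}

/-- The image of an edge set under a substitution of words for letters. -/
def relabel (g : T' → List T) (E : Set (Edge T')) : Set (Edge T) :=
  (fun e => ⟨e.src, e.label.flatMap g, e.tgt⟩) '' E

theorem mem_relabel {E : Set (Edge T')} {a b : ℕ} {w : List T} :
    (⟨a, w, b⟩ : Edge T) ∈ relabel g E ↔ ∃ w', (⟨a, w', b⟩ : Edge T') ∈ E ∧ w'.flatMap g = w := by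
  constructor
  · rintro ⟨⟨a, v, b⟩, h, he⟩
    simp only [Edge.mk.injEq] at he
    obtain ⟨rfl, rfl, rfl⟩ := he
    exact ⟨v, h, rfl⟩
  · rintro ⟨w', h, rfl⟩
    exact ⟨_, h, rfl⟩

/-- Paths depend on the endpoints of edges alone; substitution merely acts on the label of the whole
path. -/
theorem path_relabel_iff {a b : ℕ} {w : List T} : Path (relabel g A) (relabel g B) a w b ↔
    ∃ w', Path A B a w' b ∧ w'.flatMap g = w := by
  constructor
  · intro h
    induction h with
    | single h =>
      obtain ⟨w', h', rfl⟩ := mem_relabel.1 h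
      exact ⟨w', .single h', rfl⟩
    | step h1 h2 _ ih =>
      obtain ⟨u, h1', rfl⟩ := mem_relabel.1 h1
      obtain ⟨v, h2', rfl⟩ := mem_relabel.1 h2
      obtain ⟨w', h3, rfl⟩ := ih
      exact ⟨_, .step h1' h2' h3, by simp⟩
  · rintro ⟨w', h, rfl⟩
    induction h with
    | single h => exact .single (mem_relabel.2 ⟨_, h, rfl⟩)
    | step h1 h2 _ ih =>
      simp only [List.flatMap_append]
      exact .step (mem_relabel.2 ⟨_, h1, rfl⟩) (mem_relabel.2 ⟨_, h2, rfl⟩) ih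

theorem cyc_relabel_iff : Cyc (relabel g A) (relabel g B) ↔ Cyc A B := by
  constructor
  · rintro ⟨a, u, x, v, h1, h2⟩
    obtain ⟨u', h1, -⟩ := path_relabel_iff.1 h1
    obtain ⟨v', h2, -⟩ := mem_relabel.1 h2
    exact ⟨a, u', x, v', h1, h2⟩
  · rintro ⟨a, u, x, v, h1, h2⟩
    exact ⟨_, _, _, _, path_relabel_iff.2 ⟨u, h1, rfl⟩, mem_relabel.2 ⟨v, h2, rfl⟩⟩

end Relabel

/-! ### Wiring of finite matchings -/

/-- A single plugged edge fuses its two neighbours in `A`. Since `x` is the target of no other edge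
and `y` the source of no other edge, all remaining paths are single edges. -/
theorem path_singleton_iff {A : Set (Edge T)} {A₀ : Set (Edge T)} {a b x y : ℕ} {u v w : List T}
    (hA : A = insert ⟨a, u, x⟩ (insert ⟨y, w, b⟩ A₀)) (hx : ∀ e ∈ A₀, e.tgt ≠ x)
    (hy : ∀ e ∈ A₀, e.src ≠ y) (hay : a ≠ y) (hbx : b ≠ x) {p q : ℕ} {r : List T} (hp : p ≠ y)
    (hq : q ≠ x) :
    Path A {⟨x, v, y⟩} p r q ↔
      (⟨p, r, q⟩ : Edge T) ∈ insert (⟨a, u ++ (v ++ w), b⟩ : Edge T) A₀ := by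
  have hto : ∀ {c s}, (⟨c, s, x⟩ : Edge T) ∈ A → c = a ∧ s = u := by
    intro c s h
    rw [hA] at h
    rcases h with h | h | h
    · simp only [Edge.mk.injEq] at h
      exact ⟨h.1, h.2.1⟩
    · simp only [Edge.mk.injEq] at h
      exact (hbx h.2.2.symm).elim
    · exact (hx _ h rfl).elim
  have hfrom : ∀ {c s}, (⟨y, s, c⟩ : Edge T) ∈ A → s = w ∧ c = b := by
    intro c s h
    rw [hA] at h
    rcases h with h | h | h
    · simp only [Edge.mk.injEq] at h
      exact (hay h.1.symm).elim
    · simp only [Edge.mk.injEq] at h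
      exact ⟨h.2.1, h.2.2⟩
    · exact (hy _ h rfl).elim
  constructor
  · intro h
    cases h with
    | single h =>
      rw [hA] at h
      rcases h with h | h | h
      · simp only [Edge.mk.injEq] at h
        exact (hq h.2.2).elim
      · simp only [Edge.mk.injEq] at h
        exact (hp h.1).elim
      · exact Or.inr h
    | step h1 h2 h3 =>
      simp only [Set.mem_singleton_iff, Edge.mk.injEq] at h2
      obtain ⟨rfl, rfl, rfl⟩ := h2
      obtain ⟨rfl, rfl⟩ := hto h1
      left
      cases h3 with
      | single h4 =>
        obtain ⟨rfl, rfl⟩ := hfrom h4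
        rfl
      | step h4 h5 _ =>
        simp only [Set.mem_singleton_iff, Edge.mk.injEq] at h5
        obtain ⟨rfl, -, -⟩ := h5
        exact (hbx (hfrom h4).2.symm).elim
  · rintro (h | h)
    · simp only [Edge.mk.injEq] at h
      obtain ⟨rfl, rfl, rfl⟩ := h
      exact .step (by rw [hA]; exact Or.inl rfl) rfl (.single (by rw [hA]; exact Or.inr (Or.inl rfl)))
    · exact .single (by rw [hA]; exact Or.inr (Or.inr h))

set_option maxHeartbeats 1000000 in
/-- Plugging a matching into another one without closing a cycle yields a matching of the remaining
vertices, and every label is used exactly once. -/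
theorem exists_wiring {A B : List (Edge T)} (hAs : (A.map Edge.src).Nodup)
    (hAt : (A.map Edge.tgt).Nodup) (hA : (A.map Edge.src).Disjoint (A.map Edge.tgt))
    (hBs : (B.map Edge.src).Nodup) (hBt : (B.map Edge.tgt).Nodup)
    (hBA : ∀ e ∈ B, e.src ∈ A.map Edge.tgt ∧ e.tgt ∈ A.map Edge.src)
    (hcyc : ¬ Cyc {e | e ∈ A} {e | e ∈ B}) :
    ∃ C : List (Edge T), (A.map Edge.src).Perm (C.map Edge.src ++ B.map Edge.tgt) ∧
      (A.map Edge.tgt).Perm (C.map Edge.tgt ++ B.map Edge.src) ∧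
      (A.flatMap Edge.label ++ B.flatMap Edge.label).Perm (C.flatMap Edge.label) ∧
      ∀ a w b, a ∈ A.map Edge.src → b ∈ A.map Edge.tgt → a ∉ B.map Edge.tgt → b ∉ B.map Edge.src →
        (Path {e | e ∈ A} {e | e ∈ B} a w b ↔ (⟨a, w, b⟩ : Edge T) ∈ C) := by
  classical
  induction B generalizing A with
  | nil =>
    refine ⟨A, by simp, by simp, by simp, fun a w b _ _ _ _ => ?_⟩
    have : ({e | e ∈ ([] : List (Edge T))} : Set (Edge T)) = ∅ := by ext; simp
    rw [this]
    exact Path.empty_right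
  | cons e B ih =>
    obtain ⟨x, v, y⟩ := e
    obtain ⟨hx, hy⟩ := hBA _ List.mem_cons_self
    obtain ⟨⟨a, u, x'⟩, he1, hx'⟩ := List.mem_map.1 hx
    obtain ⟨⟨y', w, b⟩, he2, hy'⟩ := List.mem_map.1 hy
    simp only at hx' hy'
    subst hx' hy'
    -- Otherwise the plugged edge would return to the start of the `A`-edge leading to it and close
    -- a cycle.
    have hay : a ≠ y' := by
      rintro rfl
      exact hcyc ⟨_, _, _, _, .single he1, List.mem_cons_self⟩
    have hp1 := List.perm_cons_erase he1
    have he2' : (⟨y', w, b⟩ : Edge T) ∈ A.erase ⟨a, u, x'⟩ := by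
      refine (List.mem_erase_of_ne fun h => ?_).2 he2
      simp only [Edge.mk.injEq] at h
      exact hay h.1.symm
    have hp := hp1.trans ((List.perm_cons_erase he2').cons _)
    generalize (A.erase ⟨a, u, x'⟩).erase ⟨y', w, b⟩ = A₀ at hp
    have hps := hp.map Edge.src
    have hpt := hp.map Edge.tgt
    simp only [List.map_cons] at hps hpt
    have hAs' := hps.nodup_iff.1 hAs
    have hAt' := hpt.nodup_iff.1 hAt
    have hAd : ∀ i, i ∈ a :: y' :: A₀.map Edge.src → i ∉ x' :: b :: A₀.map Edge.tgt := fun i h1 h2 =>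
      hA (hps.mem_iff.2 h1) (hpt.mem_iff.2 h2)
    simp only [List.nodup_cons, List.mem_cons, not_or] at hAs' hAt' hAd
    obtain ⟨⟨-, haA⟩, hyA, hA₀s⟩ := hAs'
    obtain ⟨⟨hxb, hxA⟩, hbA, hA₀t⟩ := hAt'
    -- The fused edge contains the three labels once each; the rest of `B` is plugged into `A₁` by
    -- induction.
    set A₁ : List (Edge T) := ⟨a, u ++ (v ++ w), b⟩ :: A₀ with hA₁
    set M : Set ℕ := {z | z ≠ x' ∧ z ≠ y'} with hM
    rw [List.map_cons, List.nodup_cons] at hBs hBt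
    have hAset : ({e | e ∈ A} : Set (Edge T)) =
        insert ⟨a, u, x'⟩ (insert ⟨y', w, b⟩ {e | e ∈ A₀}) := by
      ext e
      simp only [Set.mem_insert_iff, Set.mem_ofPred_eq]
      rw [hp.mem_iff]
      simp
    have hBset : ({e | e ∈ (⟨x', v, y'⟩ : Edge T) :: B} : Set (Edge T)) =
        {⟨x', v, y'⟩} ∪ push id {e | e ∈ B} := by
      ext e
      simp [push]
    have hBM : SuppIn M ({e | e ∈ B} : Set (Edge T)) := by
      intro e he
      obtain ⟨h1, h2⟩ := hBA e (List.mem_cons_of_mem _ he)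
      have h1' := hpt.mem_iff.1 h1
      have h2' := hps.mem_iff.1 h2
      simp only [List.mem_cons] at h1' h2'
      refine ⟨⟨?_, ?_⟩, ?_, ?_⟩
      · exact fun h => hBs.1 (List.mem_map.2 ⟨e, he, h⟩)
      · intro h
        exact (hAd y' (Or.inr (Or.inl rfl))).elim (by rw [h] at h1'; tauto)
      · intro h
        have := hAd _ h2'
        rw [h] at this
        tauto
      · exact fun h => hBt.1 (List.mem_map.2 ⟨e, he, h⟩)
    have hpull : pull id M (paths {e | e ∈ A} {⟨x', v, y'⟩}) = {e | e ∈ A₁} := by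
      ext ⟨p, r, q⟩
      have hkey : p ≠ y' → q ≠ x' → (Path {e | e ∈ A} {⟨x', v, y'⟩} p r q ↔
          (⟨p, r, q⟩ : Edge T) ∈ A₁) := by
        intro h1 h2
        rw [path_singleton_iff hAset (fun e he h => hxA (List.mem_map.2 ⟨e, he, h⟩))
          (fun e he h => hyA (List.mem_map.2 ⟨e, he, h⟩)) hay (Ne.symm hxb) h1 h2]
        simp [hA₁]
      rw [mem_pull, mem_paths]
      constructor
      · rintro ⟨h1, h2, h3⟩
        exact (hkey h1.2 h2.1).1 h3
      · intro h
        have h1 : p ∈ A₁.map Edge.src := List.mem_map.2 ⟨_, h, rfl⟩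
        have h2 : q ∈ A₁.map Edge.tgt := List.mem_map.2 ⟨_, h, rfl⟩
        simp only [hA₁, List.map_cons, List.mem_cons] at h1 h2
        have hpy : p ≠ y' := by
          rintro rfl
          rcases h1 with h1 | h1
          exacts [hay h1.symm, hyA h1]
        have hqx : q ≠ x' := by
          rintro rfl
          rcases h2 with h2 | h2
          exacts [hxb h2, hxA h2]
        refine ⟨⟨?_, hpy⟩, ⟨hqx, ?_⟩, (hkey hpy hqx).2 h⟩
        · exact (hAd p (by tauto)).1
        · rintro rfl
          have := hAd q (Or.inr (Or.inl rfl))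
          tauto
    have hcyc' : ¬ Cyc ({e | e ∈ A₁} : Set (Edge T)) {e | e ∈ B} := by
      intro h
      rw [hBset, cyc_union_push_iff hBM, hpull] at hcyc
      exact hcyc (Or.inr h)
    obtain ⟨C, h1, h2, h3, h4⟩ := ih (A := A₁) (by
        simp only [hA₁, List.map_cons, List.nodup_cons]; exact ⟨haA, hA₀s⟩) (by
        simp only [hA₁, List.map_cons, List.nodup_cons]; exact ⟨hbA, hA₀t⟩) (by
        intro i hi hi'
        simp only [hA₁, List.map_cons, List.mem_cons] at hi hi'
        have := hAd i (by tauto)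
        tauto) hBs.2 hBt.2 (by
        intro e he
        obtain ⟨h1, h2⟩ := hBA e (List.mem_cons_of_mem _ he)
        have h3 := hBM e he
        have h1' := hpt.mem_iff.1 h1
        have h2' := hps.mem_iff.1 h2
        simp only [hA₁, List.map_cons, List.mem_cons] at h1' h2' ⊢
        exact ⟨h1'.resolve_left h3.1.1, by
          rcases h2' with h | h | h
          exacts [Or.inl h, (h3.2.2 h).elim, Or.inr h]⟩) hcyc'
    refine ⟨C, ?_, ?_, ?_, ?_⟩
    · refine hps.trans ((List.Perm.swap _ _ _).trans ?_)
      exact (h1.cons _).trans List.perm_middle.symm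
    · refine hpt.trans ?_
      exact (h2.cons _).trans List.perm_middle.symm
    · refine List.Perm.trans ?_ h3
      refine ((hp.flatMap_right _).append_right _).trans ?_
      rw [← Multiset.coe_eq_coe]
      simp only [hA₁, List.flatMap_cons, ← Multiset.coe_add]
      abel
    · intro p r q hp' hq' hpB hqB
      simp only [List.map_cons, List.mem_cons, not_or] at hpB hqB
      have hp'' := hps.mem_iff.1 hp'
      have hq'' := hpt.mem_iff.1 hq'
      simp only [List.mem_cons] at hp'' hq''
      have hpM : p ∈ M := ⟨(hAd p hp'').1, hpB.1⟩
      have hqM : q ∈ M := ⟨hqB.1, fun h => by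
        have := hAd y' (Or.inr (Or.inl rfl))
        rw [h] at hq''
        tauto⟩
      rw [hBset]
      have h5 := path_union_push_iff (A := {e | e ∈ A}) (B := {⟨x', v, y'⟩}) (f := id) hBM hpM hqM
        (w := r)
      rw [hpull] at h5
      refine h5.trans (h4 p r q ?_ ?_ hpB.2 hqB.2)
      · rcases hp'' with rfl | h | h
        exacts [List.mem_cons_self, (hpB.1 h).elim, List.mem_cons_of_mem _ h]
      · rcases hq'' with h | rfl | h
        exacts [(hqB.1 h).elim, List.mem_cons_self, List.mem_cons_of_mem _ h]

/-! ### Matchings of bounded boundaries -/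

section Matchings

variable {n : ℕ}

open Classical in
/-- The vertices of polarity `pol b` among the first `n`. -/
noncomputable def active (n : ℕ) (b : Bool) (X : Boundary) : List (Fin n) :=
  (List.finRange n).filter fun v => X[(v : ℕ)]? = some (pol b)

theorem mem_active {b : Bool} {X : Boundary} {v : Fin n} :
    v ∈ active n b X ↔ X[(v : ℕ)]? = some (pol b) := by simp [active]

open Classical in
/-- The first `n` numbers that are not vertices of polarity `pol b`. -/
noncomputable def idle (n : ℕ) (b : Bool) (X : Boundary) : List (Fin n) :=
  (List.finRange n).filter fun v => !decide (X[(v : ℕ)]? = some (pol b))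

theorem mem_idle {b : Bool} {X : Boundary} {v : Fin n} : v ∈ idle n b X ↔ v ∉ active n b X := by
  simp [idle, mem_active]

theorem active_append_idle (b : Bool) (X : Boundary) :
    (active n b X ++ idle n b X).Perm (List.finRange n) :=
  List.filter_append_perm _ _

theorem nodup_active (b : Bool) (X : Boundary) : (active n b X).Nodup :=
  (List.nodup_finRange n).filter _

theorem map_val_active {b : Bool} {X : Boundary} (hX : X.length ≤ n) :
    ((active n b X).map Fin.val).Perm (X.positions b) := by
  refine (List.perm_ext_iff_of_nodup ((nodup_active b X).map Fin.val_injective)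
    (Boundary.nodup_positions _ _)).2 fun i => ?_
  rw [List.mem_map, Boundary.mem_positions]
  constructor
  · rintro ⟨v, hv, rfl⟩
    exact mem_active.1 hv
  · intro h
    exact ⟨⟨i, (Boundary.lt_of_getElem? h).trans_le hX⟩, mem_active.2 h, rfl⟩

/-- `m` restricts to a bijection from the vertices of polarity `pol b` to those of the opposite
polarity. -/
def IsMatching (b : Bool) (X : Boundary) (m : Fin n → Fin n) : Prop :=
  ((active n b X).map m).Perm (active n (!b) X)

/-- The labels are indexed by all of `Fin n`, so that all atoms and matchings share one arity; only
the components at sources are read. -/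
noncomputable def matchEdges (b : Bool) (X : Boundary) (m : Fin n → Fin n) (t : Fin n → List T) :
    List (Edge T) :=
  (active n b X).map fun v : Fin n => ⟨v, t v, m v⟩

theorem typed_matchEdges {b : Bool} {X : Boundary} {m : Fin n → Fin n} (hm : IsMatching b X m)
    (t : Fin n → List T) : Typed b X {e | e ∈ matchEdges b X m t} := by
  intro e he
  obtain ⟨v, hv, rfl⟩ := List.mem_map.1 he
  exact ⟨mem_active.1 hv, mem_active.1 (hm.mem_iff.1 (List.mem_map_of_mem hv))⟩

theorem perm_of_map_perm {α β : Type*} {f : α → β} {l₁ l₂ : List α} (h : (l₁.map f).Perm (l₂.map f))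
    (hl : (l₂.map f).Nodup) (hs : ∀ a ∈ l₁, a ∈ l₂) : l₁.Perm l₂ := by
  refine (List.perm_ext_iff_of_nodup (.of_map f (h.nodup_iff.2 hl)) (.of_map f hl)).2 fun a =>
    ⟨hs a, fun ha => ?_⟩
  obtain ⟨a', h1, h2⟩ := List.mem_map.1 (h.mem_iff.2 (List.mem_map_of_mem ha))
  exact List.inj_on_of_nodup_map hl (hs _ h1) ha h2 ▸ h1

end Matchings

/-- Counting variables in words over `T ⊕ V` needs a lawful equality test on the sum. -/
instance instLawfulBEqSum {α β : Type*} [BEq α] [LawfulBEq α] [BEq β] [LawfulBEq β] :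
    LawfulBEq (α ⊕ β) where
  eq_of_beq := by
    rintro (a | a) (b | b) h
    · exact congrArg Sum.inl (eq_of_beq (show (a == b) = true from h))
    · cases h
    · cases h
    · exact congrArg Sum.inr (eq_of_beq (show (a == b) = true from h))
  rfl := by
    rintro (a | a)
    · exact (BEq.rfl : (a == a) = true)
    · exact (BEq.rfl : (a == a) = true)

/-! ### Symbolic wiring of slots -/

section SlotWiring

variable {n r : ℕ} (ξ : N → Boundary) (s : Slot N) (S : Fin r → Slot N)
  (m : Fin r → Fin n → Fin n)

abbrev SlotVar (n r : ℕ) := (_ : Fin r) × Fin n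

/-- The edges that are plugged into the slot `j`. -/
noncomputable def plugEdges (j : Fin r) (t : Fin n → List T) : List (Edge T) :=
  (matchEdges (!(S j).sign) (ξ (S j).atom) (m j) t).map fun e => ⟨(S j).emb e.src, e.label, (S j).emb e.tgt⟩

noncomputable def plugs (t : Fin r → Fin n → List T) : List (Edge T) :=
  (List.finRange r).flatMap fun j => plugEdges ξ S m j (t j)

/-- Generic input: every plugged edge has its own variable as label. Any actual input with the same
matchings is a substitution instance, so the paths have to be computed only once. -/
noncomputable def symbolicPlugs (T : Type u) : List (Edge (T ⊕ SlotVar n r)) :=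
  plugs ξ S m fun j v => [.inr ⟨j, v⟩]

def symbolicEdges (V : Type) (E : List (Edge T)) : List (Edge (T ⊕ V)) :=
  E.map fun e => ⟨e.src, e.label.map .inl, e.tgt⟩

theorem plugs_eq (t : Fin r → Fin n → List T) : ({e | e ∈ plugs ξ S m t} : Set (Edge T)) =
    ⋃ j, push (S j).emb {e | e ∈ matchEdges (!(S j).sign) (ξ (S j).atom) (m j) (t j)} := by
  ext e
  simp [plugs, plugEdges, push]

theorem relabel_symbolicEdges {V : Type} (t : V → List T) (E : List (Edge T)) :
    relabel (Sum.elim (fun a => [a]) t) {e | e ∈ symbolicEdges V E} = {e | e ∈ E} := by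
  have h : ∀ w : List T, (w.map (.inl : T → T ⊕ V)).flatMap (Sum.elim (fun a => [a]) t) = w := by
    intro w
    rw [List.flatMap_map]
    exact List.flatMap_singleton' w
  ext ⟨a, w, b⟩
  simp only [mem_relabel, symbolicEdges, Set.mem_ofPred_eq, List.mem_map]
  constructor
  · rintro ⟨w', ⟨e, he, h1⟩, rfl⟩
    simp only [Edge.mk.injEq] at h1
    obtain ⟨rfl, rfl, rfl⟩ := h1
    rwa [h]
  · intro he
    exact ⟨_, ⟨_, he, rfl⟩, h w⟩

theorem relabel_symbolicPlugs (t : Fin r → Fin n → List T) :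
    relabel (Sum.elim (fun a => [a]) fun x => t x.1 x.2) {e | e ∈ symbolicPlugs ξ S m T} =
      {e | e ∈ plugs ξ S m t} := by
  ext ⟨a, w, b⟩
  simp only [mem_relabel, symbolicPlugs, plugs, plugEdges, matchEdges, Set.mem_ofPred_eq,
    List.mem_flatMap, List.mem_map]
  constructor
  · rintro ⟨w', ⟨j, hj, _, ⟨v, hv, rfl⟩, h1⟩, rfl⟩
    simp only [Edge.mk.injEq] at h1
    obtain ⟨rfl, rfl, rfl⟩ := h1
    exact ⟨j, hj, _, ⟨v, hv, rfl⟩, by simp⟩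
  · rintro ⟨j, hj, _, ⟨v, hv, rfl⟩, h1⟩
    simp only [Edge.mk.injEq] at h1
    obtain ⟨rfl, rfl, rfl⟩ := h1
    exact ⟨_, ⟨j, hj, _, ⟨v, hv, rfl⟩, rfl⟩, by simp⟩

/-- Whether a cycle closes is decided by the matchings, not by the words. Hence one production
serves all words. -/
theorem cyc_symbolic_iff (t : Fin r → Fin n → List T) (E : List (Edge T)) :
    Cyc {e | e ∈ symbolicEdges (SlotVar n r) E} {e | e ∈ symbolicPlugs ξ S m T} ↔
      Cyc {e | e ∈ E} {e | e ∈ plugs ξ S m t} := by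
  rw [← relabel_symbolicPlugs, ← relabel_symbolicEdges (fun x : SlotVar n r => t x.1 x.2) E,
    cyc_relabel_iff]

theorem map_src_plugs (hξ : ∀ j, (ξ (S j).atom).length ≤ n) (t : Fin r → Fin n → List T) :
    ((plugs ξ S m t).map Edge.src).Perm
      ((List.finRange r).flatMap fun j => (S j).vertices ξ false) := by
  rw [plugs, List.map_flatMap]
  refine List.Perm.flatMap_left _ fun j _ => ?_
  have h := (map_val_active (b := !(S j).sign) (hξ j)).map (S j).emb
  rw [List.map_map] at h
  rw [plugEdges, matchEdges, List.map_map, List.map_map, Slot.vertices]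
  cases hs : (S j).sign <;> rw [hs] at h <;> exact h

theorem map_tgt_plugs (hξ : ∀ j, (ξ (S j).atom).length ≤ n)
    (hm : ∀ j, IsMatching (!(S j).sign) (ξ (S j).atom) (m j)) (t : Fin r → Fin n → List T) :
    ((plugs ξ S m t).map Edge.tgt).Perm
      ((List.finRange r).flatMap fun j => (S j).vertices ξ true) := by
  rw [plugs, List.map_flatMap]
  refine List.Perm.flatMap_left _ fun j _ => ?_
  have h := (map_val_active (b := !!(S j).sign) (hξ j)).map (S j).emb
  have h1 := ((hm j).map Fin.val).map (S j).emb
  have h2 := h1.trans h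
  rw [List.map_map, List.map_map] at h2
  rw [plugEdges, matchEdges, List.map_map, List.map_map, Slot.vertices]
  cases hs : (S j).sign <;> rw [hs] at h2 <;> exact h2

/-- The variables that are not the label of a plugged edge. -/
noncomputable def idleVars (T : Type u) : List (T ⊕ SlotVar n r) :=
  (List.finRange r).flatMap fun j =>
    (idle n (!(S j).sign) (ξ (S j).atom)).map fun v => Sum.inr ⟨j, v⟩

theorem count_plugs_idleVars [BEq T] [LawfulBEq T] (x : SlotVar n r) :
    ((symbolicPlugs ξ S m T).flatMap Edge.label ++ idleVars ξ S T).count (Sum.inr x) = 1 := by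
  have h1 : ((symbolicPlugs ξ S m T).flatMap Edge.label ++ idleVars ξ S T).Perm
      ((List.finRange r).flatMap fun j => (List.finRange n).map fun v => Sum.inr ⟨j, v⟩) := by
    have h2 : (symbolicPlugs ξ S m T).flatMap Edge.label = (List.finRange r).flatMap fun j =>
        (active n (!(S j).sign) (ξ (S j).atom)).map fun v => Sum.inr ⟨j, v⟩ := by
      simp only [symbolicPlugs, plugs, plugEdges, matchEdges, List.flatMap_assoc, List.map_map,
        List.flatMap_map]
      congr 1
      funext j
      exact List.map_eq_flatMap.symm
    rw [h2, idleVars]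
    refine (List.flatMap_append_perm _ _ _).trans (List.Perm.flatMap_left _ fun j _ => ?_)
    rw [← List.map_append]
    exact (active_append_idle _ _).map _
  rw [h1.count_eq]
  refine List.count_eq_one_of_mem ?_ ?_
  · rw [List.nodup_flatMap]
    refine ⟨fun j _ => (List.nodup_finRange _).map fun v v' h => ?_, ?_⟩
    · simpa using h
    · refine (List.nodup_finRange _).imp fun {j j'} hj => ?_
      rw [Function.onFun, List.disjoint_left]
      intro x hx hx'
      obtain ⟨_, _, rfl⟩ := List.mem_map.1 hx
      obtain ⟨_, _, h⟩ := List.mem_map.1 hx'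
      simp only [Sum.inr.injEq, Sigma.mk.injEq] at h
      exact hj h.1.symm
  · exact List.mem_flatMap.2 ⟨x.1, List.mem_finRange _, List.mem_map.2 ⟨x.2, List.mem_finRange _, rfl⟩⟩

end SlotWiring

/-! ### Linear rules read off from wirings -/

section SlotRule

variable {n r : ℕ} {ξ : N → Boundary} {s : Slot N} {S : Fin r → Slot N} {m : Fin r → Fin n → Fin n}

theorem vertices_perm_active (b : Bool) (hs : (ξ s.atom).length ≤ n) :
    ((active n (s.sign == b) (ξ s.atom)).map fun v : Fin n => s.emb v).Perm (s.vertices ξ b) := by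
  have h := (map_val_active (b := s.sign == b) hs).map s.emb
  rwa [List.map_map] at h

/-- The edges that survive the plugging have their ends at the vertices of the output slot; read
back through its embedding, they form a matching of the boundary of its atom. -/
theorem exists_slot_matching (hs : (ξ s.atom).length ≤ n) {C : List (Edge T)}
    (hCs : (C.map Edge.src).Perm (s.vertices ξ true))
    (hCt : (C.map Edge.tgt).Perm (s.vertices ξ false))
    (hnd : ∀ b, (s.vertices ξ b).Nodup) :
    ∃ (μ : Fin n → Fin n) (w : Fin n → List T), IsMatching s.sign (ξ s.atom) μ ∧
      C.Perm ((active n s.sign (ξ s.atom)).map fun v : Fin n => ⟨s.emb v, w v, s.emb (μ v)⟩) := by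
  have hv1 := vertices_perm_active (n := n) true hs
  have hv2 := vertices_perm_active (n := n) false hs
  have hb1 : (s.sign == true) = s.sign := by cases s.sign <;> rfl
  have hb2 : (s.sign == false) = !s.sign := by cases s.sign <;> rfl
  rw [hb1] at hv1
  rw [hb2] at hv2
  have hex : ∀ v : Fin n, ∃ (u : Fin n) (w : List T), v ∈ active n s.sign (ξ s.atom) →
      u ∈ active n (!s.sign) (ξ s.atom) ∧ (⟨s.emb v, w, s.emb u⟩ : Edge T) ∈ C := by
    intro v
    by_cases hv : v ∈ active n s.sign (ξ s.atom)
    · have h1 : s.emb v ∈ C.map Edge.src :=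
        (hv1.trans hCs.symm).mem_iff.1 (List.mem_map.2 ⟨v, hv, rfl⟩)
      obtain ⟨⟨a, w, b⟩, he, rfl⟩ := List.mem_map.1 h1
      have h2 : b ∈ C.map Edge.tgt := List.mem_map.2 ⟨_, he, rfl⟩
      obtain ⟨u, hu, hub⟩ := List.mem_map.1 ((hCt.trans hv2.symm).mem_iff.1 h2)
      exact ⟨u, w, fun _ => ⟨hu, hub ▸ he⟩⟩
    · exact ⟨v, [], fun h => (hv h).elim⟩
  choose μ w hμ using hex
  have hinj := List.inj_on_of_nodup_map (hv1.nodup_iff.2 (hnd true))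
  have hCsnd := hCs.nodup_iff.2 (hnd true)
  have hC : C.Perm ((active n s.sign (ξ s.atom)).map fun v : Fin n => ⟨s.emb v, w v, s.emb (μ v)⟩) := by
    refine (List.perm_ext_iff_of_nodup (.of_map _ hCsnd) ?_).2 fun e => ⟨fun he => ?_, fun he => ?_⟩
    · exact (nodup_active _ _).map_on fun v hv v' hv' h => hinj hv hv' (congrArg Edge.src h)
    · obtain ⟨v, hv, hve⟩ := List.mem_map.1
        ((hCs.trans hv1.symm).mem_iff.1 (List.mem_map_of_mem (f := Edge.src) he))
      refine List.mem_map.2 ⟨v, hv, ?_⟩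
      exact List.inj_on_of_nodup_map hCsnd (hμ v hv).2 he hve
    · obtain ⟨v, hv, rfl⟩ := List.mem_map.1 he
      exact (hμ v hv).2
  refine ⟨μ, w, perm_of_map_perm (f := fun v : Fin n => s.emb v) ?_ (hv2.nodup_iff.2 (hnd false)) ?_, hC⟩
  · refine List.Perm.trans ?_ (hCt.trans hv2.symm)
    have := hC.map Edge.tgt
    rw [List.map_map] at this ⊢
    exact this.symm
  · intro u hu
    obtain ⟨v, hv, rfl⟩ := List.mem_map.1 hu
    exact (hμ v hv).1

theorem vertices_mem {b : Bool} {a : ℕ} (ha : (ξ s.atom)[a]? = some (pol (s.sign == b))) :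
    s.emb a ∈ s.vertices ξ b := List.mem_map.2 ⟨a, Boundary.mem_positions.2 ha, rfl⟩

/-- The generic input is wired into the axiom by `exists_wiring`. The labels of the surviving edges,
words in terminals and variables, are the arguments of the production. Each variable that labels a
plugged edge occurs in them once. -/
theorem exists_rule [BEq T] [LawfulBEq T] (hs : (ξ s.atom).length ≤ n)
    (hξ : ∀ j, (ξ (S j).atom).length ≤ n)
    (hm : ∀ j, IsMatching (!(S j).sign) (ξ (S j).atom) (m j)) {E : List (Edge T)}
    (hsrc : (E.map Edge.src).Perm
      (s.vertices ξ true ++ (List.finRange r).flatMap fun j => (S j).vertices ξ true))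
    (htgt : (E.map Edge.tgt).Perm
      (s.vertices ξ false ++ (List.finRange r).flatMap fun j => (S j).vertices ξ false))
    (hnd : (E.map Edge.src ++ E.map Edge.tgt).Nodup) {z : Fin n}
    (hz : z ∉ active n s.sign (ξ s.atom))
    (hcyc : ¬ Cyc {e | e ∈ symbolicEdges (SlotVar n r) E} {e | e ∈ symbolicPlugs ξ S m T}) :
    ∃ (μ : Fin n → Fin n) (args : Fin n → List (T ⊕ SlotVar n r)),
      IsMatching s.sign (ξ s.atom) μ ∧ (∀ x, ∑ v, (args v).count (Sum.inr x) = 1) ∧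
      ∀ t : Fin r → Fin n → List T,
        (∀ j, ∀ v ∈ idle n (!(S j).sign) (ξ (S j).atom), t j v = []) →
        (∀ v ∈ idle n s.sign (ξ s.atom), substitute (fun x => t x.1 x.2) (args v) = []) ∧
        pull s.emb (s.dom ξ) (paths {e | e ∈ E} {e | e ∈ plugs ξ S m t}) =
          {e | e ∈ matchEdges s.sign (ξ s.atom) μ
            fun v => substitute (fun x => t x.1 x.2) (args v)} := by
  classical
  rw [List.nodup_append'] at hnd
  obtain ⟨hnds, hndt, hndd⟩ := hnd
  have hAs : (symbolicEdges (SlotVar n r) E).map Edge.src = E.map Edge.src := by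
    simp [symbolicEdges]
  have hAt : (symbolicEdges (SlotVar n r) E).map Edge.tgt = E.map Edge.tgt := by
    simp [symbolicEdges]
  have hBs := map_src_plugs ξ S m hξ fun j v => [(.inr ⟨j, v⟩ : T ⊕ SlotVar n r)]
  have hBt := map_tgt_plugs ξ S m hξ hm fun j v => [(.inr ⟨j, v⟩ : T ⊕ SlotVar n r)]
  have hs2 := List.nodup_append'.1 (hsrc.nodup_iff.1 hnds)
  have ht2 := List.nodup_append'.1 (htgt.nodup_iff.1 hndt)
  have hsv : ∀ b, (s.vertices ξ b).Nodup := by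
    rintro (_ | _)
    exacts [ht2.1, hs2.1]
  obtain ⟨C, hC1, hC2, hC3, hC4⟩ := exists_wiring (A := symbolicEdges (SlotVar n r) E)
    (B := symbolicPlugs ξ S m T) (hAs ▸ hnds) (hAt ▸ hndt) (hAs ▸ hAt ▸ hndd)
    (hBs.nodup_iff.2 ht2.2.1) (hBt.nodup_iff.2 hs2.2.1) (by
      intro e he
      rw [hAs, hAt]
      exact ⟨htgt.mem_iff.2 (List.mem_append_right _ (hBs.mem_iff.1 (List.mem_map_of_mem he))),
        hsrc.mem_iff.2 (List.mem_append_right _ (hBt.mem_iff.1 (List.mem_map_of_mem he)))⟩) hcyc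
  rw [hAs] at hC1 hC4
  rw [hAt] at hC2 hC4
  have hCs : (C.map Edge.src).Perm (s.vertices ξ true) := by
    have h := (hC1.symm.trans hsrc).trans (hBt.symm.append_left _)
    exact (List.perm_append_right_iff _).1 h
  have hCt : (C.map Edge.tgt).Perm (s.vertices ξ false) := by
    have h := (hC2.symm.trans htgt).trans (hBs.symm.append_left _)
    exact (List.perm_append_right_iff _).1 h
  obtain ⟨μ, w, hμ, hC⟩ := exists_slot_matching hs hCs hCt hsv
  set act := active n s.sign (ξ s.atom) with hact
  -- Linearity demands that the idle variables occur too. They are collected in the idle component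
  -- `z`, where they contribute only empty words.
  refine ⟨μ, fun v => if v ∈ act then w v else if v = z then idleVars ξ S T else [], hμ, ?_, ?_⟩
  · intro x
    have h1 : ∀ v, ((if v ∈ act then w v else if v = z then idleVars ξ S T else []).count
        (Sum.inr x)) = (if v ∈ act then (w v).count (Sum.inr x) else 0) +
          if v = z then (idleVars ξ S T).count (Sum.inr x) else 0 := by
      intro v
      by_cases h : v ∈ act
      · have : v ≠ z := fun h' => hz (h' ▸ h)
        simp [h, this]
      · by_cases h' : v = z <;> simp [h, h', hz]
    have h2 : ∑ v, (if v ∈ act then (w v).count (Sum.inr x) else 0) =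
        (act.flatMap w).count (Sum.inr x) := by
      rw [← Finset.sum_filter, List.count_flatMap, ← List.sum_toFinset _ (nodup_active _ _)]
      refine Finset.sum_congr ?_ fun _ _ => rfl
      ext v
      simp [hact]
    have h3 : (act.flatMap w).Perm ((symbolicPlugs ξ S m T).flatMap Edge.label ++
        (symbolicEdges (SlotVar n r) E).flatMap Edge.label) := by
      have h4 := (hC3.trans (hC.flatMap_right Edge.label)).symm
      rw [List.flatMap_map] at h4
      exact h4.trans List.perm_append_comm
    have h5 : ((symbolicEdges (SlotVar n r) E).flatMap Edge.label).count (Sum.inr x) = 0 := by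
      refine List.count_eq_zero.2 fun h => ?_
      simp [symbolicEdges] at h
    simp only [h1, Finset.sum_add_distrib, h2, Finset.sum_ite_eq', Finset.mem_univ, if_true]
    rw [h3.count_eq, List.count_append, h5, add_zero, ← List.count_append]
    exact count_plugs_idleVars ξ S m x
  · intro t ht
    constructor
    · intro v hv
      have hv' : v ∉ act := mem_idle.1 hv
      simp only [if_neg hv']
      split_ifs
      · simp only [substitute, idleVars, List.flatMap_assoc, List.flatMap_map, Sum.elim_inr,
          List.flatMap_eq_nil_iff]
        exact fun j _ v hv => ht j v hv
      · rfl
    · have hb1 : (s.sign == true) = s.sign := by cases s.sign <;> rfl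
      have hb2 : (s.sign == false) = !s.sign := by cases s.sign <;> rfl
      have hpol : ∀ a ∈ s.dom ξ, ∀ b, (ξ s.atom)[a]? = some (pol (s.sign == b)) ∨
          (ξ s.atom)[a]? = some (pol (s.sign == !b)) := by
        intro a ha b
        rw [List.getElem?_eq_getElem ha]
        rcases exists_pol ((ξ s.atom)[a]) (s.sign == b) with h | h
        · exact Or.inl (congrArg some h)
        · refine Or.inr (congrArg some (h.trans (congrArg pol ?_)))
          cases s.sign <;> cases b <;> rfl
      have hsa : ∀ a ∈ s.dom ξ, s.emb a ∈ E.map Edge.src →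
          (ξ s.atom)[a]? = some (pol (s.sign == true)) := fun a ha h =>
        (hpol a ha true).resolve_right fun h' =>
          hndd h (htgt.mem_iff.2 (List.mem_append_left _ (vertices_mem h')))
      have hta : ∀ a ∈ s.dom ξ, s.emb a ∈ E.map Edge.tgt →
          (ξ s.atom)[a]? = some (pol (s.sign == false)) := fun a ha h =>
        (hpol a ha false).resolve_right fun h' =>
          hndd (hsrc.mem_iff.2 (List.mem_append_left _ (vertices_mem h'))) h
      have hends : ∀ a ∈ s.dom ξ, ∀ b ∈ s.dom ξ, s.emb a ∈ E.map Edge.src →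
          s.emb b ∈ E.map Edge.tgt → ∀ y,
          (Path {e | e ∈ symbolicEdges (SlotVar n r) E} {e | e ∈ symbolicPlugs ξ S m T}
            (s.emb a) y (s.emb b) ↔ (⟨s.emb a, y, s.emb b⟩ : Edge _) ∈ C) := by
        intro a ha b hb ha' hb' y
        refine hC4 _ _ _ ha' hb' (fun h => ?_) fun h => ?_
        · exact hs2.2.2 (vertices_mem (hsa a ha ha')) (hBt.mem_iff.1 h)
        · exact ht2.2.2 (vertices_mem (hta b hb hb')) (hBs.mem_iff.1 h)
      ext ⟨a, y, b⟩
      rw [mem_pull, mem_paths, ← relabel_symbolicPlugs,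
        ← relabel_symbolicEdges (fun x : SlotVar n r => t x.1 x.2) E, path_relabel_iff]
      simp only [matchEdges, Set.mem_ofPred_eq, List.mem_map, Edge.mk.injEq]
      constructor
      · rintro ⟨ha, hb, y', h1, rfl⟩
        have ha' : s.emb a ∈ E.map Edge.src := by
          obtain ⟨_, _, h2⟩ := h1.head
          exact hAs ▸ List.mem_map.2 ⟨_, h2, rfl⟩
        have hb' : s.emb b ∈ E.map Edge.tgt := by
          obtain ⟨_, _, h2⟩ := h1.last
          exact hAt ▸ List.mem_map.2 ⟨_, h2, rfl⟩
        obtain ⟨v, hv, h2⟩ := List.mem_map.1 (hC.mem_iff.1 ((hends a ha b hb ha' hb' _).1 h1))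
        simp only [Edge.mk.injEq] at h2
        obtain ⟨h3, rfl, h4⟩ := h2
        have hv1 := mem_active.1 hv
        have hv2 := mem_active.1 (hμ.mem_iff.1 (List.mem_map_of_mem hv))
        rw [← hb1] at hv1
        rw [← hb2] at hv2
        refine ⟨v, hv, ?_, ?_, ?_⟩
        · exact List.inj_on_of_nodup_map (hsv true) (Boundary.mem_positions.2 hv1)
            (Boundary.mem_positions.2 (hsa a ha ha')) h3
        · rw [if_pos hv]
          rfl
        · exact List.inj_on_of_nodup_map (hsv false) (Boundary.mem_positions.2 hv2)
            (Boundary.mem_positions.2 (hta b hb hb')) h4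
      · rintro ⟨v, hv, rfl, rfl, rfl⟩
        have hv1 := mem_active.1 hv
        have hv2 := mem_active.1 (hμ.mem_iff.1 (List.mem_map_of_mem hv))
        have h1 : (⟨s.emb v, w v, s.emb (μ v)⟩ : Edge _) ∈ C :=
          hC.mem_iff.2 (List.mem_map.2 ⟨v, hv, rfl⟩)
        have h2 := hC1.mem_iff.2 (List.mem_append_left _ (List.mem_map_of_mem h1))
        have h3 := hC2.mem_iff.2 (List.mem_append_left _ (List.mem_map_of_mem h1))
        have hd1 := Boundary.lt_of_getElem? hv1
        have hd2 := Boundary.lt_of_getElem? hv2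
        refine ⟨hd1, hd2, w v, (hends _ hd1 _ hd2 h2 h3 _).2 h1, ?_⟩
        rw [if_pos hv]
        rfl

end SlotRule

/-! ### From linear logic grammars to multiple context-free grammars -/

theorem place_fst_mem {ξ : N → Boundary} {o : ℕ} {Δ : List (Formula N)} :
    ∀ q ∈ place ξ o Δ, q.1 ∈ Δ := by
  induction Δ generalizing o with
  | nil => intro q hq; simp [place] at hq
  | cons X Δ ih =>
    intro q hq
    rcases List.mem_cons.1 hq with rfl | hq
    · exact List.mem_cons_self
    · exact List.mem_cons_of_mem _ (ih q hq)

theorem atom_toSlot {ξ : N → Boundary} {q : Placed N} (hq : q.1.IsLiteral) :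
    (toSlot ξ q).atom = q.1.atom := by
  obtain ⟨X, f⟩ := q
  obtain ⟨p, rfl | rfl⟩ := hq <;> rfl

theorem flatMap_finRange_get {α β : Type*} (l : List α) (f : α → List β) :
    ((List.finRange l.length).flatMap fun j => f (l.get j)) = l.flatMap f := by
  conv_rhs => rw [← List.map_get_finRange l, List.flatMap_map]

theorem flatMap_finRange_eq_of_idle {n : ℕ} {v : Fin n} {t : Fin n → List T}
    (h : ∀ v', v' ≠ v → t v' = []) : (List.finRange n).flatMap t = t v := by
  have key : ∀ l : List (Fin n), l.Nodup → l.flatMap t = if v ∈ l then t v else [] := by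
    intro l
    induction l with
    | nil => simp
    | cons a l ih =>
      intro hl
      rw [List.nodup_cons] at hl
      rw [List.flatMap_cons, ih hl.2]
      by_cases ha : v = a
      · subst ha
        simp [hl.1]
      · simp [h a (Ne.symm ha), ha]
  rw [key _ (List.nodup_finRange n), if_pos (List.mem_finRange v)]

namespace LLG

variable (G : LLG.{u, v} T)

/-- A finite family of atoms that contains those of the lexicon. -/
structure AtomFamily where
  k : ℕ
  atom : Fin k → G.Atom
  bound : ℕ
  length_le : ∀ i, (G.ξ (atom i)).length ≤ bound
  exists_lex : ∀ α ∈ G.Lex, ∀ X ∈ α.1.flatMap Formula.leaves, ∃ i, atom i = X.atom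

/-- A finite lexicon mentions finitely many atoms, so their boundaries have bounded length. The
initial atom may be missing from the family; `derivableSets` is then empty there. -/
theorem nonempty_atomFamily : Nonempty G.AtomFamily := by
  have hfin : (⋃ α ∈ G.Lex, Formula.atom '' {X | X ∈ α.1.flatMap Formula.leaves}).Finite :=
    G.lex_finite.biUnion fun α _ => (List.finite_toSet _).image _
  obtain ⟨k, f, -, hf⟩ := hfin.fin_param
  obtain ⟨M, hM⟩ := (Set.finite_range fun i => (G.ξ (f i)).length).bddAbove
  exact ⟨⟨k, f, M, fun i => hM ⟨i, rfl⟩, fun α hα X hX => hf.ge (Set.mem_biUnion hα ⟨X, hX, rfl⟩)⟩⟩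

namespace AtomFamily

variable {G} (c : G.AtomFamily)

/-- The predicate symbols: an initial one, and the matchings of the boundaries of atoms. -/
abbrev Pred := Option (Bool × Fin c.k × (Fin (c.bound + 1) → Fin (c.bound + 1)))

/-- Boundaries of the family have at most `bound` vertices, so the last of the `bound + 1`
components is always idle and can take up unused variables. -/
def arity : c.Pred → ℕ
  | none => 1
  | some _ => c.bound + 1

abbrev slot (q : Placed G.Atom) : Slot G.Atom := toSlot G.ξ q

/-- The edges that are plugged into placed literals. -/
noncomputable def inputs (l : List (Placed G.Atom))
    (m : Fin l.length → Fin (c.bound + 1) → Fin (c.bound + 1))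
    (t : Fin l.length → Fin (c.bound + 1) → List T) : Set (Edge T) :=
  ⋃ j, push (slot (l.get j)).emb
    {e | e ∈ matchEdges (!(slot (l.get j)).sign) (G.ξ (slot (l.get j)).atom) (m j) (t j)}

/-- The production `p` computes the effect of the multiword `σ` on edges that are plugged into
the placed literals `l`. -/
def IsRule (σ : Set (Edge T)) (q : Placed G.Atom) (l : List (Placed G.Atom)) (i : Fin c.k)
    (f : Fin l.length → Fin c.k) (m : Fin l.length → Fin (c.bound + 1) → Fin (c.bound + 1))
    (p : Production T c.Pred c.arity) : Prop :=
  c.atom i = (slot q).atom ∧ (∀ j, c.atom (f j) = (slot (l.get j)).atom) ∧ ∃ μ args lin,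
    p = ⟨some ((slot q).sign, i, μ), l.length, fun j => some (!(slot (l.get j)).sign, f j, m j),
      args, lin⟩ ∧
    IsMatching (slot q).sign (G.ξ (slot q).atom) μ ∧
    ∀ t : Fin l.length → Fin (c.bound + 1) → List T,
      (∀ j, ∀ v ∈ idle (c.bound + 1) (!(slot (l.get j)).sign) (G.ξ (slot (l.get j)).atom), t j v = []) →
      ¬ Cyc σ (c.inputs l m t) ∧
      (∀ v ∈ idle (c.bound + 1) (slot q).sign (G.ξ (slot q).atom),
        substitute (fun x => t x.1 x.2) (args v) = []) ∧
      pull (slot q).emb ((slot q).dom G.ξ) (paths σ (c.inputs l m t)) =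
        {e | e ∈ matchEdges (slot q).sign (G.ξ (slot q).atom) μ
          fun v => substitute (fun x => t x.1 x.2) (args v)}

/-- A single input `t` without cycle suffices, because the absence of cycles depends only on the
matchings `m`; the rule obtained is valid for all inputs. -/
theorem exists_isRule {α : List (Formula G.Atom) × Multiword T} (hα : α ∈ G.Lex)
    (hfree : ∀ X ∈ α.1, X.TensorFree) {q : Placed G.Atom} {l : List (Placed G.Atom)}
    (hp : (place G.ξ 0 (α.1.flatMap Formula.leaves)).Perm (q :: l)) {i : Fin c.k}
    (hi : c.atom i = (slot q).atom) {f : Fin l.length → Fin c.k}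
    (hf : ∀ j, c.atom (f j) = (slot (l.get j)).atom)
    {m : Fin l.length → Fin (c.bound + 1) → Fin (c.bound + 1)}
    (hm : ∀ j, IsMatching (!(slot (l.get j)).sign) (G.ξ (slot (l.get j)).atom) (m j))
    {t : Fin l.length → Fin (c.bound + 1) → List T} (hcyc : ¬ Cyc α.2.edges (c.inputs l m t)) :
    ∃ p, c.IsRule α.2.edges q l i f m p := by
  classical
  have hlit : ∀ X ∈ α.1.flatMap Formula.leaves, X.IsLiteral := by
    intro X hX
    obtain ⟨Y, hY, hX⟩ := List.mem_flatMap.1 hX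
    exact (hfree Y hY).isLiteral_of_mem X hX
  obtain ⟨E, hE, hEs, hEt⟩ := (G.lex_typed α hα).exists_list
  have hEset : ({e | e ∈ E} : Set (Edge T)) = α.2.edges := Set.ext hE
  have hpos : ∀ b, (Boundary.positions b (Boundary.dual [] ++ seqInterp G.ξ α.1)).Perm
      ((slot q).vertices G.ξ b ++ (List.finRange l.length).flatMap fun j =>
        (slot (l.get j)).vertices G.ξ b) := by
    intro b
    have h1 := flatMap_vertices (ξ := G.ξ) b 0 hlit
    rw [seqInterp_flatMap_leaves] at h1
    simp only [zero_add, List.map_id'] at h1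
    refine h1.symm.trans ((hp.flatMap_right _).trans ?_)
    rw [List.flatMap_cons, flatMap_finRange_get l fun q => (slot q).vertices G.ξ b]
  have hinputs : ∀ t, c.inputs l m t = {e | e ∈ plugs G.ξ (fun j => slot (l.get j)) m t} :=
    fun t => (plugs_eq G.ξ (fun j => slot (l.get j)) m t).symm
  have hcyc' : ¬ Cyc {e | e ∈ symbolicEdges (SlotVar (c.bound + 1) l.length) E}
      {e | e ∈ symbolicPlugs G.ξ (fun j => slot (l.get j)) m T} := by
    rw [cyc_symbolic_iff _ _ _ t, hEset, ← hinputs]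
    exact hcyc
  have hlen := c.length_le i
  rw [hi] at hlen
  have hlen' := fun j => c.length_le (f j)
  simp only [hf] at hlen'
  obtain ⟨μ, args, hμ, hargs, hspec⟩ := exists_rule (s := slot q) (S := fun j => slot (l.get j))
    (z := Fin.last c.bound) (hlen.trans (Nat.le_succ _)) (fun j => (hlen' j).trans (Nat.le_succ _))
    hm (hEs.trans (hpos true)) (hEt.trans (hpos false)) (by
      rw [List.nodup_append']
      refine ⟨hEs.nodup_iff.2 (Boundary.nodup_positions _ _),
        hEt.nodup_iff.2 (Boundary.nodup_positions _ _), fun a h1 h2 => ?_⟩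
      have h1 := Boundary.mem_positions.1 (hEs.mem_iff.1 h1)
      have h2 := Boundary.mem_positions.1 (hEt.mem_iff.1 h2)
      rw [h1] at h2
      simp [pol] at h2) (by
      intro h
      have := Boundary.lt_of_getElem? (mem_active.1 h)
      rw [Fin.val_last] at this
      omega) hcyc'
  refine ⟨_, hi, hf, μ, args, hargs, rfl, hμ, fun t ht => ?_⟩
  obtain ⟨h1, h2⟩ := hspec t ht
  refine ⟨?_, h1, ?_⟩
  · rw [hinputs, ← hEset]
    rwa [cyc_symbolic_iff _ _ _ t] at hcyc'
  · rw [hinputs, ← hEset]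
    exact h2

/-- The production of the initial predicate symbol for a matching of the initial atom. -/
def startRule (i : Fin c.k) (μ : Fin (c.bound + 1) → Fin (c.bound + 1)) :
    Production T c.Pred c.arity where
  head := none
  n := 1
  body _ := some (true, i, μ)
  -- The boundary of the initial atom has one left endpoint, so all but one of the concatenated
  -- components are empty, while linearity requires all of them to occur.
  args _ := (List.finRange (c.bound + 1)).map fun v => .inr ⟨0, v⟩
  linear := by
    rintro ⟨j, v⟩
    obtain rfl := Fin.fin_one_eq_zero j
    show ∑ _ : Fin 1, _ = 1
    rw [Fin.sum_univ_one]
    classical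
    refine List.count_eq_one_of_mem ((List.nodup_finRange _).map fun v v' h => ?_)
      (List.mem_map.2 ⟨v, List.mem_finRange _, rfl⟩)
    simpa using h

/-- One production for each way to plug edges into all but the first of the placed literals. -/
noncomputable def rules (σ : Set (Edge T)) : List (Placed G.Atom) → Set (Production T c.Pred c.arity)
  | [] => ∅
  | q :: l => Set.range fun d : {d : Fin c.k × (Fin l.length → Fin c.k) ×
      (Fin l.length → Fin (c.bound + 1) → Fin (c.bound + 1)) //
        ∃ p, c.IsRule σ q l d.1 d.2.1 d.2.2 p} => d.2.choose

/-- The multiple context-free grammar of a linear logic grammar. -/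
noncomputable def toMCFG : MCFG T where
  N := c.Pred
  finite_N := inferInstance
  arity := c.arity
  arity_pos := by
    rintro (_ | _)
    exacts [one_pos, Nat.succ_pos _]
  S := none
  arity_S := rfl
  P := (Set.range fun d : {d : Fin c.k × (Fin (c.bound + 1) → Fin (c.bound + 1)) //
      c.atom d.1 = G.S} => c.startRule d.1.1 d.1.2) ∪
    -- Singular axioms are omitted: regular derivations do not use them.
    ⋃ α ∈ {α | α ∈ G.Lex ∧ α.2.IsRegular},
      ⋃ l ∈ {l : List (Placed G.Atom) | (place G.ξ 0 (α.1.flatMap Formula.leaves)).Perm l},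
        c.rules α.2.edges l
  finite_P := by
    refine (Set.finite_range _).union ((G.lex_finite.subset fun α h => h.1).biUnion fun α _ => ?_)
    refine Set.Finite.biUnion ?_ fun l _ => ?_
    · refine (List.finite_toSet (place G.ξ 0 (α.1.flatMap Formula.leaves)).permutations).subset
        fun l hl => List.mem_permutations.2 (List.Perm.symm hl)
    · cases l with
      | nil => exact Set.finite_empty
      | cons q l => exact Set.finite_range _

theorem mem_P {p : Production T c.Pred c.arity} : p ∈ c.toMCFG.P →
    (∃ i μ, c.atom i = G.S ∧ p = c.startRule i μ) ∨
    ∃ α ∈ G.Lex, α.2.IsRegular ∧ ∃ q l,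
      (place G.ξ 0 (α.1.flatMap Formula.leaves)).Perm (q :: l) ∧
      ∃ i f m, c.IsRule α.2.edges q l i f m p := by
  rintro (⟨d, rfl⟩ | h)
  · exact Or.inl ⟨_, _, d.2, rfl⟩
  · simp only [Set.mem_iUnion] at h
    obtain ⟨α, ⟨hα, hr⟩, l, hl, h⟩ := h
    cases l with
    | nil => exact h.elim
    | cons q l =>
      obtain ⟨d, rfl⟩ := h
      exact Or.inr ⟨α, hα, hr, q, l, hl, _, _, _, d.2.choose_spec⟩

theorem startRule_mem {i : Fin c.k} (hi : c.atom i = G.S)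
    (μ : Fin (c.bound + 1) → Fin (c.bound + 1)) : c.startRule i μ ∈ c.toMCFG.P :=
  Or.inl ⟨⟨(i, μ), hi⟩, rfl⟩

theorem exists_rule_mem {α : List (Formula G.Atom) × Multiword T} (hα : α ∈ G.Lex)
    (hr : α.2.IsRegular) {q : Placed G.Atom} {l : List (Placed G.Atom)}
    (hp : (place G.ξ 0 (α.1.flatMap Formula.leaves)).Perm (q :: l)) {i : Fin c.k}
    {f : Fin l.length → Fin c.k} {m : Fin l.length → Fin (c.bound + 1) → Fin (c.bound + 1)}
    (h : ∃ p, c.IsRule α.2.edges q l i f m p) :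
    ∃ p ∈ c.toMCFG.P, c.IsRule α.2.edges q l i f m p := by
  refine ⟨_, Or.inr ?_, h.choose_spec⟩
  simp only [Set.mem_iUnion]
  exact ⟨α, ⟨hα, hr⟩, q :: l, hp, ⟨⟨(i, f, m), h⟩, rfl⟩⟩

end AtomFamily

end LLG

theorem substitute_allVars {n : ℕ} (t : Fin 1 → Fin n → List T) :
    substitute (fun x : SlotVar n 1 => t x.1 x.2) ((List.finRange n).map fun v => .inr ⟨0, v⟩) =
      (List.finRange n).flatMap (t 0) := by
  rw [substitute, List.flatMap_map]
  rfl

namespace LLG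

variable {G : LLG.{u, v} T}

theorem exists_start_vertex (G : LLG.{u, v} T) {n : ℕ} (hn : (G.ξ G.S).length ≤ n) :
    ∃ v : Fin n, ∀ v', v' ∈ active n true (G.ξ G.S) ↔ v' = v := by
  obtain ⟨i, hi, hu⟩ := G.left_S
  refine ⟨⟨i, (Boundary.lt_of_getElem? hi).trans_le hn⟩, fun v' => ?_⟩
  rw [mem_active]
  constructor
  · exact fun h => Fin.ext (hu _ h)
  · rintro rfl
    exact hi

theorem realizes_lex_iff {α : List (Formula G.Atom) × Multiword T} (hα : α ∈ G.Lex)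
    (hfree : ∀ X ∈ α.1, X.TensorFree) {L : Bool → G.Atom → Set (Set (Edge T))}
    (hL : ∀ b p, ∀ d ∈ L b p, Typed b (G.ξ p) d) :
    Realizes G.ξ (realizers G.ξ L) (place G.ξ 0 α.1) α.2.edges ↔
      ∀ q l, (place G.ξ 0 (α.1.flatMap Formula.leaves)).Perm (q :: l) →
        ∀ t : Fin l.length → Set (Edge T),
        (∀ j, t j ∈ L (!(toSlot G.ξ (l.get j)).sign) (toSlot G.ξ (l.get j)).atom) →
        ¬ Cyc α.2.edges (⋃ j, push (toSlot G.ξ (l.get j)).emb (t j)) →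
        pull (toSlot G.ξ q).emb ((toSlot G.ξ q).dom G.ξ)
          (paths α.2.edges (⋃ j, push (toSlot G.ξ (l.get j)).emb (t j))) ∈
            L (toSlot G.ξ q).sign (toSlot G.ξ q).atom := by
  rw [← realizes_flatMap_leaves_iff hL (.of_isCowordism (G.lex_typed _ hα)),
    realizes_iff_toSlot hL]
  refine place_isLiteral fun X hX => ?_
  obtain ⟨Y, hY, hX⟩ := List.mem_flatMap.1 hX
  exact (hfree Y hY).isLiteral_of_mem X hX

/-! ### Correctness of the grammar read off from the lexicon -/

namespace AtomFamily

variable (c : G.AtomFamily)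

/-- The edge sets of derivable tuples. -/
def derivableSets (b : Bool) (p : G.Atom) : Set (Set (Edge T)) :=
  {d | ∃ i μ, ∃ t : Fin (c.bound + 1) → List T, c.atom i = p ∧ IsMatching b (G.ξ p) μ ∧
    (∀ v ∈ idle (c.bound + 1) b (G.ξ p), t v = []) ∧ c.toMCFG.Derivable (some (b, i, μ)) t ∧
    {e | e ∈ matchEdges b (G.ξ p) μ t} = d}

theorem typed_derivableSets : ∀ b p, ∀ d ∈ c.derivableSets b p, Typed b (G.ξ p) d := by
  rintro b p _ ⟨i, μ, t, -, hμ, -, -, rfl⟩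
  exact typed_matchEdges hμ t

/-- The productions were chosen for this: plugging derivable tuples into an axiom without closing a
cycle is one production step. -/
theorem realizes_derivableSets {α : List (Formula G.Atom) × Multiword T} (hα : α ∈ G.Lex)
    (hr : α.2.IsRegular) (hfree : ∀ X ∈ α.1, X.TensorFree) :
    Realizes G.ξ (realizers G.ξ c.derivableSets) (place G.ξ 0 α.1) α.2.edges := by
  rw [realizes_lex_iff hα hfree c.typed_derivableSets]
  intro q l hp d hd hcyc
  choose f m t hf hm ht hder hd' using hd
  have hlit : ∀ r ∈ place G.ξ 0 (α.1.flatMap Formula.leaves), r.1.IsLiteral := by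
    refine place_isLiteral fun X hX => ?_
    obtain ⟨Y, hY, hX⟩ := List.mem_flatMap.1 hX
    exact (hfree Y hY).isLiteral_of_mem X hX
  have hq := hp.mem_iff.2 List.mem_cons_self
  obtain ⟨i, hi⟩ := c.exists_lex α hα q.1 (place_fst_mem q hq)
  rw [← atom_toSlot (hlit q hq)] at hi
  have hinputs : (⋃ j, push (toSlot G.ξ (l.get j)).emb (d j)) = c.inputs l m t := by
    simp only [← hd']
    rfl
  rw [hinputs] at hcyc ⊢
  obtain ⟨p, hpP, -, -, μ, args, lin, rfl, hμ, hspec⟩ :=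
    c.exists_rule_mem hα hr hp (c.exists_isRule hα hfree hp hi hf hm hcyc)
  obtain ⟨-, h1, h2⟩ := hspec t ht
  rw [h2]
  exact ⟨i, μ, _, hi, hμ, h1, .production _ hpP t hder, rfl⟩

/-- The meaning of the predicates of the grammar in terms of derivable multiwords. -/
def Sound : (A : c.Pred) → (Fin (c.arity A) → List T) → Prop
  | none, t => t ⟨0, one_pos⟩ ∈ G.language
  | some (b, i, μ), t => IsMatching b (G.ξ (c.atom i)) μ ∧
      (∀ v ∈ idle (c.bound + 1) b (G.ξ (c.atom i)), t v = []) ∧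
      {e | e ∈ matchEdges b (G.ξ (c.atom i)) μ t} ∈ G.closedLiteral b (c.atom i)

/-- The axiom realizes its sequent over the closed multiwords of literals, so the edges that the
rule computes are again a closed derivable multiword, or the reflection of one for a negative sign.
-/
theorem sound_rule (hfree : G.TensorFreeLexicon) {α : List (Formula G.Atom) × Multiword T}
    (hα : α ∈ G.Lex) (hr : α.2.IsRegular) {q : Placed G.Atom} {l : List (Placed G.Atom)}
    (hp : (place G.ξ 0 (α.1.flatMap Formula.leaves)).Perm (q :: l)) {i : Fin c.k}
    {f : Fin l.length → Fin c.k} {m : Fin l.length → Fin (c.bound + 1) → Fin (c.bound + 1)}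
    {p : Production T c.Pred c.arity} (h : c.IsRule α.2.edges q l i f m p)
    {t : (j : Fin p.n) → Fin (c.arity (p.body j)) → List T} (ht : ∀ j, c.Sound (p.body j) (t j)) :
    c.Sound p.head fun v => substitute (fun x => t x.1 x.2) (p.args v) := by
  obtain ⟨hi, hf, μ, args, lin, rfl, hμ, hspec⟩ := h
  have ht' : ∀ j : Fin l.length, c.Sound (some (!(slot (l.get j)).sign, f j, m j)) (t j) := ht
  simp only [Sound, hf] at ht'
  obtain ⟨h1, h2, h3⟩ := hspec t fun j => (ht' j).2.1
  have h4 := (realizes_lex_iff hα (hfree α hα) typed_closedLiteral).1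
    (Derivable.realizes_closedLiteral (hfree α hα) (.lex hα) hr) q l hp _
    (fun j => (ht' j).2.2) h1
  show c.Sound (some ((slot q).sign, i, μ)) _
  simp only [Sound, hi]
  exact ⟨hμ, h2, Set.mem_of_eq_of_mem h3.symm h4⟩

theorem sound_start {i : Fin c.k} (hi : c.atom i = G.S)
    {μ : Fin (c.bound + 1) → Fin (c.bound + 1)} {t : Fin (c.bound + 1) → List T}
    (ht : c.Sound (some (true, i, μ)) t) : (List.finRange (c.bound + 1)).flatMap t ∈ G.language := by
  have hlen := c.length_le i
  simp only [Sound, hi] at ht hlen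
  obtain ⟨-, h1, σ, h2, h3, h4⟩ := ht
  obtain ⟨v, hv⟩ := G.exists_start_vertex (hlen.trans (Nat.le_succ _))
  refine ⟨σ, h2, h3, ⟨v, t v, μ v⟩, ?_, ?_⟩
  · rw [h4]
    exact List.mem_map.2 ⟨v, (hv v).2 rfl, rfl⟩
  · refine (flatMap_finRange_eq_of_idle fun v' hv' => h1 v' ?_).symm
    rw [mem_idle, hv]
    exact hv'

theorem sound_of_derivable (hfree : G.TensorFreeLexicon) {A : c.toMCFG.N}
    {t : Fin (c.toMCFG.arity A) → List T} (h : c.toMCFG.Derivable A t) : c.Sound A t := by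
  induction h with
  | production p hp t _ ih =>
    rcases c.mem_P hp with ⟨i, μ, hi, rfl⟩ | ⟨α, hα, hr, q, l, hl, i, f, m, h⟩
    · have h := c.sound_start hi (ih (0 : Fin 1))
      exact Set.mem_of_eq_of_mem (substitute_allVars (n := c.bound + 1) t) h
    · exact c.sound_rule hfree hα hr hl h ih

/-- One inclusion is the soundness of the predicates with respect to derivable multiwords. The other
is the realizability theorem with atoms interpreted by the derivable tuples. -/
theorem language_toMCFG (hfree : G.TensorFreeLexicon) : c.toMCFG.language = G.language := by
  ext w
  constructor
  · intro hw
    exact c.sound_of_derivable hfree hw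
  · rintro ⟨σ, hσ, hr, e, he, rfl⟩
    obtain ⟨i, μ, t, hi, -, h1, h2, h3⟩ := hσ.edges_mem hr (hσ.realizes c.typed_derivableSets
      (fun α hα hr' => c.realizes_derivableSets hα hr' (hfree α hα)) hr)
    rw [← h3] at he
    obtain ⟨v', hv', rfl⟩ := List.mem_map.1 he
    have hlen := c.length_le i
    rw [hi] at hlen
    obtain ⟨v, hv⟩ := G.exists_start_vertex (hlen.trans (Nat.le_succ c.bound))
    obtain rfl := (hv v').1 hv'
    have h4 := MCFG.Derivable.production (G := c.toMCFG) (c.startRule i μ) (c.startRule_mem hi μ)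
      (fun _ => t) fun _ => h2
    have h5 : (fun _ => substitute (fun x : SlotVar (c.bound + 1) 1 => t x.2)
        ((List.finRange (c.bound + 1)).map fun v => Sum.inr ⟨0, v⟩) : Fin 1 → List T) =
          fun _ => t v' := funext fun _ => (substitute_allVars fun _ => t).trans
      (flatMap_finRange_eq_of_idle fun v hv' => h1 v (by rw [mem_idle, hv]; exact hv'))
    show c.toMCFG.Derivable none fun _ : Fin 1 => t v'
    rw [← h5]
    exact h4

end AtomFamily

end LLG

end LinLog

theorem mainTheorem2 {T : Type u} [Finite T] (L : Language T) :
    (∃ G : LinLog.MCFG T, G.language = L) ↔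
      ∃ G : LinLog.LLG.{u, v} T, G.TensorFreeLexicon ∧ G.language = L := by
  constructor
  · rintro ⟨G, rfl⟩
    exact ⟨G.toLLG, G.tensorFreeLexicon_toLLG, LinLog.MCFG.language_toLLG⟩
  · rintro ⟨G, hfree, rfl⟩
    obtain ⟨c⟩ := G.nonempty_atomFamily
    exact ⟨c.toMCFG, c.language_toMCFG hfree⟩
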